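/- \textbf{Definitions.} For $x\in\mathbb{R}^n$ let $\|x\|_0$ be its number of nonzero entries; $x$ is $k$-sparse if $\|x\|_0\le k$. For a matrix $M$ and a set $B$ of row indices, $M_{B^c}$ consists of the rows of $M$ outside $B$; for $C\subseteq[n]$, $x_{C^c}$ consists of the entries of $x$ outside $C$. A matrix $M\in\mathbb{R}^{p\times n}$ is \emph{$(b,b',\eta,\tau)$-erasure-robust} if for every $B\subseteq[p]$ with $|B|\le b$ there is $C\subseteq[n]$ with $|C|\le b'$ such that every $x\in\mathbb{R}^n$ satisfies $\|x\|_0\ge\tau$ or $\|x_{C^c}\|_2\le\eta\|M_{B^c}x\|_\infty$. A subspace $V\subseteq\mathbb{R}^n$ is \emph{$(\delta,\eta,\tau)$-quantitatively dense} if for every $C\subseteq[n]$ with $|C|\le\tau$ and every $x\in\mathbb{R}^n$ with $\mathrm{dist}(x,V)\le\delta\|x\|_2$ one has $\|x_{C^c}\|_2\ge\eta\|x\|_2$. A \emph{preconditioner} is a matrix $S\in\mathbb{R}^{n\times s}$ with $\ker(S^T)=\{0\}$. Given $X\in\mathbb{R}^{m\times n}$ with rows $X_1,\dots,X_m$, the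 $S$-preconditioned Lasso \emph{fails} to recover $w^*\in\mathbb{R}^n$ if $w^*\notin\arg\min_{w\in\mathbb{R}^n:\,Xw=Xw^*}\|S^Tw\|_1$. \textbf{Theorem.} There are absolute constants $c,c_m,c_0>0$ such that the following holds. Let $n\ge r\ge 0$ and $k,k',m,t\ge1$ be integers, let $\tau,b,b',\eta,\epsilon>0$ be real, and let $M\in\mathbb{R}^{(n-r)\times n}$ have $k'$-sparse rows $M_1,\dots,M_{n-r}$. Put $\Theta=M^TM$ and $\tilde\Theta=\Theta+\epsilon I$, and suppose that $\Theta$ has smallest nonzero eigenvalue $\lambda$ (in particular $M\ne0$). Suppose that $M$ is $(b,b',\eta,\tau)$-erasure-robust, that $\ker M$ is $\left(\tfrac1{12\sqrt n},\tfrac1{2\sqrt n},b'\right)$-quantitatively dense, and that $$544\,n^{15/2}\,k\,\eta\,\|M\|_F\sqrt{\epsilon/\lambda}\le1,\qquad r>2m,\qquad m\ge c_m\log n,\qquad \epsilon<c\lambda/n^2 .$$ Let $\mathcal{D}_M$ be the law of $$\sum_{i=1}^t \frac{Z_i\,M_{R_i}}{\sqrt{M_{R_i}^T\tilde\Theta^{-1}M_{R_i}}},$$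 where $R_1,\dots,R_t$ are uniform on $[n-r]$ and $Z_1,\dots,Z_t$ are uniform on $[-1,1]$, all independent (a term with $M_{R_i}=0$ is read as $0$). Let $\mathcal{D}_k$ be the law of a random vector in $\mathbb{R}^n$ whose support is uniformly random among the sets of $\min(k,n)$ coordinates and whose entries on the support are independent $N(0,1)$. Let $\mathcal{D}=\tfrac12\mathcal{D}_M+\tfrac12\mathcal{D}_k$. Then $\mathcal{D}$ is a probability distribution, almost every $w^*\sim\mathcal{D}$ is $\max(k't,k)$-sparse, and for every $s$ and every preconditioner $S\in\mathbb{R}^{n\times s}$ with $(n/\tau)\log(sn)<k$, with probability at least $$\frac12\min\left(1-e^{-bt/(n-r)}-\frac1n,\ \ 1-\frac2n-\frac{kb'}n-e^{-k(r-2m)/n}\right)$$ over $w^*\sim\mathcal{D}$, the $S$-preconditioned Lasso fails to recover $w^*$ with probability at least $$1-\frac{4m}{3r}-e^{-c_0m}$$ over independent samples $X_1,\dots,X_m\sim N(0,\tilde\Theta^{-1})$. -/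

import Mathlib

open MeasureTheory ProbabilityTheory
open scoped ENNReal Matrix

namespace PrecLasso

noncomputable section

/-- The support `{i | x i ≠ 0}` of a vector. -/
def supp {n : ℕ} (x : EuclideanSpace ℝ (Fin n)) : Finset (Fin n) :=
  Finset.univ.filter fun i => x i ≠ 0

/-- The vector `x` restricted to the coordinates outside `C` (extended by zero). -/
def restrictCompl {n : ℕ} (C : Finset (Fin n)) (x : EuclideanSpace ℝ (Fin n)) :
    EuclideanSpace ℝ (Fin n) :=
  WithLp.toLp 2 fun i => if i ∈ C then 0 else x i

/-- `(b, b', η, τ)`-erasure-robustness of `M ∈ ℝ^{p × n}`. The norm on the right is the sup norm of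
the entries of `M x` whose index lies outside `B`. -/
def ErasureRobust {p n : ℕ} (M : Matrix (Fin p) (Fin n) ℝ) (b b' η τ : ℝ) : Prop :=
  ∀ B : Finset (Fin p), (B.card : ℝ) ≤ b →
    ∃ C : Finset (Fin n), (C.card : ℝ) ≤ b' ∧
      ∀ x : EuclideanSpace ℝ (Fin n),
        τ ≤ ((supp x).card : ℝ) ∨
          ‖restrictCompl C x‖ ≤ η * ‖fun i : {i : Fin p // i ∉ B} => (M *ᵥ x.ofLp) i‖

/-- `(δ, η, τ)`-quantitative density of a subspace of `ℝⁿ`. -/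
def QuantitativelyDense {n : ℕ} (V : Submodule ℝ (EuclideanSpace ℝ (Fin n))) (δ η τ : ℝ) : Prop :=
  ∀ C : Finset (Fin n), (C.card : ℝ) ≤ τ →
    ∀ x : EuclideanSpace ℝ (Fin n),
      Metric.infDist x (V : Set (EuclideanSpace ℝ (Fin n))) ≤ δ * ‖x‖ →
        η * ‖x‖ ≤ ‖restrictCompl C x‖

/-- The null space of `M`, as a subspace of Euclidean space. -/
def kernel {p n : ℕ} (M : Matrix (Fin p) (Fin n) ℝ) : Submodule ℝ (EuclideanSpace ℝ (Fin n)) :=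
  LinearMap.ker (Matrix.toLpLin 2 2 M)

/-- The Frobenius norm. -/
def frobNorm {p n : ℕ} (M : Matrix (Fin p) (Fin n) ℝ) : ℝ :=
  Real.sqrt (∑ i, ∑ j, M i j ^ 2)

/-- `lam` is the smallest nonzero eigenvalue of the square matrix `A`. -/
def IsSmallestNonzeroEigenvalue {n : ℕ} (A : Matrix (Fin n) (Fin n) ℝ) (lam : ℝ) : Prop :=
  IsLeast {μ : ℝ | μ ≠ 0 ∧ Module.End.HasEigenvalue (Matrix.toLin' A) μ} lam

/-- The covariance matrix `(Mᵀ M + ε I)⁻¹`. -/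
def covMat {p n : ℕ} (M : Matrix (Fin p) (Fin n) ℝ) (ε : ℝ) : Matrix (Fin n) (Fin n) ℝ :=
  (Mᵀ * M + ε • (1 : Matrix (Fin n) (Fin n) ℝ))⁻¹

/-- A preconditioner is a matrix `S ∈ ℝ^{n × s}` with `ker Sᵀ = {0}`. -/
def IsPreconditioner {n s : ℕ} (S : Matrix (Fin n) (Fin s) ℝ) : Prop :=
  ∀ w : Fin n → ℝ, Sᵀ *ᵥ w = 0 → w = 0

/-- The objective `‖Sᵀ w‖₁`. -/
def objective {n s : ℕ} (S : Matrix (Fin n) (Fin s) ℝ) (w : EuclideanSpace ℝ (Fin n)) : ℝ :=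
  ∑ j, |(Sᵀ *ᵥ w.ofLp) j|

/-- The set of optimal solutions of the `S`-preconditioned Lasso on the samples `(X i, y i)`:
minimize `‖Sᵀ w‖₁` subject to `⟨X i, w⟩ = y i` for all `i`. -/
def lassoSolutions {n s m : ℕ} (S : Matrix (Fin n) (Fin s) ℝ)
    (X : Fin m → EuclideanSpace ℝ (Fin n)) (y : Fin m → ℝ) : Set (EuclideanSpace ℝ (Fin n)) :=
  {w | (∀ i, inner ℝ (X i) w = y i) ∧
    ∀ v : EuclideanSpace ℝ (Fin n), (∀ i, inner ℝ (X i) v = y i) → objective S w ≤ objective S v}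

/-- On the covariates `X` and the noiseless responses `⟨X i, w⟩`, the `S`-preconditioned Lasso
fails to recover `w`: the signal is not an optimal solution. -/
def LassoFails {n s m : ℕ} (S : Matrix (Fin n) (Fin s) ℝ)
    (X : Fin m → EuclideanSpace ℝ (Fin n)) (w : EuclideanSpace ℝ (Fin n)) : Prop :=
  w ∉ lassoSolutions S X fun i => inner ℝ (X i) w

/-- The law of `m` independent covariates with distribution `N(0, A)`. -/
def sampleLaw {n : ℕ} (A : Matrix (Fin n) (Fin n) ℝ) (m : ℕ) :
    Measure (Fin m → EuclideanSpace ℝ (Fin n)) :=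
  Measure.pi fun _ => multivariateGaussian 0 A

/-- The row `M i` divided by `√(M iᵀ (Mᵀ M + ε I)⁻¹ M i)` (a zero row stays zero). -/
def normalizedRow {p n : ℕ} (M : Matrix (Fin p) (Fin n) ℝ) (ε : ℝ) (i : Fin p) :
    EuclideanSpace ℝ (Fin n) :=
  (Real.sqrt (M i ⬝ᵥ (covMat M ε *ᵥ M i)))⁻¹ • WithLp.toLp 2 (M i)

/-- The law of `∑ i, Z i • normalizedRow (R i)`, where `R 1, …, R t` are uniformly random row indices
and `Z 1, …, Z t` are uniform on `[-1, 1]`, all independent. -/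
def rowCombinationLaw {p n : ℕ} (M : Matrix (Fin p) (Fin n) ℝ) (ε : ℝ) (t : ℕ) :
    Measure (EuclideanSpace ℝ (Fin n)) :=
  ((Measure.pi fun _ : Fin t => uniformOn (Set.univ : Set (Fin p))).prod
      (Measure.pi fun _ : Fin t => cond (volume : Measure ℝ) (Set.Icc (-1) 1))).map
    fun ω => ∑ i, ω.2 i • normalizedRow M ε (ω.1 i)

/-- The law of a random signal in `ℝⁿ` whose support set `K` is uniform among the `k`-element sets of
coordinates (all coordinates when `k ≥ n`) and whose entries on `K` are independent `N(0, 1)`. -/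
def sparseGaussianLaw (n k : ℕ) : Measure (EuclideanSpace ℝ (Fin n)) :=
  (((Finset.univ : Finset (Fin n)).powersetCard (min k n)).card : ℝ≥0∞)⁻¹ •
    ∑ K ∈ (Finset.univ : Finset (Fin n)).powersetCard (min k n),
      (Measure.pi fun _ : Fin n => gaussianReal 0 1).map
        fun g => (WithLp.toLp 2 fun i => if i ∈ K then g i else 0 : EuclideanSpace ℝ (Fin n))

/-- With probability `1/2` a random combination of `t` normalized rows of `M`, with probability `1/2`
a uniformly random `k`-sparse Gaussian signal. -/
def signalLaw {p n : ℕ} (M : Matrix (Fin p) (Fin n) ℝ) (ε : ℝ) (k t : ℕ) :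
    Measure (EuclideanSpace ℝ (Fin n)) :=
  (2 : ℝ≥0∞)⁻¹ • rowCombinationLaw M ε t + (2 : ℝ≥0∞)⁻¹ • sparseGaussianLaw n k

end

end PrecLasso

/-!
Write `F w = ‖Sᵀ w‖₁`, `Σ = (Mᵀ M + ε I)⁻¹` and `G w = √(wᵀ Σ w)`, the standard deviation of a
response `⟨X, w⟩`. Let `K` be, up to a factor `2`, the least constant such that `F ≤ K ‖·‖` on
some `2 m`-dimensional subspace `U` of `ker M` (`exists_width`). Along `ker M` the samples have
variance `1 / ε`, and a union bound over a grid (`sampleLaw_small_combination_le`) shows that with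
high probability no combination of the samples has a small component in `U` relative to its
coefficients. By duality, any responses `y` are interpolated by some `u ∈ U` with `‖u‖` of order
`√ε √m ‖y‖₁` (`exists_interpolant`). Hence the Lasso fails on every signal `w` with
`F w > L * G w`, where `L` is of order `K √ε n ^ (3 / 2)`
(`sampleLaw_not_lassoFails_le_of_large`).

Let `B` be the set of rows `i` for which `F` is at least `100 n ^ (5 / 2) * L` at the `i`-th
normalized row, which has `G ≤ 1`. There are two cases.

If `B` has at least `b` elements, a random combination of normalized rows involves a row of `B`
with probability at least `1 - exp (-b t / (n - r))`, and then anticoncentration of its uniform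
coefficient gives `F w > L * G w` up to an error probability `1 / n` (`prod_rows_seminorm_le`).
When the number `t` of terms is so large that `G w` is of larger order than one term, the same row
is drawn many times, and anticoncentration of the binomial distribution replaces that of a single
coefficient.

If `B` has at most `b` elements, let `C` be the set of coordinates that erasure-robustness
attaches to `B`, and let `w` be a sparse Gaussian signal. Typically `w` is orthogonal to no column
of `S` with at least `τ` nonzero entries, and `F w / ‖w‖` is at least of order `K / (n ^ 2 √k)`,
because `F` is at least `K / √n` at more than `r - 2 m` basis vectors
(`finrank_lt_card_large_add`, `sparseGaussianLaw_atypical_le`). If the Lasso recovers `w`, the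
Hahn–Banach theorem provides a subgradient `g` of `F` at `w` in the span of the samples
(`exists_certificate`), and `‖g‖` is at least `F w / ‖w‖`. Outside `C`, the vector `g` equals
`∑ j, sign ⟨S_j, w⟩ S_j` up to the total mass of the sparse columns, which robustness bounds by
`η ∑ F (M_i)` over the rows outside `B` (`sum_norm_restrictCompl_column_le`). Moreover `g` is
close to `ker M`, because orthogonally to `ker M` the samples have variance at most `1 / λ`, far
below `1 / ε` (`norm_sub_starProjection_le`). By quantitative density of `ker M` these two
properties determine `g` up to a small relative error (`norm_starProjection_sub_lt`), so the span
of the samples, projected to `ker M`, comes close to a vector that depends on `w` only. The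
projected samples are rotation invariant and `ker M` has dimension at least `r`, so this has
probability at most `4 m / (3 r)` (`sampleLaw_spanNear_le`).
-/

namespace PrecLasso

/-! ### Product measures and one-dimensional estimates -/

section ProductMeasures

variable {ι : Type*} [Fintype ι] {X : ι → Type*} [∀ i, MeasurableSpace (X i)]
  (μ : ∀ i, Measure (X i)) [∀ i, IsProbabilityMeasure (μ i)]

/-- Under a product of probability measures, a single coordinate may be drawn afresh. -/
theorem lintegral_pi_update [DecidableEq ι] (i : ι) {f : (∀ i, X i) → ℝ≥0∞} (hf : Measurable f) :
    ∫⁻ g, f g ∂Measure.pi μ = ∫⁻ g, ∫⁻ x, f (Function.update g i x) ∂μ i ∂Measure.pi μ := by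
  have hm : Measurable (∫⋯∫⁻_{i}, f ∂μ) := hf.lmarginal μ
  have h := lintegral_eq_of_lmarginal_eq (μ := μ) {i} hf hm (by
    ext g
    rw [lmarginal_singleton (μ := μ) (∫⋯∫⁻_{i}, f ∂μ) i]
    simp_rw [lmarginal_update_of_mem (μ := μ) (Finset.mem_singleton_self i)]
    simp)
  rw [h]
  simp_rw [lmarginal_singleton]

/-- A set whose one-dimensional slices in direction `i` are small is small. -/
theorem measure_pi_le_lintegral_of_slices [DecidableEq ι] (i : ι) {A : Set (∀ i, X i)}
    (hA : MeasurableSet A) (q : (∀ i, X i) → ℝ≥0∞)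
    (h : ∀ g, μ i {x | Function.update g i x ∈ A} ≤ q g) :
    Measure.pi μ A ≤ ∫⁻ g, q g ∂Measure.pi μ := by
  rw [← lintegral_indicator_one hA, lintegral_pi_update μ i (measurable_one.indicator hA)]
  refine lintegral_mono fun g => ?_
  refine le_trans (le_of_eq ?_) (h g)
  have hmeas : MeasurableSet {x | Function.update g i x ∈ A} := (measurable_update g) hA
  rw [← lintegral_indicator_one hmeas]
  rfl

theorem measure_pi_le_of_slices [DecidableEq ι] (i : ι) {A : Set (∀ i, X i)}
    (hA : MeasurableSet A) (q : ℝ≥0∞)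
    (h : ∀ g, μ i {x | Function.update g i x ∈ A} ≤ q) : Measure.pi μ A ≤ q := by
  simpa using measure_pi_le_lintegral_of_slices μ i hA (fun _ => q) h

theorem lintegral_pi_prod {φ : ∀ i, X i → ℝ≥0∞} (hφ : ∀ i, Measurable (φ i)) :
    ∫⁻ g, ∏ i, φ i (g i) ∂Measure.pi μ = ∏ i, ∫⁻ x, φ i x ∂μ i := by
  have h := lintegral_prod_eq_prod_lintegral_of_indepFun (μ := Measure.pi μ) Finset.univ
    (fun i g => φ i (g i)) (iIndepFun_pi fun i => (hφ i).aemeasurable)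
    (fun i => (hφ i).comp (measurable_pi_apply i))
  rw [h]
  refine Finset.prod_congr rfl fun i _ => ?_
  exact (measurePreserving_eval μ i).lintegral_comp (hφ i)

end ProductMeasures

/-- Exponential Markov inequality. -/
theorem measure_le_exp_mul_lintegral {Ω : Type*} [MeasurableSpace Ω] (μ : Measure Ω)
    {f : Ω → ℝ} (hf : Measurable f) (a : ℝ) :
    μ {ω | a ≤ f ω} ≤ ENNReal.ofReal (Real.exp (-a)) *
      ∫⁻ ω, ENNReal.ofReal (Real.exp (f ω)) ∂μ := by
  have h := mul_meas_ge_le_lintegral (μ := μ)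
    (f := fun ω => ENNReal.ofReal (Real.exp (f ω))) (by fun_prop)
    (ENNReal.ofReal (Real.exp a))
  have hset : {ω | a ≤ f ω} =
      {ω | ENNReal.ofReal (Real.exp a) ≤ ENNReal.ofReal (Real.exp (f ω))} := by
    ext ω
    simp [ENNReal.ofReal_le_ofReal_iff (Real.exp_pos _).le]
  rw [hset]
  calc _ = ENNReal.ofReal (Real.exp (-a)) * (ENNReal.ofReal (Real.exp a) *
        μ {ω | ENNReal.ofReal (Real.exp a) ≤ ENNReal.ofReal (Real.exp (f ω))}) := by
        rw [← mul_assoc, ← ENNReal.ofReal_mul (Real.exp_pos _).le, ← Real.exp_add]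
        simp
    _ ≤ _ := by gcongr

theorem volume_le_of_forall_abs_sub_le {s : Set ℝ} {d : ℝ} (h : ∀ x ∈ s, ∀ y ∈ s, |x - y| ≤ d) :
    volume s ≤ ENNReal.ofReal d := by
  refine (Real.volume_le_diam s).trans (Metric.ediam_le fun x hx y hy => ?_)
  rw [edist_dist, Real.dist_eq]
  exact ENNReal.ofReal_le_ofReal (h x hx y hy)

theorem gaussianPDFReal_le_half (x : ℝ) : gaussianPDFReal 0 1 x ≤ 1 / 2 := by
  rw [gaussianPDFReal]
  have h1 : (2 : ℝ) ≤ √(2 * Real.pi * (1 : NNReal)) := by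
    apply Real.le_sqrt_of_sq_le
    have := Real.pi_gt_three
    norm_num; linarith
  have h2 : Real.exp (-(x - 0) ^ 2 / (2 * (1 : NNReal))) ≤ 1 := by
    apply Real.exp_le_one_iff.2
    exact div_nonpos_of_nonpos_of_nonneg (neg_nonpos.2 (sq_nonneg _)) (by positivity)
  calc _ ≤ (2 : ℝ)⁻¹ * 1 := by gcongr
    _ = 1 / 2 := by norm_num

theorem gaussianReal_le_of_forall_abs_sub_le {s : Set ℝ} {d : ℝ}
    (h : ∀ x ∈ s, ∀ y ∈ s, |x - y| ≤ d) : gaussianReal 0 1 s ≤ ENNReal.ofReal (d / 2) := by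
  rw [gaussianReal_apply _ one_ne_zero]
  calc ∫⁻ x in s, gaussianPDF 0 1 x ≤ ∫⁻ _ in s, ENNReal.ofReal (1 / 2) := by
        exact lintegral_mono fun x => ENNReal.ofReal_le_ofReal (gaussianPDFReal_le_half x)
    _ = ENNReal.ofReal (1 / 2) * volume s := by simp
    _ ≤ ENNReal.ofReal (1 / 2) * ENNReal.ofReal d := by
        gcongr; exact volume_le_of_forall_abs_sub_le h
    _ = _ := by rw [← ENNReal.ofReal_mul (by norm_num)]; congr 1; ring

/-- The uniform distribution on `[-1, 1]`. -/
noncomputable abbrev uniformLaw : Measure ℝ := cond (volume : Measure ℝ) (Set.Icc (-1) 1)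

instance : IsProbabilityMeasure uniformLaw :=
  cond_isProbabilityMeasure_of_finite (by simp) (by simp)

theorem uniformLaw_le_of_forall_abs_sub_le {s : Set ℝ} {d : ℝ}
    (h : ∀ x ∈ s, ∀ y ∈ s, |x - y| ≤ d) : uniformLaw s ≤ ENNReal.ofReal (d / 2) := by
  rw [uniformLaw, cond_apply measurableSet_Icc]
  calc _ ≤ (ENNReal.ofReal 2)⁻¹ * ENNReal.ofReal d := by
        gcongr
        · simp; norm_num
        · exact (measure_mono Set.inter_subset_right).trans (volume_le_of_forall_abs_sub_le h)
    _ = _ := by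
      rw [mul_comm, ← div_eq_mul_inv, ENNReal.ofReal_div_of_pos (by norm_num)]

/-- Bounded exponential square moment of a Gaussian whose variance is at most `v`. -/
theorem lintegral_exp_sq_gaussianReal_le (σ : NNReal) {v : ℝ} (hσ : (σ : ℝ) ≤ v) :
    ∫⁻ x, ENNReal.ofReal (Real.exp (x ^ 2 / (4 * v))) ∂gaussianReal 0 σ ≤
      ENNReal.ofReal (√2) := by
  by_cases h0 : σ = 0
  · subst h0
    simp only [gaussianReal_zero_var]
    rw [lintegral_dirac]
    simp
  have hσ0 : (0 : ℝ) < σ := by positivity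
  rw [gaussianReal_of_var_ne_zero _ h0,
    lintegral_withDensity_eq_lintegral_mul _ (measurable_gaussianPDF _ _) (by fun_prop)]
  -- the weighted density is at most `√2` times the density of `N(0, 2σ)`
  calc _ ≤ ∫⁻ x, ENNReal.ofReal (√2) * gaussianPDF 0 (2 * σ) x := by
        refine lintegral_mono fun x => ?_
        simp only [Pi.mul_apply, gaussianPDF]
        rw [← ENNReal.ofReal_mul (gaussianPDFReal_nonneg _ _ _),
          ← ENNReal.ofReal_mul (by positivity)]
        apply ENNReal.ofReal_le_ofReal
        simp only [gaussianPDFReal, sub_zero, NNReal.coe_mul, NNReal.coe_ofNat]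
        have e1 : √(2 * Real.pi * (2 * σ)) = √2 * √(2 * Real.pi * σ) := by
          rw [← Real.sqrt_mul (by norm_num)]; congr 1; ring
        rw [e1, mul_inv, ← mul_assoc, ← mul_assoc, mul_inv_cancel₀ (by positivity), one_mul,
          mul_assoc, ← Real.exp_add]
        gcongr
        have : x ^ 2 / (4 * v) ≤ x ^ 2 / (4 * σ) := by gcongr
        calc _ ≤ -x ^ 2 / (2 * σ) + x ^ 2 / (4 * σ) := by gcongr
          _ = _ := by field_simp; ring
    _ = _ := by
        rw [lintegral_const_mul _ (measurable_gaussianPDF _ _),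
          lintegral_gaussianPDF_eq_one _ (by positivity), mul_one]

/-- Small-ball estimate for a Gaussian in exponential form, uniform in the centre. -/
theorem lintegral_exp_neg_sq_gaussianReal_le {s : ℝ} (hs : 0 < s) (q : ℝ) :
    ∫⁻ x, ENNReal.ofReal (Real.exp (-(s * (x + q) ^ 2))) ∂gaussianReal 0 1 ≤
      ENNReal.ofReal (√(2 * s))⁻¹ := by
  rw [gaussianReal_of_var_ne_zero _ one_ne_zero,
    lintegral_withDensity_eq_lintegral_mul _ (measurable_gaussianPDF _ _) (by fun_prop)]
  have hv : (2 * s).toNNReal⁻¹ ≠ 0 := by positivity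
  -- the weight is a multiple of the density of `N(-q, 1 / (2 s))`
  calc _ ≤ ∫⁻ x, ENNReal.ofReal (√(2 * s))⁻¹ * gaussianPDF (-q) ((2 * s).toNNReal⁻¹) x := by
        refine lintegral_mono fun x => ?_
        simp only [Pi.mul_apply, gaussianPDF]
        rw [← ENNReal.ofReal_mul (gaussianPDFReal_nonneg _ _ _),
          ← ENNReal.ofReal_mul (by positivity)]
        apply ENNReal.ofReal_le_ofReal
        simp only [gaussianPDFReal, sub_zero, NNReal.coe_inv, NNReal.coe_one, sub_neg_eq_add,
          Real.coe_toNNReal _ (show 0 ≤ 2 * s by positivity), mul_one]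
        have e1 : √(2 * Real.pi) = √(2 * s) * √(2 * Real.pi * (2 * s)⁻¹) := by
          rw [← Real.sqrt_mul (by positivity)]; congr 1; field_simp
        have e2 : -(x + q) ^ 2 / (2 * (2 * s)⁻¹) = -(s * (x + q) ^ 2) := by field_simp
        rw [e2, e1, mul_inv, mul_assoc, mul_assoc]
        have : Real.exp (-x ^ 2 / 2) ≤ 1 := by
          apply Real.exp_le_one_iff.2
          have := sq_nonneg x
          linarith
        gcongr
        nlinarith [Real.exp_pos (-(s * (x + q) ^ 2))]
    _ = _ := by
        rw [lintegral_const_mul _ (measurable_gaussianPDF _ _),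
          lintegral_gaussianPDF_eq_one _ hv, mul_one]

/-- The central binomial coefficient is at most `4 ^ m / √(2 m + 1)`. -/
theorem centralBinom_sq_mul_le (m : ℕ) : m.centralBinom ^ 2 * (2 * m + 1) ≤ 16 ^ m := by
  induction m with
  | zero => simp
  | succ m ih =>
    have h := Nat.succ_mul_centralBinom_succ m
    have h2 : (m + 1) ^ 2 * ((m + 1).centralBinom ^ 2 * (2 * (m + 1) + 1)) ≤
        (m + 1) ^ 2 * 16 ^ (m + 1) := by
      calc _ = ((m + 1) * (m + 1).centralBinom) ^ 2 * (2 * m + 3) := by ring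
        _ = (4 * (2 * m + 1) * (2 * m + 3)) * (m.centralBinom ^ 2 * (2 * m + 1)) := by rw [h]; ring
        _ ≤ (16 * (m + 1) ^ 2) * 16 ^ m := Nat.mul_le_mul (by nlinarith) ih
        _ = _ := by ring
    exact Nat.le_of_mul_le_mul_left h2 (by positivity)

/-- Every binomial coefficient is at most `2 ^ N / √(N + 1)`. -/
theorem choose_sq_mul_le (N j : ℕ) : N.choose j ^ 2 * (N + 1) ≤ 4 ^ N := by
  have hmid := Nat.choose_le_middle j N
  rcases Nat.even_or_odd' N with ⟨m, rfl | rfl⟩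
  · have e : (2 * m).choose (2 * m / 2) = m.centralBinom := by
      rw [Nat.centralBinom]; congr 1; omega
    calc _ ≤ m.centralBinom ^ 2 * (2 * m + 1) := by rw [← e]; gcongr
      _ ≤ 16 ^ m := centralBinom_sq_mul_le m
      _ = 4 ^ (2 * m) := by rw [pow_mul]; norm_num
  · have e : (2 * m + 1) / 2 = m := by omega
    rw [e] at hmid
    have h2 : 2 * (2 * m + 1).choose m = (m + 1).centralBinom := by
      rw [Nat.centralBinom, show 2 * (m + 1) = 2 * m + 1 + 1 by ring, Nat.choose_succ_succ,
        Nat.choose_symm_half]; ring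
    have h3 := centralBinom_sq_mul_le (m + 1)
    rw [← h2] at h3
    have : 4 * ((2 * m + 1).choose j ^ 2 * (2 * m + 1 + 1)) ≤ 4 * 4 ^ (2 * m + 1) := by
      calc _ ≤ 4 * ((2 * m + 1).choose m ^ 2 * (2 * (m + 1) + 1)) := by gcongr; omega
        _ = (2 * (2 * m + 1).choose m) ^ 2 * (2 * (m + 1) + 1) := by ring
        _ ≤ _ := h3
        _ = _ := by rw [show (16 : ℕ) = 4 ^ 2 by norm_num, ← pow_mul]; ring
    omega

/-! ### The covariance matrix -/

section Covariance

variable {p n : ℕ} (M : Matrix (Fin p) (Fin n) ℝ) {ε lam : ℝ}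

theorem inner_eq_dotProduct (x y : EuclideanSpace ℝ (Fin n)) :
    inner ℝ x y = x.ofLp ⬝ᵥ y.ofLp := by
  rw [EuclideanSpace.inner_eq_star_dotProduct, star_trivial, dotProduct_comm]

theorem mem_kernel_iff {x : EuclideanSpace ℝ (Fin n)} : x ∈ kernel M ↔ M *ᵥ x.ofLp = 0 := by
  rw [kernel, LinearMap.mem_ker, Matrix.toLpLin_apply, WithLp.toLp_eq_zero]

theorem le_finrank_kernel : n - p ≤ Module.finrank ℝ (kernel M) := by
  have h := LinearMap.finrank_range_add_finrank_ker (Matrix.toLpLin 2 2 M)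
  have h2 := Submodule.finrank_le (LinearMap.range (Matrix.toLpLin 2 2 M))
  rw [finrank_euclideanSpace, Fintype.card_fin] at h h2
  have h3 : Module.finrank ℝ (LinearMap.ker (Matrix.toLpLin 2 2 M)) =
    Module.finrank ℝ (kernel M) := rfl
  omega

theorem inner_row_eq (i : Fin p) (x : EuclideanSpace ℝ (Fin n)) :
    inner ℝ (WithLp.toLp 2 (M i) : EuclideanSpace ℝ (Fin n)) x = (M *ᵥ x.ofLp) i := by
  rw [inner_eq_dotProduct]; rfl

theorem row_mem_orthogonal_kernel (i : Fin p) :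
    (WithLp.toLp 2 (M i) : EuclideanSpace ℝ (Fin n)) ∈ (kernel M)ᗮ := by
  rw [Submodule.mem_orthogonal']
  intro u hu
  rw [inner_row_eq, (mem_kernel_iff M).1 hu]; rfl

theorem posDef_gram_add (hε : 0 < ε) :
    (Mᵀ * M + ε • (1 : Matrix (Fin n) (Fin n) ℝ)).PosDef := by
  have h1 : (Mᵀ * M).PosSemidef := by
    simpa using Matrix.posSemidef_conjTranspose_mul_self M
  exact Matrix.PosDef.posSemidef_add h1 (Matrix.PosDef.one.smul hε)

theorem posDef_covMat (hε : 0 < ε) : (covMat M ε).PosDef := (posDef_gram_add M hε).inv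

theorem gram_mulVec_covMat_mulVec (hε : 0 < ε) (x : Fin n → ℝ) :
    Mᵀ *ᵥ (M *ᵥ (covMat M ε *ᵥ x)) + ε • (covMat M ε *ᵥ x) = x := by
  have hdet : IsUnit (Mᵀ * M + ε • (1 : Matrix (Fin n) (Fin n) ℝ)).det :=
    (posDef_gram_add M hε).det_pos.ne'.isUnit
  have h : (Mᵀ * M + ε • (1 : Matrix (Fin n) (Fin n) ℝ)) *ᵥ (covMat M ε *ᵥ x) = x := by
    rw [covMat, Matrix.mulVec_mulVec, Matrix.mul_nonsing_inv _ hdet, Matrix.one_mulVec]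
  rw [Matrix.add_mulVec, Matrix.smul_mulVec, Matrix.one_mulVec] at h
  rwa [Matrix.mulVec_mulVec]

theorem covMat_mulVec_of_mem_kernel (hε : 0 < ε) {u : EuclideanSpace ℝ (Fin n)}
    (hu : u ∈ kernel M) : covMat M ε *ᵥ u.ofLp = ε⁻¹ • u.ofLp := by
  have hdet : IsUnit (Mᵀ * M + ε • (1 : Matrix (Fin n) (Fin n) ℝ)).det :=
    (posDef_gram_add M hε).det_pos.ne'.isUnit
  have h : (Mᵀ * M + ε • (1 : Matrix (Fin n) (Fin n) ℝ)) *ᵥ u.ofLp = ε • u.ofLp := by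
    rw [Matrix.add_mulVec, ← Matrix.mulVec_mulVec, (mem_kernel_iff M).1 hu, Matrix.mulVec_zero,
      Matrix.smul_mulVec, Matrix.one_mulVec, zero_add]
  have h2 : u.ofLp = ε • (covMat M ε *ᵥ u.ofLp) := by
    rw [← Matrix.mulVec_smul, ← h, covMat, Matrix.mulVec_mulVec, Matrix.nonsing_inv_mul _ hdet,
      Matrix.one_mulVec]
  rw [eq_inv_smul_iff₀ hε.ne', ← h2]

open scoped MatrixOrder in
/-- The square root of the covariance matrix: `‖covSqrt M ε x‖` is the standard deviation of
`⟨X, x⟩` for `X ∼ N(0, (Mᵀ M + ε I)⁻¹)`. -/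
noncomputable def covSqrt (ε : ℝ) : EuclideanSpace ℝ (Fin n) →L[ℝ] EuclideanSpace ℝ (Fin n) :=
  Matrix.toEuclideanCLM (𝕜 := ℝ) (CFC.sqrt (covMat M ε))

open scoped MatrixOrder in
theorem norm_sq_covSqrt (hε : 0 < ε) (x : EuclideanSpace ℝ (Fin n)) :
    ‖covSqrt M ε x‖ ^ 2 = x.ofLp ⬝ᵥ covMat M ε *ᵥ x.ofLp := by
  have hsa : IsSelfAdjoint (covSqrt M ε) := (CFC.sqrt_nonneg (covMat M ε)).isSelfAdjoint.map _
  rw [← real_inner_self_eq_norm_sq]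
  have h1 : inner ℝ (covSqrt M ε x) (covSqrt M ε x) = inner ℝ x (covSqrt M ε (covSqrt M ε x)) := by
    conv_lhs => rw [← hsa.adjoint_eq, ContinuousLinearMap.adjoint_inner_left, hsa.adjoint_eq]
  rw [h1, ← ContinuousLinearMap.comp_apply, ← ContinuousLinearMap.mul_def, covSqrt, ← map_mul,
    CFC.sqrt_mul_sqrt_self _ (posDef_covMat M hε).posSemidef.nonneg, inner_eq_dotProduct]
  rfl

theorem eigenvalue_pos (hlam : IsSmallestNonzeroEigenvalue (Mᵀ * M) lam) : 0 < lam := by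
  obtain ⟨⟨h0, hev⟩, -⟩ := hlam
  obtain ⟨v, hv⟩ := hev.exists_hasEigenvector
  have h1 : Mᵀ *ᵥ (M *ᵥ v) = lam • v := by
    rw [Matrix.mulVec_mulVec, ← Matrix.toLin'_apply]; exact hv.apply_eq_smul
  have h2 : (M *ᵥ v) ⬝ᵥ (M *ᵥ v) = lam * (v ⬝ᵥ v) := by
    rw [Matrix.dotProduct_mulVec, ← Matrix.mulVec_transpose, h1, smul_dotProduct, smul_eq_mul]
  have h3 : 0 < v ⬝ᵥ v := by
    have := Matrix.dotProduct_star_self_pos_iff.2 hv.2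
    simpa using this
  have h4 : 0 ≤ (M *ᵥ v) ⬝ᵥ (M *ᵥ v) := Finset.sum_nonneg fun i _ => mul_self_nonneg _
  rw [h2] at h4
  exact lt_of_le_of_ne (nonneg_of_mul_nonneg_left h4 h3) (Ne.symm h0)

/-- Expansion in an orthonormal eigenbasis of `Mᵀ M`: the eigenvectors with eigenvalue `0` lie in
`ker M` and do not contribute to `x`. -/
theorem eigenvalue_mul_norm_sq_le (hlam : IsSmallestNonzeroEigenvalue (Mᵀ * M) lam)
    {x : EuclideanSpace ℝ (Fin n)} (hx : x ∈ (kernel M)ᗮ) :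
    lam * ‖x‖ ^ 2 ≤ (M *ᵥ x.ofLp) ⬝ᵥ (M *ᵥ x.ofLp) := by
  have hH : (Mᵀ * M).IsHermitian := by
    simpa using Matrix.isHermitian_conjTranspose_mul_self M
  set e := hH.eigenvectorBasis
  have hΘ : ∀ i, Mᵀ *ᵥ (M *ᵥ (e i).ofLp) = hH.eigenvalues i • (e i).ofLp := by
    intro i
    rw [Matrix.mulVec_mulVec]
    exact hH.mulVec_eigenvectorBasis i
  have h1 : (M *ᵥ x.ofLp) ⬝ᵥ (M *ᵥ x.ofLp) =
      ∑ i, hH.eigenvalues i * inner ℝ (e i) x ^ 2 := by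
    have e1 : (M *ᵥ x.ofLp) ⬝ᵥ (M *ᵥ x.ofLp) =
        inner ℝ x (WithLp.toLp 2 (Mᵀ *ᵥ (M *ᵥ x.ofLp)) : EuclideanSpace ℝ (Fin n)) := by
      rw [inner_eq_dotProduct, Matrix.dotProduct_mulVec, ← Matrix.mulVec_transpose,
        dotProduct_comm]
    rw [e1, ← e.sum_inner_mul_inner]
    refine Finset.sum_congr rfl fun i _ => ?_
    have e2 : inner ℝ (e i) (WithLp.toLp 2 (Mᵀ *ᵥ (M *ᵥ x.ofLp)) : EuclideanSpace ℝ (Fin n)) =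
        hH.eigenvalues i * inner ℝ (e i) x := by
      rw [inner_eq_dotProduct, inner_eq_dotProduct, ← smul_eq_mul, ← smul_dotProduct, ← hΘ,
        Matrix.dotProduct_mulVec, ← Matrix.mulVec_transpose, Matrix.transpose_transpose,
        Matrix.dotProduct_mulVec, ← Matrix.mulVec_transpose]
    rw [e2, real_inner_comm]; ring
  rw [h1, ← e.sum_sq_inner_right, Finset.mul_sum]
  refine Finset.sum_le_sum fun i _ => ?_
  by_cases h0 : hH.eigenvalues i = 0
  · have hker : e i ∈ kernel M := by
      rw [mem_kernel_iff]
      have h2 := hΘ i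
      rw [h0, zero_smul] at h2
      have h3 : (M *ᵥ (e i).ofLp) ⬝ᵥ (M *ᵥ (e i).ofLp) = 0 := by
        rw [Matrix.dotProduct_mulVec, ← Matrix.mulVec_transpose, h2, zero_dotProduct]
      exact dotProduct_self_eq_zero.1 h3
    rw [(Submodule.mem_orthogonal _ _).1 hx _ hker]
    simp
  · have : lam ≤ hH.eigenvalues i := by
      refine hlam.2 ⟨h0, ?_⟩
      refine Module.End.hasEigenvalue_of_hasEigenvector (x := (e i).ofLp) ⟨?_, ?_⟩
      · rw [Module.End.mem_eigenspace_iff, Matrix.toLin'_apply, ← Matrix.mulVec_mulVec, hΘ]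
      · intro h
        have := e.orthonormal.ne_zero i
        exact this (WithLp.ofLp_injective 2 h)
    gcongr

/-- On the orthogonal complement of `ker M` the covariance is at most `1 / lam`. -/
theorem norm_sq_covSqrt_le (hε : 0 < ε) (hlam : IsSmallestNonzeroEigenvalue (Mᵀ * M) lam)
    {x : EuclideanSpace ℝ (Fin n)} (hx : x ∈ (kernel M)ᗮ) :
    ‖covSqrt M ε x‖ ^ 2 ≤ ‖x‖ ^ 2 / lam := by
  have hl := eigenvalue_pos M hlam
  set y : EuclideanSpace ℝ (Fin n) := WithLp.toLp 2 (covMat M ε *ᵥ x.ofLp)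
  have hxy : Mᵀ *ᵥ (M *ᵥ y.ofLp) + ε • y.ofLp = x.ofLp := gram_mulVec_covMat_mulVec M hε x.ofLp
  have hy : y ∈ (kernel M)ᗮ := by
    rw [Submodule.mem_orthogonal]
    intro u hu
    have h := (Submodule.mem_orthogonal _ _).1 hx u hu
    rw [inner_eq_dotProduct, ← hxy, dotProduct_add, Matrix.dotProduct_mulVec,
      ← Matrix.mulVec_transpose, Matrix.transpose_transpose, (mem_kernel_iff M).1 hu,
      zero_dotProduct, zero_add, dotProduct_smul, smul_eq_mul] at h
    rw [inner_eq_dotProduct]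
    exact (mul_eq_zero.1 h).resolve_left hε.ne'
  have h1 : inner ℝ x y = (M *ᵥ y.ofLp) ⬝ᵥ (M *ᵥ y.ofLp) + ε * ‖y‖ ^ 2 := by
    rw [inner_eq_dotProduct, ← hxy, add_dotProduct, smul_dotProduct, ← real_inner_self_eq_norm_sq,
      inner_eq_dotProduct y y, smul_eq_mul, Matrix.mulVec_transpose, ← Matrix.dotProduct_mulVec]
  have h2 := eigenvalue_mul_norm_sq_le M hlam hy
  have h3 := real_inner_le_norm x y
  have h4 : ‖covSqrt M ε x‖ ^ 2 = inner ℝ x y := by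
    rw [norm_sq_covSqrt M hε, inner_eq_dotProduct]
  rw [h4, le_div_iff₀ hl]
  -- `lam ‖y‖² ≤ ‖M y‖² ≤ ⟨x, y⟩ ≤ ‖x‖ ‖y‖` for `y = (Mᵀ M + ε I)⁻¹ x`
  have h5 : lam * ‖y‖ ^ 2 ≤ ‖x‖ * ‖y‖ := by nlinarith [sq_nonneg ‖y‖]
  have h6 : lam * ‖y‖ ≤ ‖x‖ := by
    rcases (norm_nonneg y).eq_or_lt with h | h
    · rw [← h]; simp
    · nlinarith
  nlinarith [norm_nonneg x]

theorem norm_covSqrt_row (hε : 0 < ε) (i : Fin p) :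
    Real.sqrt (M i ⬝ᵥ (covMat M ε *ᵥ M i)) = ‖covSqrt M ε (WithLp.toLp 2 (M i))‖ := by
  rw [← Real.sqrt_sq (norm_nonneg (covSqrt M ε _)), norm_sq_covSqrt M hε]

theorem norm_covSqrt_pos (hε : 0 < ε) {x : EuclideanSpace ℝ (Fin n)} (hx : x ≠ 0) :
    0 < ‖covSqrt M ε x‖ := by
  have h := (posDef_covMat M hε).dotProduct_mulVec_pos (x := x.ofLp)
    (fun h => hx (WithLp.ofLp_injective 2 h))
  simp only [star_trivial] at h
  rw [← norm_sq_covSqrt M hε] at h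
  exact (norm_nonneg _).lt_of_ne' (sq_pos_iff.1 h)

/-- Equality holds except for a zero row. -/
theorem norm_covSqrt_normalizedRow_le (hε : 0 < ε) (i : Fin p) :
    ‖covSqrt M ε (normalizedRow M ε i)‖ ≤ 1 := by
  rw [normalizedRow, norm_covSqrt_row M hε, map_smul, norm_smul, norm_inv, norm_norm]
  exact inv_mul_le_one

theorem norm_covSqrt_smul_normalizedRow (hε : 0 < ε) (i : Fin p) :
    ‖covSqrt M ε (WithLp.toLp 2 (M i))‖ • normalizedRow M ε i = WithLp.toLp 2 (M i) := by
  rw [normalizedRow, norm_covSqrt_row M hε]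
  by_cases h : (WithLp.toLp 2 (M i) : EuclideanSpace ℝ (Fin n)) = 0
  · rw [h]; simp
  · rw [smul_smul, mul_inv_cancel₀ (norm_covSqrt_pos M hε h).ne', one_smul]

end Covariance

/-! ### Gaussian covariates -/

section Gaussian

variable {p n : ℕ} (M : Matrix (Fin p) (Fin n) ℝ) {ε : ℝ}

theorem charFun_multivariateGaussian_covMat (hε : 0 < ε) (t : EuclideanSpace ℝ (Fin n)) :
    charFun (multivariateGaussian 0 (covMat M ε)) t =
      Complex.exp (-((‖covSqrt M ε t‖ ^ 2 : ℝ) : ℂ) / 2) := by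
  rw [charFun_multivariateGaussian (posDef_covMat M hε).posSemidef, norm_sq_covSqrt M hε]
  simp [neg_div]

theorem map_inner_multivariateGaussian (hε : 0 < ε) (w : EuclideanSpace ℝ (Fin n)) :
    (multivariateGaussian 0 (covMat M ε)).map (fun x => inner ℝ w x) =
      gaussianReal 0 (‖covSqrt M ε w‖ ^ 2).toNNReal := by
  have : IsProbabilityMeasure ((multivariateGaussian 0 (covMat M ε)).map (fun x => inner ℝ w x)) :=
    Measure.isProbabilityMeasure_map (by fun_prop)
  refine Measure.ext_of_charFun (funext fun t => ?_)
  rw [charFun_gaussianReal, charFun_apply, integral_map (by fun_prop) (by fun_prop)]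
  have h := charFun_multivariateGaussian_covMat M hε (t • w)
  rw [charFun_apply] at h
  have e : ∀ x : EuclideanSpace ℝ (Fin n), inner ℝ (inner ℝ w x) t = inner ℝ x (t • w) := by
    intro x
    rw [real_inner_smul_right, Real.inner_apply, real_inner_comm x w]; simp [mul_comm]
  simp_rw [e]
  rw [h, map_smul, norm_smul, Real.coe_toNNReal _ (sq_nonneg _)]
  congr 1
  push_cast
  rw [mul_pow, Real.norm_eq_abs, ← Complex.ofReal_pow, sq_abs]
  push_cast
  ring

/-- The coordinates of a covariate along orthonormal vectors in `ker M` are independent with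
variance `1 / ε`. -/
theorem map_inner_kernel_multivariateGaussian (hε : 0 < ε) {d : ℕ}
    {f : Fin d → EuclideanSpace ℝ (Fin n)} (hf : Orthonormal ℝ f) (hfk : ∀ i, f i ∈ kernel M) :
    (multivariateGaussian 0 (covMat M ε)).map (fun x i => √ε * inner ℝ (f i) x) =
      Measure.pi fun _ : Fin d => gaussianReal 0 1 := by
  have hmeas : Measurable fun (x : EuclideanSpace ℝ (Fin n)) (i : Fin d) =>
      √ε * inner ℝ (f i) x := by fun_prop
  have : IsProbabilityMeasure ((multivariateGaussian 0 (covMat M ε)).map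
      (fun x i => √ε * inner ℝ (f i) x)) := Measure.isProbabilityMeasure_map hmeas.aemeasurable
  refine (MeasurableEquiv.toLp 2 (Fin d → ℝ)).map_measurableEquiv_injective
    (Measure.ext_of_charFun <| funext fun t => ?_)
  rw [MeasurableEquiv.coe_toLp, charFun_pi, charFun_apply, Measure.map_map (by fun_prop) hmeas,
    integral_map (by fun_prop) (by fun_prop)]
  set u : EuclideanSpace ℝ (Fin n) := ∑ i, t i • f i
  have huk : u ∈ kernel M := Submodule.sum_mem _ fun i _ => Submodule.smul_mem _ _ (hfk i)
  have hun : ‖u‖ ^ 2 = ∑ i, t i ^ 2 := by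
    rw [← real_inner_self_eq_norm_sq, hf.inner_sum]
    simp [pow_two]
  have h := charFun_multivariateGaussian_covMat M hε (√ε • u)
  rw [charFun_apply] at h
  have e : ∀ x : EuclideanSpace ℝ (Fin n),
      inner ℝ ((WithLp.toLp 2 ∘ fun (x : EuclideanSpace ℝ (Fin n)) (i : Fin d) =>
        √ε * inner ℝ (f i) x) x) t = inner ℝ x (√ε • u) := by
    intro x
    rw [real_inner_smul_right, inner_sum, Finset.mul_sum, PiLp.inner_apply]
    refine Finset.sum_congr rfl fun i _ => ?_
    simp only [Function.comp, real_inner_smul_right, real_inner_comm x (f i)]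
    simp; ring
  simp_rw [e]
  rw [h, norm_sq_covSqrt M hε]
  have e2 : (√ε • u).ofLp ⬝ᵥ covMat M ε *ᵥ (√ε • u).ofLp = ∑ i, t i ^ 2 := by
    rw [covMat_mulVec_of_mem_kernel M hε (Submodule.smul_mem _ _ huk), dotProduct_smul,
      ← inner_eq_dotProduct, real_inner_self_eq_norm_sq, norm_smul, mul_pow, hun,
      Real.norm_eq_abs, sq_abs, Real.sq_sqrt hε.le, smul_eq_mul, inv_mul_cancel_left₀ hε.ne']
  rw [e2]
  simp_rw [charFun_gaussianReal]
  rw [← Complex.exp_sum]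
  congr 1
  push_cast
  simp [neg_div, Finset.sum_div]

instance (A : Matrix (Fin n) (Fin n) ℝ) (m : ℕ) : IsProbabilityMeasure (sampleLaw A m) := by
  unfold sampleLaw; infer_instance

/-- Upper tail of the empirical second moment in a fixed direction. -/
theorem sampleLaw_sum_inner_sq_gt_le (hε : 0 < ε) (m : ℕ) {w : EuclideanSpace ℝ (Fin n)} {v : ℝ}
    (hv : 0 < v) (hw : ‖covSqrt M ε w‖ ^ 2 ≤ v) :
    sampleLaw (covMat M ε) m {X | 8 * m * v < ∑ l, inner ℝ w (X l) ^ 2} ≤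
      ENNReal.ofReal (Real.exp (-m)) := by
  calc _ ≤ sampleLaw (covMat M ε) m {X | (2 * m : ℝ) ≤ ∑ l, inner ℝ w (X l) ^ 2 / (4 * v)} := by
        refine measure_mono fun X hX => ?_
        simp only [Set.mem_ofPred_eq, ← Finset.sum_div] at hX ⊢
        rw [le_div_iff₀ (by positivity)]
        linarith
    _ ≤ ENNReal.ofReal (Real.exp (-(2 * m))) * ∫⁻ X, ENNReal.ofReal (Real.exp
          (∑ l, inner ℝ w (X l) ^ 2 / (4 * v))) ∂sampleLaw (covMat M ε) m :=
        measure_le_exp_mul_lintegral _ (by fun_prop) _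
    _ = ENNReal.ofReal (Real.exp (-(2 * m))) * ∏ _l : Fin m, ∫⁻ x, ENNReal.ofReal (Real.exp
          (inner ℝ w x ^ 2 / (4 * v))) ∂multivariateGaussian 0 (covMat M ε) := by
        congr 1
        rw [sampleLaw, ← lintegral_pi_prod _ (fun _ => by fun_prop)]
        refine lintegral_congr fun X => ?_
        rw [Real.exp_sum, ENNReal.ofReal_prod_of_nonneg fun _ _ => (Real.exp_pos _).le]
    _ ≤ ENNReal.ofReal (Real.exp (-(2 * m))) * ∏ _l : Fin m, ENNReal.ofReal (√2) := by
        gcongr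
        calc _ = ∫⁻ y, ENNReal.ofReal (Real.exp (y ^ 2 / (4 * v)))
              ∂(multivariateGaussian 0 (covMat M ε)).map (fun x => inner ℝ w x) := by
              rw [lintegral_map (by fun_prop) (by fun_prop)]
          _ ≤ _ := by
              rw [map_inner_multivariateGaussian M hε]
              exact lintegral_exp_sq_gaussianReal_le _
                (by rwa [Real.coe_toNNReal _ (sq_nonneg _)])
    _ ≤ _ := by
        rw [Finset.prod_const, Finset.card_univ, Fintype.card_fin,
          ← ENNReal.ofReal_pow (by positivity), ← ENNReal.ofReal_mul (Real.exp_pos _).le]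
        apply ENNReal.ofReal_le_ofReal
        have h1 : √2 ≤ Real.exp 1 := by
          have := Real.add_one_le_exp 1
          have : √2 ≤ 2 := Real.sqrt_le_iff.2 ⟨by norm_num, by norm_num⟩
          linarith
        calc _ ≤ Real.exp (-(2 * m)) * Real.exp 1 ^ m := by gcongr
          _ = _ := by rw [← Real.exp_nat_mul, ← Real.exp_add]; congr 1; ring

end Gaussian

/-! ### Proximity of the span of the samples to a vector of `ker M` -/

section Span

variable {p n : ℕ} (M : Matrix (Fin p) (Fin n) ℝ) {ε : ℝ}

/-- The covariates whose linear span comes, after projection to `ker M`, within `‖h‖ / 2` of `h`. -/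
def spanNear (m : ℕ) (h : EuclideanSpace ℝ (Fin n)) : Set (Fin m → EuclideanSpace ℝ (Fin n)) :=
  {X | ∃ α : Fin m → ℝ, ‖(kernel M).starProjection (∑ l, α l • X l) - h‖ < ‖h‖ / 2}

theorem isOpen_spanNear (m : ℕ) (h : EuclideanSpace ℝ (Fin n)) : IsOpen (spanNear M m h) := by
  have : spanNear M m h = ⋃ α : Fin m → ℝ,
      {X | ‖(kernel M).starProjection (∑ l, α l • X l) - h‖ < ‖h‖ / 2} := by
    ext X; simp [spanNear]
  rw [this]
  exact isOpen_iUnion fun α => isOpen_lt (by fun_prop) continuous_const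

theorem spanNear_smul (m : ℕ) {h : EuclideanSpace ℝ (Fin n)} {c : ℝ} (hc : 0 < c) :
    spanNear M m (c • h) = spanNear M m h := by
  have key : ∀ (c : ℝ) (h : EuclideanSpace ℝ (Fin n)), 0 < c →
      spanNear M m h ⊆ spanNear M m (c • h) := by
    rintro c h hc X ⟨α, hα⟩
    refine ⟨c • α, ?_⟩
    have e : ∑ l, (c • α) l • X l = c • ∑ l, α l • X l := by
      rw [Finset.smul_sum]; simp [mul_smul]
    rw [e, map_smul, ← smul_sub, norm_smul, norm_smul, Real.norm_of_nonneg hc.le, mul_div_assoc]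
    gcongr
  refine Set.Subset.antisymm ?_ (key c h hc)
  have := key c⁻¹ (c • h) (inv_pos.2 hc)
  rwa [inv_smul_smul₀ hc.ne'] at this

/-- An isometry that moves vectors only within `ker M` preserves the law of a covariate. -/
theorem map_multivariateGaussian_of_sub_mem_kernel (hε : 0 < ε)
    (R : EuclideanSpace ℝ (Fin n) ≃ₗᵢ[ℝ] EuclideanSpace ℝ (Fin n))
    (hR : ∀ x, x - R x ∈ kernel M) (hR2 : ∀ x y, inner ℝ (R x) y = inner ℝ x (R y)) :
    (multivariateGaussian 0 (covMat M ε)).map R = multivariateGaussian 0 (covMat M ε) := by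
  have : IsProbabilityMeasure ((multivariateGaussian 0 (covMat M ε)).map R) :=
    Measure.isProbabilityMeasure_map (by fun_prop)
  refine Measure.ext_of_charFun (funext fun t => ?_)
  rw [charFun_apply, integral_map (by fun_prop) (by fun_prop)]
  simp_rw [hR2]
  rw [← charFun_apply, charFun_multivariateGaussian_covMat M hε,
    charFun_multivariateGaussian_covMat M hε]
  congr 4
  rw [norm_sq_covSqrt M hε, norm_sq_covSqrt M hε]
  set w := t - R t
  have ht : t = R t + w := by simp [w]
  have hw : covMat M ε *ᵥ w.ofLp = ε⁻¹ • w.ofLp := covMat_mulVec_of_mem_kernel M hε (hR t)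
  have hsymm : w.ofLp ⬝ᵥ covMat M ε *ᵥ (R t).ofLp = ε⁻¹ * inner ℝ w (R t) := by
    have hT : (covMat M ε)ᵀ = covMat M ε := by
      have := (posDef_covMat M hε).isHermitian
      simpa [Matrix.IsHermitian] using this
    rw [Matrix.dotProduct_mulVec, ← Matrix.mulVec_transpose, hT, hw, smul_dotProduct,
      inner_eq_dotProduct, smul_eq_mul]
  have hn : ‖t‖ ^ 2 = ‖R t‖ ^ 2 + 2 * inner ℝ (R t) w + ‖w‖ ^ 2 := by
    conv_lhs => rw [ht]
    exact norm_add_sq_real _ _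
  rw [R.norm_map] at hn
  conv_rhs => rw [ht]
  rw [WithLp.ofLp_add, Matrix.mulVec_add, add_dotProduct, dotProduct_add, dotProduct_add, hsymm,
    hw, dotProduct_smul, dotProduct_smul, ← inner_eq_dotProduct (R t) w,
    ← inner_eq_dotProduct w w, real_inner_self_eq_norm_sq, smul_eq_mul, smul_eq_mul,
    real_inner_comm (R t) w]
  linear_combination ε⁻¹ * hn

/-- The event `spanNear` has the same probability for all unit vectors of `ker M`. -/
theorem sampleLaw_spanNear_eq (hε : 0 < ε) (m : ℕ) {u u' : EuclideanSpace ℝ (Fin n)}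
    (hu : u ∈ kernel M) (hu' : u' ∈ kernel M) (hn : ‖u‖ = ‖u'‖) :
    sampleLaw (covMat M ε) m (spanNear M m u) = sampleLaw (covMat M ε) m (spanNear M m u') := by
  -- the reflection that exchanges `u` and `u'`
  set R := (Submodule.span ℝ {u - u'})ᗮ.reflection
  have hRu : R u = u' := Submodule.reflection_sub hn
  have hsub : ∀ x, x - R x ∈ kernel M := by
    intro x
    have hle : Submodule.span ℝ {u - u'} ≤ kernel M := by
      rw [Submodule.span_singleton_le_iff_mem]; exact Submodule.sub_mem _ hu hu'
    have : x - R x = (2 : ℝ) • (Submodule.span ℝ {u - u'}).starProjection x := by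
      rw [Submodule.reflection_apply, Submodule.starProjection_orthogonal_val]
      module
    rw [this]
    exact Submodule.smul_mem _ _ (hle (Submodule.starProjection_apply_mem _ _))
  have hinner : ∀ x y, inner ℝ (R x) y = inner ℝ x (R y) := by
    intro x y
    rw [← R.inner_map_map x (R y), Submodule.reflection_reflection]
  have hmapk : ∀ x ∈ kernel M, R x ∈ kernel M := fun x hx => by
    have := Submodule.sub_mem _ hx (hsub x)
    simpa using this
  have hcomm : ∀ x, (kernel M).starProjection (R x) = R ((kernel M).starProjection x) := by
    intro x
    refine Submodule.eq_starProjection_of_mem_of_inner_eq_zero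
      (hmapk _ (Submodule.starProjection_apply_mem _ _)) ?_
    intro w hw
    rw [← map_sub, hinner]
    exact Submodule.starProjection_inner_eq_zero _ _ (hmapk w hw)
  have hpre : (fun (X : Fin m → EuclideanSpace ℝ (Fin n)) l => R (X l)) ⁻¹' spanNear M m u' =
      spanNear M m u := by
    ext X
    simp only [Set.mem_preimage, spanNear, Set.mem_ofPred_eq, ← hn]
    refine exists_congr fun α => ?_
    simp_rw [← map_smul, ← map_sum, hcomm]
    rw [← hRu, ← map_sub, R.norm_map]
  have hmap : (sampleLaw (covMat M ε) m).map (fun X l => R (X l)) = sampleLaw (covMat M ε) m := by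
    rw [sampleLaw]
    have h1 : IsProbabilityMeasure ((multivariateGaussian 0 (covMat M ε)).map R) :=
      Measure.isProbabilityMeasure_map (by fun_prop)
    rw [Measure.pi_map_pi (f := fun _ => R) (fun _ => by fun_prop)]
    simp_rw [map_multivariateGaussian_of_sub_mem_kernel M hε R hsub hinner]
  rw [← hpre, ← Measure.map_apply (by fun_prop) (isOpen_spanNear M m u').measurableSet, hmap]

/-- A fixed vector of `ker M` is seldom close to the span of the covariates: in an orthonormal basis
of `ker M`, an `m`-dimensional subspace is close to few of the basis vectors. -/
theorem sampleLaw_spanNear_le (hε : 0 < ε) (m : ℕ) {h : EuclideanSpace ℝ (Fin n)}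
    (hk : h ∈ kernel M) (h0 : h ≠ 0) :
    sampleLaw (covMat M ε) m (spanNear M m h) ≤
      ENNReal.ofReal (4 * m / (3 * Module.finrank ℝ (kernel M))) := by
  set d := Module.finrank ℝ (kernel M)
  set b := stdOrthonormalBasis ℝ (kernel M)
  have hd : 0 < d := by
    have : Nontrivial (kernel M) := ⟨⟨⟨h, hk⟩, 0, fun e => h0 (congrArg Subtype.val e)⟩⟩
    exact Module.finrank_pos
  have hb : Orthonormal ℝ fun i => (b i : EuclideanSpace ℝ (Fin n)) := by
    have := b.orthonormal.comp_linearIsometry (kernel M).subtypeₗᵢ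
    exact this
  have heq : ∀ i, sampleLaw (covMat M ε) m (spanNear M m h) =
      sampleLaw (covMat M ε) m (spanNear M m (b i)) := by
    intro i
    rw [← spanNear_smul M m (inv_pos.2 (norm_pos_iff.2 h0)) (h := h)]
    refine sampleLaw_spanNear_eq M hε m (Submodule.smul_mem _ _ hk) (b i).2 ?_
    rw [hb.1 i, norm_smul, norm_inv, norm_norm, inv_mul_cancel₀ (norm_ne_zero_iff.2 h0)]
  -- A basis vector within `1 / 2` of the subspace `W` has a projection to `W` of squared norm at
  -- least `3 / 4`, and these squared norms add up to at most `dim W ≤ m`.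
  have hcount : ∀ X : Fin m → EuclideanSpace ℝ (Fin n),
      ∑ i, (spanNear M m (b i : EuclideanSpace ℝ (Fin n))).indicator
        (fun _ => (1 : ℝ)) X ≤ 4 / 3 * m := by
    intro X
    set W := Submodule.span ℝ (Set.range fun l => (kernel M).starProjection (X l))
    have hW : Module.finrank ℝ W ≤ m := by
      have := finrank_range_le_card (R := ℝ) fun l => (kernel M).starProjection (X l)
      rwa [Fintype.card_fin] at this
    have h1 : ∀ i, (spanNear M m (b i : EuclideanSpace ℝ (Fin n))).indicator
        (fun _ => (1 : ℝ)) X ≤ 4 / 3 * ‖W.starProjection (b i)‖ ^ 2 := by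
      intro i
      by_cases hX : X ∈ spanNear M m (b i : EuclideanSpace ℝ (Fin n))
      · rw [Set.indicator_of_mem hX]
        obtain ⟨α, hα⟩ := hX
        rw [hb.1 i] at hα
        set z := (kernel M).starProjection (∑ l, α l • X l)
        have hz : z ∈ W := by
          simp only [z, map_sum, map_smul]
          exact Submodule.sum_mem _ fun l _ => Submodule.smul_mem _ _
            (Submodule.subset_span ⟨l, rfl⟩)
        have hmin : ‖(b i : EuclideanSpace ℝ (Fin n)) - W.starProjection (b i)‖ ≤
            ‖(b i : EuclideanSpace ℝ (Fin n)) - z‖ := by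
          rw [Submodule.starProjection_minimal]
          exact ciInf_le ⟨0, by rintro _ ⟨y, rfl⟩; positivity⟩ (⟨z, hz⟩ : W)
        rw [norm_sub_rev _ z] at hmin
        have hpy := W.norm_sq_eq_add_norm_sq_starProjection (b i : EuclideanSpace ℝ (Fin n))
        rw [hb.1 i, Submodule.starProjection_orthogonal_val] at hpy
        nlinarith [norm_nonneg ((b i : EuclideanSpace ℝ (Fin n)) - W.starProjection (b i))]
      · rw [Set.indicator_of_notMem hX]; positivity
    refine (Finset.sum_le_sum fun i _ => h1 i).trans ?_
    rw [← Finset.mul_sum]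
    gcongr
    set c := stdOrthonormalBasis ℝ W
    have h2 : ∀ i, ‖W.starProjection (b i : EuclideanSpace ℝ (Fin n))‖ ^ 2 =
        ∑ j, inner ℝ (b i : EuclideanSpace ℝ (Fin n)) (c j : EuclideanSpace ℝ (Fin n)) ^ 2 := by
      intro i
      have e : ‖W.starProjection (b i : EuclideanSpace ℝ (Fin n))‖ =
        ‖W.orthogonalProjectionOnto (b i : EuclideanSpace ℝ (Fin n))‖ := rfl
      rw [e, ← c.sum_sq_inner_left]
      refine Finset.sum_congr rfl fun j _ => ?_
      rw [Submodule.inner_orthogonalProjectionOnto_eq_of_mem_right]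
    simp_rw [h2]
    rw [Finset.sum_comm]
    calc _ ≤ ∑ j, ‖(c j : EuclideanSpace ℝ (Fin n))‖ ^ 2 := by
          refine Finset.sum_le_sum fun j _ => ?_
          have := hb.sum_inner_products_le (c j : EuclideanSpace ℝ (Fin n)) (s := Finset.univ)
          simpa using this
      _ = Module.finrank ℝ W := by
          have hc : ∀ j, ‖(c j : EuclideanSpace ℝ (Fin n))‖ = 1 := fun j => c.orthonormal.1 j
          simp [hc]
      _ ≤ m := by exact_mod_cast hW
  have hint : (d : ℝ≥0∞) * sampleLaw (covMat M ε) m (spanNear M m h) ≤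
      ENNReal.ofReal (4 / 3 * m) := by
    calc _ = ∑ i, sampleLaw (covMat M ε) m (spanNear M m (b i : EuclideanSpace ℝ (Fin n))) := by
          simp_rw [← heq]
          simp [d]
      _ = ∫⁻ X, ∑ i, (spanNear M m (b i : EuclideanSpace ℝ (Fin n))).indicator
            (fun _ => (1 : ℝ≥0∞)) X ∂sampleLaw (covMat M ε) m := by
          rw [lintegral_finsetSum _ fun i _ =>
            measurable_const.indicator (isOpen_spanNear M m _).measurableSet]
          refine Finset.sum_congr rfl fun i _ => ?_
          rw [lintegral_indicator_const (isOpen_spanNear M m _).measurableSet, one_mul]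
      _ ≤ ∫⁻ _, ENNReal.ofReal (4 / 3 * m) ∂sampleLaw (covMat M ε) m := by
          refine lintegral_mono fun X => ?_
          refine le_trans (le_of_eq ?_) (ENNReal.ofReal_le_ofReal (hcount X))
          rw [ENNReal.ofReal_sum_of_nonneg fun i _ => Set.indicator_nonneg (by simp) _]
          refine Finset.sum_congr rfl fun i _ => ?_
          by_cases hX : X ∈ spanNear M m (b i : EuclideanSpace ℝ (Fin n)) <;> simp [hX]
      _ = _ := by simp
  have hd' : (0 : ℝ) < d := by exact_mod_cast hd
  rw [show 4 * (m : ℝ) / (3 * d) = 4 / 3 * m / d by field_simp, ENNReal.ofReal_div_of_pos hd',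
    ENNReal.ofReal_natCast, ENNReal.le_div_iff_mul_le (Or.inl (by positivity)) (Or.inl (by simp)),
    mul_comm]
  exact hint

end Span

/-! ### Small combinations of the samples -/

section SmallestSingularValue

/-- A fixed combination of the rows of a Gaussian matrix is seldom short. -/
theorem pi_gaussian_sum_sq_le {m d : ℕ} {α : Fin m → ℝ} {l₀ : Fin m} (hα : |α l₀| = 1)
    {s : ℝ} (hs : 0 < s) (a : ℝ) :
    (Measure.pi fun _ : Fin m => Measure.pi fun _ : Fin d => gaussianReal 0 1)
      {Y | ∑ i, (∑ l, α l * Y l i) ^ 2 ≤ a} ≤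
      ENNReal.ofReal (Real.exp (s * a) * ((√(2 * s))⁻¹) ^ d) := by
  set ν := Measure.pi fun _ : Fin m => Measure.pi fun _ : Fin d => gaussianReal 0 1
  calc _ ≤ ν {Y | -(s * a) ≤ -(s * ∑ i, (∑ l, α l * Y l i) ^ 2)} := by
        refine measure_mono fun Y hY => ?_
        simp only [Set.mem_ofPred_eq] at hY ⊢
        gcongr
    _ ≤ ENNReal.ofReal (Real.exp (- -(s * a))) * ∫⁻ Y, ENNReal.ofReal (Real.exp
          (-(s * ∑ i, (∑ l, α l * Y l i) ^ 2))) ∂ν := measure_le_exp_mul_lintegral _ (by fun_prop) _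
    _ ≤ ENNReal.ofReal (Real.exp (- -(s * a))) * ∫⁻ _, ENNReal.ofReal ((√(2 * s))⁻¹ ^ d) ∂ν := by
        refine mul_le_mul' le_rfl ?_
        -- the entries of row `l₀` are integrated first, with the other rows fixed
        rw [lintegral_pi_update _ l₀ (by fun_prop)]
        refine lintegral_mono fun Y => ?_
        set q : Fin d → ℝ := fun i => α l₀ * ∑ l ∈ Finset.univ.erase l₀, α l * Y l i
        have hsq : α l₀ * α l₀ = 1 := by
          rw [← pow_two, ← sq_abs, hα, one_pow]
        have e : ∀ y : Fin d → ℝ, ENNReal.ofReal (Real.exp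
            (-(s * ∑ i, (∑ l, α l * Function.update Y l₀ y l i) ^ 2))) =
            ∏ i, ENNReal.ofReal (Real.exp (-(s * (y i + q i) ^ 2))) := by
          intro y
          rw [Finset.mul_sum, ← Finset.sum_neg_distrib, Real.exp_sum,
            ENNReal.ofReal_prod_of_nonneg fun _ _ => (Real.exp_pos _).le]
          refine Finset.prod_congr rfl fun i _ => ?_
          congr 4
          rw [← Finset.add_sum_erase _ _ (Finset.mem_univ l₀)]
          have e1 : ∑ l ∈ Finset.univ.erase l₀, α l * Function.update Y l₀ y l i =
              ∑ l ∈ Finset.univ.erase l₀, α l * Y l i := by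
            refine Finset.sum_congr rfl fun l hl => ?_
            rw [Function.update_of_ne (Finset.ne_of_mem_erase hl)]
          rw [e1, Function.update_self]
          set z := ∑ l ∈ Finset.univ.erase l₀, α l * Y l i
          have : y i + q i = α l₀ * (α l₀ * y i + z) := by
            rw [mul_add, ← mul_assoc, hsq, one_mul]
          rw [this, mul_pow, pow_two (α l₀), hsq, one_mul]
        simp_rw [e]
        rw [lintegral_pi_prod _ (φ := fun i x => ENNReal.ofReal (Real.exp (-(s * (x + q i) ^ 2))))
          fun i => by fun_prop]
        calc _ ≤ ∏ _i : Fin d, ENNReal.ofReal (√(2 * s))⁻¹ :=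
              Finset.prod_le_prod' fun i _ => lintegral_exp_neg_sq_gaussianReal_le hs _
          _ = _ := by simp [ENNReal.ofReal_pow]
    _ = _ := by
        rw [lintegral_const, measure_univ, mul_one, ← ENNReal.ofReal_mul (Real.exp_pos _).le,
          neg_neg]

/-- Rounding a vector of sup norm `1` to the grid of mesh `1 / N`, keeping an entry of absolute
value `1`. -/
theorem exists_grid_point {m N : ℕ} (hN : 0 < N) {β : Fin m → ℝ} (hβ : ‖β‖ = 1) :
    ∃ k ∈ Fintype.piFinset fun _ : Fin m => Finset.Icc (-N : ℤ) N,
      (∃ l, |(k l / N : ℝ)| = 1) ∧ ∀ l, |(k l / N : ℝ) - β l| ≤ 1 / (2 * N) := by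
  have hN' : (0 : ℝ) < N := by exact_mod_cast hN
  refine ⟨fun l => round (N * β l), ?_, ?_, ?_⟩
  · rw [Fintype.mem_piFinset]
    intro l
    have h1 : |β l| ≤ 1 := by rw [← hβ]; exact norm_le_pi_norm β l
    have h2 := abs_sub_round ((N : ℝ) * β l)
    rw [abs_le] at h1 h2
    have h3 : ((round (N * β l) : ℤ) : ℝ) < ((N + 1 : ℤ) : ℝ) := by push_cast; nlinarith
    have h4 : ((-N - 1 : ℤ) : ℝ) < ((round (N * β l) : ℤ) : ℝ) := by push_cast; nlinarith
    rw [Int.cast_lt] at h3 h4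
    rw [Finset.mem_Icc]; omega
  · have hne : Nonempty (Fin m) := by
      by_contra h
      rw [not_nonempty_iff] at h
      rw [Subsingleton.elim β 0, norm_zero] at hβ
      exact zero_ne_one hβ
    obtain ⟨l, hl⟩ := Finite.exists_max fun l => ‖β l‖
    have h1 : |β l| = 1 := by
      apply le_antisymm
      · rw [← hβ]; exact norm_le_pi_norm β l
      · rw [← hβ]; exact (pi_norm_le_iff_of_nonneg (norm_nonneg _)).2 hl
    refine ⟨l, ?_⟩
    rcases eq_or_eq_neg_of_abs_eq h1 with h | h
    · simp [h, hN'.ne']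
    · have : (N : ℝ) * β l = ((-N : ℤ) : ℝ) := by rw [h]; push_cast; ring
      simp only [this, round_intCast]
      push_cast
      rw [neg_div, div_self hN'.ne']; simp
  · intro l
    have h2 := abs_sub_round ((N : ℝ) * β l)
    have e : ((round (N * β l) : ℤ) / N : ℝ) - β l = -(N * β l - round (N * β l)) / N := by
      field_simp; ring
    rw [e, abs_div, abs_neg, abs_of_pos hN', div_le_div_iff₀ hN' (by positivity)]
    nlinarith

/-- The deterministic part of the net argument: a matrix of bounded Frobenius norm with a short
combination of rows has a short combination of rows with grid coefficients. -/
theorem sum_sq_grid_le {m d N : ℕ} {Y : Fin m → Fin d → ℝ} {a f : ℝ} {β γ : Fin m → ℝ}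
    (hγ : ∀ l, |γ l - β l| ≤ 1 / (2 * N))
    (hβ : ∑ i, (∑ l, β l * Y l i) ^ 2 ≤ a) (hY : ∑ i, ∑ l, Y l i ^ 2 ≤ f) :
    ∑ i, (∑ l, γ l * Y l i) ^ 2 ≤ 2 * a + 2 * (m * (1 / (2 * N)) ^ 2 * f) := by
  have h1 : ∑ i, (∑ l, (γ l - β l) * Y l i) ^ 2 ≤ m * (1 / (2 * N)) ^ 2 * f := by
    calc _ ≤ ∑ i, (∑ l, (γ l - β l) ^ 2) * (∑ l, Y l i ^ 2) :=
          Finset.sum_le_sum fun i _ => Finset.sum_mul_sq_le_sq_mul_sq _ _ _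
      _ = (∑ l, (γ l - β l) ^ 2) * ∑ i, ∑ l, Y l i ^ 2 := by rw [Finset.mul_sum]
      _ ≤ (∑ _l : Fin m, (1 / (2 * N : ℝ)) ^ 2) * f := by
          refine mul_le_mul (Finset.sum_le_sum fun l _ => ?_) hY (by positivity) (by positivity)
          rw [← sq_abs]
          exact pow_le_pow_left₀ (abs_nonneg _) (hγ l) 2
      _ = _ := by simp
  calc _ ≤ ∑ i, (2 * (∑ l, β l * Y l i) ^ 2 + 2 * (∑ l, (γ l - β l) * Y l i) ^ 2) := by
        refine Finset.sum_le_sum fun i _ => ?_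
        have : ∑ l, γ l * Y l i = ∑ l, β l * Y l i + ∑ l, (γ l - β l) * Y l i := by
          rw [← Finset.sum_add_distrib]; exact Finset.sum_congr rfl fun l _ => by ring
        rw [this]
        nlinarith [sq_nonneg (∑ l, β l * Y l i - ∑ l, (γ l - β l) * Y l i)]
    _ = 2 * ∑ i, (∑ l, β l * Y l i) ^ 2 + 2 * ∑ i, (∑ l, (γ l - β l) * Y l i) ^ 2 := by
        rw [Finset.sum_add_distrib, Finset.mul_sum, Finset.mul_sum]
    _ ≤ _ := by gcongr

/-- A grid of mesh `1 / (800 m²)` is fine enough for the net argument, and has few enough points. -/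
theorem grid_union_bound {m : ℕ} (hm : 0 < m) :
    ((2 * (800 * m ^ 2) + 1 : ℕ) : ℝ) ^ m *
      (Real.exp ((m / (40 * m ^ 3 / (800 * m ^ 2) ^ 2)) * (40 * m ^ 3 / (800 * m ^ 2) ^ 2 : ℝ)) *
        ((√(2 * (m / (40 * m ^ 3 / (800 * m ^ 2) ^ 2 : ℝ))))⁻¹) ^ (2 * m)) ≤ Real.exp (-m) := by
  have hm' : (1 : ℝ) ≤ m := by exact_mod_cast hm
  have h0 : (0 : ℝ) < m := by linarith
  have e1 : (m / (40 * m ^ 3 / (800 * m ^ 2) ^ 2)) * (40 * m ^ 3 / (800 * m ^ 2) ^ 2 : ℝ) = m := by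
    field_simp
  have e2 : (2 * (m / (40 * m ^ 3 / (800 * m ^ 2) ^ 2 : ℝ))) = 32000 * m ^ 2 := by
    field_simp; norm_num
  rw [e1, e2, pow_mul, inv_pow, Real.sq_sqrt (by positivity)]
  have e3 : Real.exp m = Real.exp 1 ^ m := by rw [← Real.exp_nat_mul]; simp
  have e4 : Real.exp (-m) = (Real.exp (-1)) ^ m := by rw [← Real.exp_nat_mul]; simp
  rw [e3, e4, ← mul_pow, ← mul_pow]
  apply pow_le_pow_left₀ (by positivity)
  have he := Real.exp_one_lt_d9
  have hepos := Real.exp_pos 1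
  rw [Real.exp_neg, ← div_eq_mul_inv, ← mul_div_assoc, div_le_iff₀ (by positivity),
    ← div_eq_inv_mul, le_div_iff₀ hepos]
  push_cast
  have h5 : Real.exp 1 * Real.exp 1 ≤ 9 := by nlinarith
  have h6 : (2 * (800 * (m : ℝ) ^ 2) + 1) ≤ 1601 * m ^ 2 := by nlinarith
  nlinarith [mul_le_mul h6 h5 (by positivity) (by positivity)]

variable {p n : ℕ} (M : Matrix (Fin p) (Fin n) ℝ) {ε : ℝ}

/-- With high probability the covariates are quantitatively independent, even after restricting to
a subspace of `ker M` of dimension `2 m`. The proof is a union bound over a grid of coefficient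
vectors. -/
theorem sampleLaw_small_combination_le (hε : 0 < ε) {m : ℕ} (hm : 0 < m)
    {f : Fin (2 * m) → EuclideanSpace ℝ (Fin n)} (hf : Orthonormal ℝ f)
    (hfk : ∀ i, f i ∈ kernel M) :
    sampleLaw (covMat M ε) m {X | ∃ α : Fin m → ℝ,
        200 * √m * (√ε * √(∑ i, inner ℝ (f i) (∑ l, α l • X l) ^ 2)) < ‖α‖} ≤
      ENNReal.ofReal ((2 * m + 1) * Real.exp (-m)) := by
  set N : ℕ := 800 * m ^ 2 with hN
  have hm' : (0 : ℝ) < m := by exact_mod_cast hm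
  have hN0 : 0 < N := by positivity
  have hNr : (N : ℝ) = 800 * m ^ 2 := by rw [hN]; push_cast; ring
  set μ := sampleLaw (covMat M ε) m
  set φ : (Fin m → EuclideanSpace ℝ (Fin n)) → Fin m → Fin (2 * m) → ℝ :=
    fun X l i => √ε * inner ℝ (f i) (X l) with hφ
  have hφm : Measurable φ := by rw [hφ]; fun_prop
  have hmap : μ.map φ = Measure.pi fun _ => Measure.pi fun _ => gaussianReal 0 1 := by
    have h1 : IsProbabilityMeasure ((multivariateGaussian 0 (covMat M ε)).map
        fun x (i : Fin (2 * m)) => √ε * inner ℝ (f i) x) :=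
      Measure.isProbabilityMeasure_map (by fun_prop)
    have := Measure.pi_map_pi (μ := fun _ : Fin m => multivariateGaussian 0 (covMat M ε))
      (f := fun _ x (i : Fin (2 * m)) => √ε * inner ℝ (f i) x) (fun _ => by fun_prop)
    rw [show μ.map φ = _ from this]
    simp_rw [map_inner_kernel_multivariateGaussian M hε hf hfk]
  -- `a` is the squared length that `sum_sq_grid_le` yields for the nearest grid point: the short
  -- combination contributes `1 / (40000 m)`, and the rounding `1 / (2 N)` of each coefficient with
  -- the bound `16 m ^ 2` on the squared Frobenius norm the rest
  set a : ℝ := 40 * m ^ 3 / (800 * m ^ 2) ^ 2 with ha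
  set T := (Fintype.piFinset fun _ : Fin m => Finset.Icc (-N : ℤ) N).filter
    fun k => ∃ l, |(k l / N : ℝ)| = 1
  set big : Fin (2 * m) → Set (Fin m → EuclideanSpace ℝ (Fin n)) :=
    fun i => {X | 8 * m * (1 / ε) < ∑ l, inner ℝ (f i) (X l) ^ 2}
  set small : (Fin m → ℤ) → Set (Fin m → EuclideanSpace ℝ (Fin n)) :=
    fun k => φ ⁻¹' {Y | ∑ i, (∑ l, (k l / N : ℝ) * Y l i) ^ 2 ≤ a}
  have hcover : {X | ∃ α : Fin m → ℝ,
        200 * √m * (√ε * √(∑ i, inner ℝ (f i) (∑ l, α l • X l) ^ 2)) < ‖α‖} ⊆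
      (⋃ i ∈ (Finset.univ : Finset (Fin (2 * m))), big i) ∪ ⋃ k ∈ T, small k := by
    rintro X ⟨α, hα⟩
    by_contra hX
    simp only [Set.mem_union, Set.mem_iUnion, not_or, not_exists, Finset.mem_univ,
      true_implies] at hX
    obtain ⟨hbig, hsmall⟩ := hX
    have hα0 : 0 < ‖α‖ := lt_of_le_of_lt (by positivity) hα
    set β : Fin m → ℝ := ‖α‖⁻¹ • α
    have hβ : ‖β‖ = 1 := by
      rw [norm_smul, norm_inv, norm_norm, inv_mul_cancel₀ hα0.ne']
    obtain ⟨k, hk, hk1, hk2⟩ := exists_grid_point hN0 hβ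
    refine hsmall k (Finset.mem_filter.2 ⟨hk, hk1⟩) ?_
    have hY : ∑ i, ∑ l, φ X l i ^ 2 ≤ 16 * m ^ 2 := by
      calc _ ≤ ∑ _i : Fin (2 * m), (8 * m : ℝ) := by
            refine Finset.sum_le_sum fun i _ => ?_
            have h := hbig i
            simp only [big, Set.mem_ofPred_eq, not_lt] at h
            simp only [hφ, mul_pow, Real.sq_sqrt hε.le, ← Finset.mul_sum]
            calc _ ≤ ε * (8 * m * (1 / ε)) := by gcongr
              _ = _ := by field_simp
        _ = _ := by simp; ring
    have hβY : ∑ i, (∑ l, β l * φ X l i) ^ 2 ≤ 1 / (40000 * m) := by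
      have e : ∀ i, ∑ l, β l * φ X l i = ‖α‖⁻¹ * (√ε * inner ℝ (f i) (∑ l, α l • X l)) := by
        intro i
        simp only [inner_sum, real_inner_smul_right, Finset.mul_sum]
        refine Finset.sum_congr rfl fun l _ => ?_
        simp [hφ, β]; ring
      simp_rw [e, mul_pow, ← Finset.mul_sum]
      have h1 : (200 * √m * (√ε * √(∑ i, inner ℝ (f i) (∑ l, α l • X l) ^ 2))) ^ 2 ≤ ‖α‖ ^ 2 :=
        pow_le_pow_left₀ (by positivity) hα.le 2
      have hS : 0 ≤ ∑ i, inner ℝ (f i) (∑ l, α l • X l) ^ 2 := by positivity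
      rw [mul_pow, mul_pow, mul_pow, Real.sq_sqrt hm'.le, Real.sq_sqrt hε.le,
        Real.sq_sqrt hS] at h1
      rw [Real.sq_sqrt hε.le, le_div_iff₀ (by positivity), inv_pow, ← div_eq_inv_mul,
        div_mul_eq_mul_div, div_le_one (by positivity)]
      linarith
    have := sum_sq_grid_le hk2 hβY hY
    refine this.trans (le_of_eq ?_)
    rw [ha, hNr]
    field_simp
    ring
  calc μ _ ≤ μ (⋃ i ∈ (Finset.univ : Finset (Fin (2 * m))), big i) + μ (⋃ k ∈ T, small k) :=
        (measure_mono hcover).trans (measure_union_le _ _)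
    _ ≤ ∑ _i : Fin (2 * m), ENNReal.ofReal (Real.exp (-m)) + ∑ _k ∈ T, ENNReal.ofReal
          (Real.exp (m / a * a) * ((√(2 * (m / a)))⁻¹) ^ (2 * m)) := by
        gcongr
        · refine (measure_biUnion_finset_le _ _).trans (Finset.sum_le_sum fun i _ => ?_)
          refine sampleLaw_sum_inner_sq_gt_le M hε m (by positivity) ?_
          rw [norm_sq_covSqrt M hε, covMat_mulVec_of_mem_kernel M hε (hfk i), dotProduct_smul,
            ← inner_eq_dotProduct, real_inner_self_eq_norm_sq, hf.1 i]
          simp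
        · refine (measure_biUnion_finset_le _ _).trans (Finset.sum_le_sum fun k hk => ?_)
          obtain ⟨l, hl⟩ := (Finset.mem_filter.1 hk).2
          have hset : MeasurableSet {Y : Fin m → Fin (2 * m) → ℝ |
              ∑ i, (∑ l, (k l / N : ℝ) * Y l i) ^ 2 ≤ a} :=
            measurableSet_le (by fun_prop) measurable_const
          rw [← Measure.map_apply hφm hset, hmap]
          exact pi_gaussian_sum_sq_le hl (by positivity) a
    _ ≤ ENNReal.ofReal (2 * m * Real.exp (-m)) + ENNReal.ofReal (Real.exp (-m)) := by
        gcongr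
        · rw [Finset.sum_const, Finset.card_univ, Fintype.card_fin, nsmul_eq_mul,
            ENNReal.ofReal_mul (by positivity)]
          gcongr
          rw [← ENNReal.ofReal_natCast, Nat.cast_mul, Nat.cast_ofNat]
        · rw [Finset.sum_const, nsmul_eq_mul, ← ENNReal.ofReal_natCast,
            ← ENNReal.ofReal_mul (by positivity)]
          apply ENNReal.ofReal_le_ofReal
          refine le_trans ?_ (grid_union_bound hm)
          gcongr
          have hT : T.card ≤ (2 * (800 * m ^ 2) + 1) ^ m := by
            refine (Finset.card_filter_le _ _).trans (le_of_eq ?_)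
            rw [Fintype.card_piFinset_const, Int.card_Icc]
            congr 1
            omega
          exact_mod_cast hT
    _ = _ := by
        rw [← ENNReal.ofReal_add (by positivity) (by positivity)]; congr 1; ring

end SmallestSingularValue

/-! ### Anticoncentration for random combinations of vectors -/

section UniformLaw

theorem uniformLaw_apply (s : Set ℝ) :
    uniformLaw s = (ENNReal.ofReal 2)⁻¹ * volume (Set.Icc (-1) 1 ∩ s) := by
  rw [uniformLaw, cond_apply measurableSet_Icc, Real.volume_Icc]
  norm_num

theorem map_neg_uniformLaw : uniformLaw.map (fun x => -x) = uniformLaw := by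
  ext s hs
  rw [Measure.map_apply measurable_neg hs, uniformLaw_apply, uniformLaw_apply,
    ← Measure.measure_preimage_neg volume (Set.Icc (-1) 1 ∩ s)]
  congr 2
  ext x
  simp only [Set.mem_inter_iff, Set.mem_preimage, Set.mem_Icc]
  constructor <;> rintro ⟨⟨h1, h2⟩, h3⟩ <;> exact ⟨⟨by linarith, by linarith⟩, h3⟩

theorem ae_uniformLaw_mem_Icc : ∀ᵐ x ∂uniformLaw, x ∈ Set.Icc (-1 : ℝ) 1 :=
  ae_cond_mem measurableSet_Icc

/-- A uniform variable on `[-1, 1]` is the half-sum of a random sign and an independent copy. -/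
theorem map_sign_add_uniformLaw :
    ((uniformOn (Set.univ : Set Bool)).prod uniformLaw).map
      (fun q => ((if q.1 then 1 else -1) + q.2) / 2) = uniformLaw := by
  have hB : ∀ b : Bool, uniformOn (Set.univ : Set Bool) {b} = (ENNReal.ofReal 2)⁻¹ := by
    intro b
    rw [uniformOn_univ]
    simp
  have hmeas : Measurable fun q : Bool × ℝ => (((if q.1 then 1 else -1) + q.2) / 2 : ℝ) := by
    refine measurable_from_prod_countable_right fun b => ?_
    have h : Measurable fun y : ℝ => ((if b then 1 else -1) + y) / 2 := by fun_prop
    exact h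
  have key : ∀ (c : ℝ) (S : Set ℝ), volume {z : ℝ | (c + z) / 2 ∈ S} =
      ENNReal.ofReal 2 * volume S := by
    intro c S
    have e : {z : ℝ | (c + z) / 2 ∈ S} =
        (fun z => (1 / 2) * z) ⁻¹' ((fun y => c / 2 + y) ⁻¹' S) := by
      ext z
      simp only [Set.mem_ofPred_eq, Set.mem_preimage]
      rw [show (c + z) / 2 = c / 2 + 1 / 2 * z by ring]
    rw [e, Real.volume_preimage_mul_left (by norm_num), measure_preimage_add]
    norm_num
  have h2 : (ENNReal.ofReal 2)⁻¹ * ENNReal.ofReal 2 = 1 :=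
    ENNReal.inv_mul_cancel (by simp) (by simp)
  ext s hs
  rw [Measure.map_apply hmeas hs, Measure.prod_apply (hmeas hs), lintegral_fintype]
  simp only [Fintype.sum_bool, hB, uniformLaw_apply]
  have e1 : Set.Icc (-1 : ℝ) 1 ∩ Prod.mk true ⁻¹'
      ((fun q : Bool × ℝ => (((if q.1 then 1 else -1) + q.2) / 2 : ℝ)) ⁻¹' s) =
      {z : ℝ | (1 + z) / 2 ∈ Set.Icc 0 1 ∩ s} := by
    ext z
    simp only [Set.mem_inter_iff, Set.mem_preimage, Set.mem_Icc, Set.mem_ofPred_eq, if_true]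
    constructor <;> rintro ⟨⟨h1, h2⟩, h3⟩ <;> exact ⟨⟨by linarith, by linarith⟩, h3⟩
  have e2 : Set.Icc (-1 : ℝ) 1 ∩ Prod.mk false ⁻¹'
      ((fun q : Bool × ℝ => (((if q.1 then 1 else -1) + q.2) / 2 : ℝ)) ⁻¹' s) =
      {z : ℝ | (-1 + z) / 2 ∈ Set.Icc (-1) 0 ∩ s} := by
    ext z
    simp only [Set.mem_inter_iff, Set.mem_preimage, Set.mem_Icc, Set.mem_ofPred_eq,
      Bool.false_eq_true, if_false]
    constructor <;> rintro ⟨⟨h1, h2⟩, h3⟩ <;> exact ⟨⟨by linarith, by linarith⟩, h3⟩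
  rw [e1, e2, key, key, ← mul_assoc, ← mul_assoc, h2, one_mul, one_mul, ← add_mul, mul_comm]
  congr 1
  have h3 : volume (Set.Icc (-1 : ℝ) 0 ∩ s) = volume (Set.Ico (-1 : ℝ) 0 ∩ s) :=
    measure_congr (Ico_ae_eq_Icc.symm.inter (ae_eq_refl s))
  rw [h3, add_comm, ← measure_union _ (measurableSet_Icc.inter hs), ← Set.union_inter_distrib_right,
    Set.Ico_union_Icc_eq_Icc (by norm_num) (by norm_num)]
  rw [Set.disjoint_left]
  rintro x ⟨⟨-, h1⟩, -⟩ ⟨⟨h2, -⟩, -⟩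
  linarith

variable {E : Type*} [NormedAddCommGroup E] [InnerProductSpace ℝ E] [MeasurableSpace E]
  [BorelSpace E]

/-- By symmetry the cross term in the expansion of `‖x • u + q‖ ^ 2` averages out. -/
theorem lintegral_uniformLaw_norm_sq_le {u : E} (hu : ‖u‖ ≤ 1) (q : E) :
    ∫⁻ x, ENNReal.ofReal (‖x • u + q‖ ^ 2) ∂uniformLaw ≤ 1 + ENNReal.ofReal (‖q‖ ^ 2) := by
  have hneg : ∫⁻ x, ENNReal.ofReal (‖x • u + q‖ ^ 2) ∂uniformLaw =
      ∫⁻ x, ENNReal.ofReal (‖(-x) • u + q‖ ^ 2) ∂uniformLaw := by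
    conv_lhs => rw [← map_neg_uniformLaw]
    rw [lintegral_map (by fun_prop) measurable_neg]
  have h2 : 2 * ∫⁻ x, ENNReal.ofReal (‖x • u + q‖ ^ 2) ∂uniformLaw ≤
      2 * (1 + ENNReal.ofReal (‖q‖ ^ 2)) := by
    calc _ = ∫⁻ x, ENNReal.ofReal (‖x • u + q‖ ^ 2) + ENNReal.ofReal (‖(-x) • u + q‖ ^ 2)
          ∂uniformLaw := by
          rw [lintegral_add_left (by fun_prop), ← hneg, two_mul]
      _ ≤ ∫⁻ _, 2 * (1 + ENNReal.ofReal (‖q‖ ^ 2)) ∂uniformLaw := by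
          refine lintegral_mono_ae ?_
          filter_upwards [ae_uniformLaw_mem_Icc] with x hx
          rw [← ENNReal.ofReal_add (by positivity) (by positivity), ← ENNReal.ofReal_one,
            ← ENNReal.ofReal_add (by positivity) (by positivity),
            show (2 : ℝ≥0∞) = ENNReal.ofReal 2 by simp, ← ENNReal.ofReal_mul (by norm_num)]
          apply ENNReal.ofReal_le_ofReal
          rw [norm_add_sq_real, norm_add_sq_real, norm_smul, norm_smul, norm_neg,
            real_inner_smul_left, real_inner_smul_left]
          have h1 : ‖x‖ * ‖u‖ ≤ 1 := by
            have : ‖x‖ ≤ 1 := abs_le.2 hx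
            nlinarith [norm_nonneg x, norm_nonneg u]
          have h3 : 0 ≤ ‖x‖ * ‖u‖ := by positivity
          nlinarith
      _ = _ := by simp
  exact (ENNReal.mul_le_mul_iff_right (by simp) (by simp)).1 h2

/-- The second moment of a combination of `t` vectors of length at most one with independent uniform
coefficients is at most `t`. -/
theorem lintegral_norm_sq_sum_le [SecondCountableTopology E] {t : ℕ} {u : Fin t → E}
    (hu : ∀ l, ‖u l‖ ≤ 1) :
    ∫⁻ z, ENNReal.ofReal (‖∑ l, z l • u l‖ ^ 2) ∂(Measure.pi fun _ : Fin t => uniformLaw) ≤ t := by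
  have h : ∀ s : Finset (Fin t), ∫⁻ z, ENNReal.ofReal (‖∑ l ∈ s, z l • u l‖ ^ 2)
      ∂(Measure.pi fun _ : Fin t => uniformLaw) ≤ s.card := by
    intro s
    induction s using Finset.cons_induction with
    | empty => simp
    | cons i s his ih =>
      rw [lintegral_pi_update _ i (by fun_prop)]
      calc _ ≤ ∫⁻ z, 1 + ENNReal.ofReal (‖∑ l ∈ s, z l • u l‖ ^ 2)
            ∂(Measure.pi fun _ : Fin t => uniformLaw) := by
            refine lintegral_mono fun z => ?_
            refine le_trans (le_of_eq ?_) (lintegral_uniformLaw_norm_sq_le (hu i) _)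
            refine lintegral_congr fun x => ?_
            rw [Finset.sum_cons, Function.update_self]
            congr 4
            refine Finset.sum_congr rfl fun l hl => ?_
            rw [Function.update_of_ne (ne_of_mem_of_not_mem hl his)]
        _ ≤ 1 + s.card := by
            rw [lintegral_add_left measurable_const]
            simpa using ih
        _ = _ := by rw [Finset.card_cons]; push_cast; ring
  simpa using h Finset.univ

end UniformLaw

section Signs

/-- If `#{i | σ i}` varies by at most `d` over a set of sign patterns, the set is small. -/
theorem pi_bool_le {ι : Type*} [Fintype ι] [DecidableEq ι] {A : Set (ι → Bool)} {d : ℝ}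
    (hd : 0 ≤ d)
    (hA : ∀ σ ∈ A, ∀ σ' ∈ A, |((Finset.univ.filter fun i => σ i).card : ℝ) -
      (Finset.univ.filter fun i => σ' i).card| ≤ d) :
    (Measure.pi fun _ : ι => uniformOn (Set.univ : Set Bool)) A ≤
      ENNReal.ofReal ((d + 1) / √(Fintype.card ι + 1)) := by
  classical
  set N := Fintype.card ι
  set c : (ι → Bool) → ℕ := fun σ => (Finset.univ.filter fun i => σ i).card with hc
  set S : Finset (ι → Bool) := Finset.univ.filter fun σ => σ ∈ A
  have hSA : A = (S : Set (ι → Bool)) := by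
    ext σ
    exact ⟨fun h => Finset.mem_coe.2 (Finset.mem_filter.2 ⟨Finset.mem_univ _, h⟩),
      fun h => (Finset.mem_filter.1 (Finset.mem_coe.1 h)).2⟩
  have hsing : ∀ σ : ι → Bool, (Measure.pi fun _ : ι => uniformOn (Set.univ : Set Bool)) {σ} =
      ENNReal.ofReal ((1 / 2) ^ N) := by
    intro σ
    rw [Measure.pi_singleton]
    have : ∀ b : Bool, uniformOn (Set.univ : Set Bool) {b} = ENNReal.ofReal (1 / 2) := by
      intro b
      rw [uniformOn_univ, ENNReal.ofReal_div_of_pos (by norm_num)]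
      simp
    simp_rw [this]
    rw [Finset.prod_const, ENNReal.ofReal_pow (by norm_num)]
    rfl
  have hmeas : (Measure.pi fun _ : ι => uniformOn (Set.univ : Set Bool)) A =
      ENNReal.ofReal (S.card * (1 / 2) ^ N) := by
    rw [hSA, ← sum_measure_singleton]
    simp_rw [hsing]
    rw [Finset.sum_const, nsmul_eq_mul, ENNReal.ofReal_mul (Nat.cast_nonneg _),
      ENNReal.ofReal_natCast]
  rw [hmeas]
  apply ENNReal.ofReal_le_ofReal
  -- the patterns with a prescribed number of positive signs are counted by a binomial coefficient
  have hfib : ∀ j, (((S.filter fun σ => c σ = j).card : ℕ) : ℝ) ≤ 2 ^ N / √(N + 1) := by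
    intro j
    have h1 : (S.filter fun σ => c σ = j).card ≤ N.choose j := by
      rw [show N = (Finset.univ : Finset ι).card from rfl, ← Finset.card_powersetCard]
      refine Finset.card_le_card_of_injOn (fun σ => Finset.univ.filter fun i => σ i) ?_ ?_
      · intro σ hσ
        exact Finset.mem_coe.2 (Finset.mem_powersetCard.2 ⟨Finset.subset_univ _,
          (Finset.mem_filter.1 (Finset.mem_coe.1 hσ)).2⟩)
      · intro σ _ σ' _ h
        funext i
        have h' : i ∈ Finset.univ.filter (fun i => σ i) ↔ i ∈ Finset.univ.filter (fun i => σ' i) :=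
          Finset.ext_iff.1 h i
        rw [Finset.mem_filter, Finset.mem_filter] at h'
        exact Bool.eq_iff_iff.2 ⟨fun hh => (h'.1 ⟨Finset.mem_univ _, hh⟩).2,
          fun hh => (h'.2 ⟨Finset.mem_univ _, hh⟩).2⟩
    rw [le_div_iff₀ (by positivity)]
    have h2 : ((N.choose j : ℕ) : ℝ) ^ 2 * (N + 1) ≤ 4 ^ N := by
      exact_mod_cast choose_sq_mul_le N j
    have h3 : ((N.choose j : ℕ) : ℝ) * √(N + 1) ≤ 2 ^ N := by
      refine (sq_le_sq₀ (by positivity) (by positivity)).1 ?_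
      rw [mul_pow, Real.sq_sqrt (by positivity), ← pow_mul, mul_comm N 2, pow_mul]
      norm_num at h2 ⊢
      exact h2
    refine le_trans ?_ h3
    gcongr
  rcases S.eq_empty_or_nonempty with hS | hS
  · rw [hS]; simp; positivity
  obtain ⟨σ₀, hσ₀, hmin⟩ := Finset.exists_min_image S c hS
  have himg : S.image c ⊆ Finset.Icc (c σ₀) (c σ₀ + ⌊d⌋₊) := by
    intro j hj
    obtain ⟨σ, hσ, rfl⟩ := Finset.mem_image.1 hj
    have h1 := hmin σ hσ
    have h2 := hA σ (by rw [hSA]; exact hσ) σ₀ (by rw [hSA]; exact hσ₀)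
    have h3 : ((c σ - c σ₀ : ℕ) : ℝ) ≤ d := by
      rw [Nat.cast_sub h1]; exact (le_abs_self _).trans h2
    have h4 := Nat.le_floor h3
    rw [Finset.mem_Icc]
    omega
  have hcard : ((S.image c).card : ℝ) ≤ d + 1 := by
    have h1 := Finset.card_le_card himg
    rw [Nat.card_Icc] at h1
    have h2 : ((S.image c).card : ℝ) ≤ (⌊d⌋₊ : ℝ) + 1 := by
      have : (S.image c).card ≤ ⌊d⌋₊ + 1 := by omega
      exact_mod_cast this
    linarith [Nat.floor_le hd]
  have hS2 : (S.card : ℝ) ≤ (d + 1) * (2 ^ N / √(N + 1)) := by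
    rw [Finset.card_eq_sum_card_image c S]
    push_cast
    calc _ ≤ ∑ _j ∈ S.image c, (2 ^ N / √(N + 1) : ℝ) := Finset.sum_le_sum fun j _ => hfib j
      _ = (S.image c).card * (2 ^ N / √(N + 1)) := by rw [Finset.sum_const, nsmul_eq_mul]
      _ ≤ _ := by gcongr
  calc _ ≤ (d + 1) * (2 ^ N / √(N + 1)) * (1 / 2) ^ N := by gcongr
    _ = (d + 1) / √(N + 1) * (2 * (1 / 2)) ^ N := by rw [mul_pow]; ring
    _ = _ := by norm_num

end Signs

section Combination

/-- Under a product of probability measures, a set of coordinates may be drawn afresh. -/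
theorem lintegral_pi_updateFinset {ι : Type*} [Fintype ι] [DecidableEq ι] {X : ι → Type*}
    [∀ i, MeasurableSpace (X i)] (μ : ∀ i, Measure (X i)) [∀ i, IsProbabilityMeasure (μ i)]
    (s : Finset ι) {f : (∀ i, X i) → ℝ≥0∞} (hf : Measurable f) :
    ∫⁻ g, f g ∂Measure.pi μ = ∫⁻ g, ∫⁻ y : ∀ i : s, X i, f (Function.updateFinset g s y)
      ∂(Measure.pi fun i : s => μ i) ∂Measure.pi μ := by
  have hm : Measurable (∫⋯∫⁻_s, f ∂μ) := hf.lmarginal μ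
  refine lintegral_eq_of_lmarginal_eq (μ := μ) s hf hm ?_
  ext g
  have h : ∀ y : ∀ i : s, X i, (∫⋯∫⁻_s, f ∂μ) (Function.updateFinset g s y) =
      (∫⋯∫⁻_s, f ∂μ) g := fun y => lmarginal_congr μ f fun i hi => by
    simp [Function.updateFinset, hi]
  change _ = ∫⁻ y : ∀ i : s, X i, (∫⋯∫⁻_s, f ∂μ) (Function.updateFinset g s y) ∂_
  simp_rw [h]
  rw [lintegral_const, measure_univ, mul_one]

variable {n t : ℕ} {F : Seminorm ℝ (EuclideanSpace ℝ (Fin n))}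
  {T : EuclideanSpace ℝ (Fin n) →L[ℝ] EuclideanSpace ℝ (Fin n)}
  {v : Fin t → EuclideanSpace ℝ (Fin n)} {L D : ℝ}

/-- Anticoncentration from the randomness of a single coefficient. -/
theorem pi_uniformLaw_seminorm_le_of_one (hF : Continuous F) (hv : ∀ l, ‖T (v l)‖ ≤ 1)
    (hL : 0 < L) (hD : 0 < D) {l₀ : Fin t} (h : D * L ≤ F (v l₀)) :
    (Measure.pi fun _ : Fin t => uniformLaw)
      {z | F (∑ l, z l • v l) ≤ L * ‖T (∑ l, z l • v l)‖} ≤ ENNReal.ofReal ((1 + √t) / D) := by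
  classical
  have ht : 0 < t := l₀.pos
  have ht' : (0 : ℝ) < √t := Real.sqrt_pos.2 (by exact_mod_cast ht)
  set q : (Fin t → ℝ) → EuclideanSpace ℝ (Fin n) := fun z => ∑ l ∈ Finset.univ.erase l₀, z l • v l
    with hq
  have hset : MeasurableSet {z : Fin t → ℝ | F (∑ l, z l • v l) ≤ L * ‖T (∑ l, z l • v l)‖} :=
    measurableSet_le (hF.measurable.comp (by fun_prop)) (by fun_prop)
  refine (measure_pi_le_lintegral_of_slices _ l₀ hset
    (fun z => ENNReal.ofReal ((1 + ‖T (q z)‖) / D)) fun z => ?_).trans ?_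
  · have hupd : ∀ x : ℝ, ∑ l, Function.update z l₀ x l • v l = x • v l₀ + q z := by
      intro x
      rw [← Finset.add_sum_erase _ _ (Finset.mem_univ l₀), Function.update_self]
      congr 1
      refine Finset.sum_congr rfl fun l hl => ?_
      rw [Function.update_of_ne (Finset.ne_of_mem_erase hl)]
    simp only [Set.mem_ofPred_eq, hupd]
    have hmono : uniformLaw {x | F (x • v l₀ + q z) ≤ L * ‖T (x • v l₀ + q z)‖} ≤
        uniformLaw ({x | F (x • v l₀ + q z) ≤ L * ‖T (x • v l₀ + q z)‖} ∩ Set.Icc (-1) 1) := by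
      refine measure_mono_ae ?_
      filter_upwards [ae_uniformLaw_mem_Icc] with x hx hs using ⟨hs, hx⟩
    refine hmono.trans ?_
    rw [show (1 + ‖T (q z)‖) / D = (2 * (1 + ‖T (q z)‖) / D) / 2 by ring]
    refine uniformLaw_le_of_forall_abs_sub_le ?_
    have hb : ∀ x ∈ {x : ℝ | F (x • v l₀ + q z) ≤ L * ‖T (x • v l₀ + q z)‖} ∩ Set.Icc (-1) 1,
        F (x • v l₀ + q z) ≤ L * (1 + ‖T (q z)‖) := by
      rintro x ⟨hx, hx1⟩
      refine le_trans hx ?_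
      gcongr
      rw [map_add, map_smul]
      refine (norm_add_le _ _).trans ?_
      gcongr
      rw [norm_smul]
      have : ‖x‖ ≤ 1 := abs_le.2 hx1
      nlinarith [hv l₀, norm_nonneg x, norm_nonneg (T (v l₀))]
    intro x hx y hy
    have h1 : |x - y| * F (v l₀) ≤ 2 * (L * (1 + ‖T (q z)‖)) := by
      have e : (x - y) • v l₀ = (x • v l₀ + q z) - (y • v l₀ + q z) := by module
      rw [← Real.norm_eq_abs, ← map_smul_eq_mul, e]
      have := map_sub_le_add F (x • v l₀ + q z) (y • v l₀ + q z)
      linarith [hb x hx, hb y hy]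
    rw [le_div_iff₀ hD]
    have h2 : L * (|x - y| * D) ≤ L * (2 * (1 + ‖T (q z)‖)) := by
      calc _ = |x - y| * (D * L) := by ring
        _ ≤ |x - y| * F (v l₀) := by gcongr
        _ ≤ _ := by linarith
    exact le_of_mul_le_mul_left h2 hL
  · set u : Fin t → EuclideanSpace ℝ (Fin n) := fun l => if l = l₀ then 0 else T (v l)
    have hu : ∀ l, ‖u l‖ ≤ 1 := by
      intro l
      by_cases h : l = l₀ <;> simp [u, h, hv]
    have hTq : ∀ z, T (q z) = ∑ l, z l • u l := by
      intro z
      rw [← Finset.add_sum_erase _ _ (Finset.mem_univ l₀), hq, map_sum]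
      simp only [u, if_true, smul_zero, zero_add]
      refine Finset.sum_congr rfl fun l hl => ?_
      rw [if_neg (Finset.ne_of_mem_erase hl), map_smul]
    simp_rw [hTq]
    calc _ ≤ ∫⁻ z, ENNReal.ofReal ((1 + √t / 2) / D) + ENNReal.ofReal (1 / (2 * √t * D)) *
            ENNReal.ofReal (‖∑ l, z l • u l‖ ^ 2) ∂(Measure.pi fun _ : Fin t => uniformLaw) := by
          refine lintegral_mono fun z => ?_
          dsimp only
          rw [← ENNReal.ofReal_mul (by positivity), ← ENNReal.ofReal_add (by positivity)
            (by positivity)]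
          apply ENNReal.ofReal_le_ofReal
          set X := ‖∑ l, z l • u l‖
          -- bounds the first moment of `X` by the second, which is at most `t`
          have h1 : X ≤ √t / 2 + X ^ 2 / (2 * √t) := by
            rw [div_add_div _ _ (by norm_num) (by positivity), le_div_iff₀ (by positivity)]
            nlinarith [sq_nonneg (X - √t)]
          calc (1 + X) / D ≤ (1 + (√t / 2 + X ^ 2 / (2 * √t))) / D := by gcongr
            _ = _ := by field_simp; ring
      _ ≤ ENNReal.ofReal ((1 + √t / 2) / D) + ENNReal.ofReal (1 / (2 * √t * D)) *
            ENNReal.ofReal t := by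
          rw [lintegral_add_left measurable_const, lintegral_const_mul _ (by fun_prop)]
          gcongr
          · simp
          · rw [ENNReal.ofReal_natCast]; exact lintegral_norm_sq_sum_le hu
      _ = _ := by
          rw [← ENNReal.ofReal_mul (by positivity), ← ENNReal.ofReal_add (by positivity)
            (by positivity)]
          congr 1
          have : (t : ℝ) = √t * √t := (Real.mul_self_sqrt (by positivity)).symm
          rw [this, Real.sqrt_mul_self (by positivity)]
          field_simp
          ring

/-- Replacing each uniform coefficient by the half-sum of a sign and an independent copy. -/
theorem pi_uniformLaw_eq_lintegral_signs {A : Set (Fin t → ℝ)} (hA : MeasurableSet A) :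
    (Measure.pi fun _ : Fin t => uniformLaw) A =
      ∫⁻ z, (Measure.pi fun _ : Fin t => uniformOn (Set.univ : Set Bool))
        {σ | (fun l => ((if σ l then 1 else -1) + z l) / 2) ∈ A}
          ∂(Measure.pi fun _ : Fin t => uniformLaw) := by
  set ub : Measure Bool := uniformOn Set.univ
  set κ : Bool × ℝ → ℝ := fun q => ((if q.1 then 1 else -1) + q.2) / 2
  have hκ : Measurable κ := by
    refine measurable_from_prod_countable_right fun b => ?_
    have h : Measurable fun y : ℝ => ((if b then 1 else -1) + y) / 2 := by fun_prop
    exact h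
  have hpi : (Measure.pi fun _ : Fin t => ub.prod uniformLaw).map (fun ω l => κ (ω l)) =
      Measure.pi fun _ : Fin t => uniformLaw := by
    have h1 : IsProbabilityMeasure ((ub.prod uniformLaw).map κ) :=
      Measure.isProbabilityMeasure_map hκ.aemeasurable
    rw [Measure.pi_map_pi (f := fun _ => κ) (fun _ => hκ.aemeasurable)]
    simp_rw [show (ub.prod uniformLaw).map κ = uniformLaw from map_sign_add_uniformLaw]
  have hmp := (measurePreserving_arrowProdEquivProdArrow Bool ℝ (Fin t) (fun _ => ub)
    (fun _ => uniformLaw)).symm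
  have hm : Measurable fun (ω : Fin t → Bool × ℝ) l => κ (ω l) := by fun_prop
  conv_lhs => rw [← hpi]
  rw [Measure.map_apply hm hA, ← hmp.measure_preimage (hm hA).nullMeasurableSet,
    Measure.prod_apply_symm (hmp.measurable (hm hA))]
  rfl

/-- Anticoncentration from the randomness of many coefficients of the same vector: the number of
positive signs among them is binomial. -/
theorem pi_uniformLaw_seminorm_le_of_many (hF : Continuous F) (hL : 0 < L) (hD : 0 < D)
    {a : EuclideanSpace ℝ (Fin n)} (h : D * L ≤ F a) {I : Finset (Fin t)} (hI : ∀ l ∈ I, v l = a)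
    {H : ℝ} (hH : 0 ≤ H) :
    (Measure.pi fun _ : Fin t => uniformLaw) {z | F (∑ l, z l • v l) ≤ L * H} ≤
      ENNReal.ofReal ((2 * H / D + 1) / √(I.card + 1)) := by
  classical
  have hset : MeasurableSet {z : Fin t → ℝ | F (∑ l, z l • v l) ≤ L * H} :=
    measurableSet_le (hF.measurable.comp (by fun_prop)) measurable_const
  rw [pi_uniformLaw_eq_lintegral_signs hset]
  suffices hs : ∀ z : Fin t → ℝ, (Measure.pi fun _ : Fin t => uniformOn (Set.univ : Set Bool))
      {σ | (fun l => ((if σ l then 1 else -1) + z l) / 2) ∈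
        {z : Fin t → ℝ | F (∑ l, z l • v l) ≤ L * H}} ≤
      ENNReal.ofReal ((2 * H / D + 1) / √(I.card + 1)) by
    refine (lintegral_mono hs).trans ?_
    simp
  intro z
  simp only [Set.mem_ofPred_eq]
  set A : Set (Fin t → Bool) :=
    {σ | F (∑ l, (((if σ l then 1 else -1) + z l) / 2 : ℝ) • v l) ≤ L * H}
  have hAm : MeasurableSet A := A.toFinite.measurableSet
  rw [← lintegral_indicator_one hAm,
    lintegral_pi_updateFinset _ I (measurable_one.indicator hAm)]
  suffices hs : ∀ g : Fin t → Bool, (Measure.pi fun _ : I => uniformOn (Set.univ : Set Bool))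
      {y | Function.updateFinset g I y ∈ A} ≤
      ENNReal.ofReal ((2 * H / D + 1) / √(I.card + 1)) by
    calc _ ≤ ∫⁻ _, ENNReal.ofReal ((2 * H / D + 1) / √(I.card + 1))
          ∂(Measure.pi fun _ : Fin t => uniformOn (Set.univ : Set Bool)) := by
          refine lintegral_mono fun g => le_trans (le_of_eq ?_) (hs g)
          have hm : MeasurableSet {y : I → Bool | Function.updateFinset g I y ∈ A} :=
            (Set.toFinite _).measurableSet
          rw [← lintegral_indicator_one hm]
          rfl
      _ = _ := by rw [lintegral_const, measure_univ, mul_one]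
  intro g
  rw [← Fintype.card_coe I]
  refine pi_bool_le (by positivity) ?_
  intro y hy y' hy'
  set c : (I → Bool) → ℝ := fun y => ((Finset.univ.filter fun i => y i).card : ℝ)
  have hdiff : ∑ l, (((if Function.updateFinset g I y l then 1 else -1) + z l) / 2 : ℝ) • v l -
      ∑ l, (((if Function.updateFinset g I y' l then 1 else -1) + z l) / 2 : ℝ) • v l =
      (c y - c y') • a := by
    rw [← Finset.sum_sub_distrib]
    have hc : ∀ y : I → Bool, c y = ∑ i : I, if y i then (1 : ℝ) else 0 := by
      intro y; simp [c]
    rw [hc, hc, ← Finset.sum_sub_distrib, Finset.sum_smul,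
      ← Finset.sum_subset (Finset.subset_univ I), ← Finset.sum_coe_sort I]
    · refine Finset.sum_congr rfl fun i _ => ?_
      rw [← sub_smul, hI i i.2]
      congr 1
      simp only [Function.updateFinset, i.2, dite_true]
      by_cases h1 : y i <;> by_cases h2 : y' i <;> simp [h1, h2] <;> ring
    · intro l _ hl
      simp [Function.updateFinset, hl]
  have h1 : |c y - c y'| * F a ≤ 2 * (L * H) := by
    rw [← Real.norm_eq_abs, ← map_smul_eq_mul, ← hdiff]
    refine (map_sub_le_add F _ _).trans ?_
    have h2 : F _ ≤ L * H := hy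
    have h3 : F _ ≤ L * H := hy'
    linarith
  rw [le_div_iff₀ hD]
  have h2 : L * (|c y - c y'| * D) ≤ L * (2 * H) := by
    calc _ = |c y - c y'| * (D * L) := by ring
      _ ≤ |c y - c y'| * F a := by gcongr
      _ ≤ _ := by linarith
  exact le_of_mul_le_mul_left h2 hL

/-- Anticoncentration from many coefficients, relative to a Hilbert norm `‖T ·‖` that Markov's
inequality bounds by `√(ρ t)`. -/
theorem pi_uniformLaw_seminorm_le_norm_of_many (hF : Continuous F) (hv : ∀ l, ‖T (v l)‖ ≤ 1)
    (hL : 0 < L) (hD : 0 < D) {a : EuclideanSpace ℝ (Fin n)} (h : D * L ≤ F a)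
    {I : Finset (Fin t)} (hI : ∀ l ∈ I, v l = a) {ρ : ℝ} (hρ : 0 < ρ) (ht : 0 < t) :
    (Measure.pi fun _ : Fin t => uniformLaw)
      {z | F (∑ l, z l • v l) ≤ L * ‖T (∑ l, z l • v l)‖} ≤
      ENNReal.ofReal (1 / ρ + (2 * √(ρ * t) / D + 1) / √(I.card + 1)) := by
  have ht' : (0 : ℝ) < t := by exact_mod_cast ht
  set μ := Measure.pi fun _ : Fin t => uniformLaw
  have hTv : ∀ z : Fin t → ℝ, T (∑ l, z l • v l) = ∑ l, z l • T (v l) := by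
    intro z; simp [map_sum]
  have hmarkov : μ {z | ENNReal.ofReal (ρ * t) ≤ ENNReal.ofReal (‖T (∑ l, z l • v l)‖ ^ 2)} ≤
      ENNReal.ofReal (1 / ρ) := by
    have h1 := mul_meas_ge_le_lintegral (μ := μ)
      (f := fun z => ENNReal.ofReal (‖T (∑ l, z l • v l)‖ ^ 2)) (by fun_prop)
      (ENNReal.ofReal (ρ * t))
    simp_rw [hTv] at h1 ⊢
    have h2 := h1.trans (lintegral_norm_sq_sum_le hv)
    have h3 : ENNReal.ofReal (1 / ρ) = (t : ℝ≥0∞) / ENNReal.ofReal (ρ * t) := by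
      rw [← ENNReal.ofReal_natCast, ← ENNReal.ofReal_div_of_pos (by positivity)]
      congr 1; field_simp
    rw [h3, ENNReal.le_div_iff_mul_le (Or.inl (by simp; positivity)) (Or.inl (by simp)), mul_comm]
    exact h2
  rw [ENNReal.ofReal_add (by positivity) (by positivity)]
  refine le_trans ?_ (add_le_add hmarkov
    (pi_uniformLaw_seminorm_le_of_many (v := v) hF hL hD h hI (Real.sqrt_nonneg (ρ * t))))
  refine le_trans (measure_mono fun z hz => ?_) (measure_union_le _ _)
  by_cases hc : ENNReal.ofReal (ρ * t) ≤ ENNReal.ofReal (‖T (∑ l, z l • v l)‖ ^ 2)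
  · exact Or.inl hc
  · right
    rw [ENNReal.ofReal_le_ofReal_iff (by positivity), not_le] at hc
    have h1 : ‖T (∑ l, z l • v l)‖ ≤ √(ρ * t) := Real.le_sqrt_of_sq_le hc.le
    have hz' : F (∑ l, z l • v l) ≤ L * ‖T (∑ l, z l • v l)‖ := hz
    exact hz'.trans (by gcongr)

end Combination

/-! ### Random combinations of rows -/

section RandomRows

/-- A bound for a product measure by conditioning on the first component. -/
theorem prod_le_of_forall_mem {α β : Type*} [MeasurableSpace α] [MeasurableSpace β]
    (μ : Measure α) (ν : Measure β) [IsProbabilityMeasure μ] [IsProbabilityMeasure ν]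
    {A : Set (α × β)} (hA : MeasurableSet A) {Γ : Set α} (hΓ : MeasurableSet Γ) {e₁ e₂ : ℝ≥0∞}
    (h₁ : μ Γᶜ ≤ e₁) (h₂ : ∀ x ∈ Γ, ν {y | (x, y) ∈ A} ≤ e₂) : μ.prod ν A ≤ e₁ + e₂ := by
  rw [Measure.prod_apply hA]
  calc _ ≤ ∫⁻ x, Γᶜ.indicator (fun _ => 1) x + e₂ ∂μ := by
        refine lintegral_mono fun x => ?_
        by_cases hx : x ∈ Γ
        · exact (h₂ x hx).trans le_add_self
        · rw [Set.indicator_of_mem hx]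
          exact prob_le_one.trans le_self_add
    _ = μ Γᶜ + e₂ := by
        rw [lintegral_add_right _ measurable_const, lintegral_indicator_const hΓ.compl]
        simp
    _ ≤ _ := by gcongr

variable {p t : ℕ}

theorem uniformOn_univ_finset [NeZero p] (B : Finset (Fin p)) :
    uniformOn (Set.univ : Set (Fin p)) B = ENNReal.ofReal (B.card / p) := by
  have : 0 < p := Nat.pos_of_neZero p
  rw [uniformOn_univ, Measure.count_apply_finset, Fintype.card_fin,
    ENNReal.ofReal_div_of_pos (by exact_mod_cast this), ENNReal.ofReal_natCast,
    ENNReal.ofReal_natCast]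

/-- The probability that `t` random row indices all miss `B`. -/
theorem pi_uniformOn_forall_notMem_le [NeZero p] {B : Finset (Fin p)} {b : ℝ} (hb : b ≤ B.card) :
    (Measure.pi fun _ : Fin t => uniformOn (Set.univ : Set (Fin p))) {R | ∀ l, R l ∉ B} ≤
      ENNReal.ofReal (Real.exp (-(b * t / p))) := by
  have hp : (0 : ℝ) < p := by exact_mod_cast Nat.pos_of_neZero p
  have e : {R : Fin t → Fin p | ∀ l, R l ∉ B} =
      Set.univ.pi fun _ => ((Bᶜ : Finset (Fin p)) : Set (Fin p)) := by
    ext R; simp [Set.mem_pi]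
  rw [e, Measure.pi_pi, uniformOn_univ_finset, Finset.prod_const, Finset.card_univ,
    Fintype.card_fin, ← ENNReal.ofReal_pow (by positivity)]
  apply ENNReal.ofReal_le_ofReal
  have h1 : ((Bᶜ : Finset (Fin p)).card : ℝ) / p ≤ Real.exp (-(b / p)) := by
    rw [Finset.card_compl, Fintype.card_fin,
      Nat.cast_sub (by simpa using Finset.card_le_univ B), sub_div, div_self hp.ne']
    have := Real.add_one_le_exp (-(b / p))
    have : b / p ≤ B.card / p := by gcongr
    linarith
  calc _ ≤ Real.exp (-(b / p)) ^ t := by gcongr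
    _ = _ := by rw [← Real.exp_nat_mul]; congr 1; ring

/-- A fixed row index is drawn at least a quarter of the expected number of times. -/
theorem pi_uniformOn_card_le [NeZero p] (i₀ : Fin p) :
    (Measure.pi fun _ : Fin t => uniformOn (Set.univ : Set (Fin p)))
      {R | ((Finset.univ.filter fun l => R l = i₀).card : ℝ) ≤ t / (4 * p)} ≤
      ENNReal.ofReal (Real.exp (-(t / (4 * p)))) := by
  have hp : (0 : ℝ) < p := by exact_mod_cast Nat.pos_of_neZero p
  set φ : Fin p → ℝ := fun i => -(if i = i₀ then 1 else 0)
  have hφ : ∫⁻ i, ENNReal.ofReal (Real.exp (φ i)) ∂uniformOn (Set.univ : Set (Fin p)) ≤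
      ENNReal.ofReal (Real.exp (-(1 / (2 * p)))) := by
    have hsing : ∀ i : Fin p, uniformOn (Set.univ : Set (Fin p)) {i} = ENNReal.ofReal (1 / p) := by
      intro i
      have := uniformOn_univ_finset ({i} : Finset (Fin p))
      simpa using this
    rw [lintegral_fintype]
    simp_rw [hsing, ← ENNReal.ofReal_mul (Real.exp_pos _).le]
    rw [← ENNReal.ofReal_sum_of_nonneg fun i _ => by positivity]
    apply ENNReal.ofReal_le_ofReal
    rw [← Finset.sum_mul, ← Finset.add_sum_erase _ _ (Finset.mem_univ i₀)]
    have h1 : ∑ i ∈ Finset.univ.erase i₀, Real.exp (φ i) = p - 1 := by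
      rw [Finset.sum_congr rfl (g := fun _ => (1 : ℝ)) fun i hi => by
        simp [φ, Finset.ne_of_mem_erase hi]]
      rw [Finset.sum_const, Finset.card_erase_of_mem (Finset.mem_univ _), Finset.card_univ,
        Fintype.card_fin, nsmul_eq_mul, Nat.cast_sub (Nat.pos_of_neZero p)]
      simp
    have h2 : Real.exp (φ i₀) ≤ 1 / 2 := by
      simp only [φ, if_true]
      rw [Real.exp_neg, one_div]
      gcongr
      linarith [Real.add_one_le_exp 1]
    rw [h1]
    have h3 := Real.add_one_le_exp (-(1 / (2 * p : ℝ)))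
    have h4 : (Real.exp (φ i₀) + (p - 1)) * (1 / p) ≤ (1 / 2 + (p - 1)) * (1 / p : ℝ) := by gcongr
    have h5 : (1 / 2 + (p - 1)) * (1 / p : ℝ) = -(1 / (2 * p)) + 1 := by field_simp; ring
    linarith
  calc _ ≤ (Measure.pi fun _ : Fin t => uniformOn (Set.univ : Set (Fin p)))
        {R | -(t / (4 * p) : ℝ) ≤ ∑ l, φ (R l)} := by
        refine measure_mono fun R hR => ?_
        simp only [Set.mem_ofPred_eq, φ, Finset.sum_neg_distrib, Finset.sum_boole] at hR ⊢
        linarith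
    _ ≤ ENNReal.ofReal (Real.exp (- -(t / (4 * p) : ℝ))) * ∫⁻ R, ENNReal.ofReal (Real.exp
          (∑ l, φ (R l))) ∂(Measure.pi fun _ : Fin t => uniformOn (Set.univ : Set (Fin p))) :=
        measure_le_exp_mul_lintegral _ (measurable_of_finite _) _
    _ ≤ ENNReal.ofReal (Real.exp (- -(t / (4 * p) : ℝ))) *
          ∏ _l : Fin t, ENNReal.ofReal (Real.exp (-(1 / (2 * p)))) := by
        refine mul_le_mul' le_rfl ?_
        calc _ = ∏ _l : Fin t, ∫⁻ i, ENNReal.ofReal (Real.exp (φ i))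
              ∂uniformOn (Set.univ : Set (Fin p)) := by
              rw [← lintegral_pi_prod _ (fun _ => measurable_of_finite _)]
              refine lintegral_congr fun R => ?_
              rw [Real.exp_sum, ENNReal.ofReal_prod_of_nonneg fun _ _ => (Real.exp_pos _).le]
          _ ≤ _ := Finset.prod_le_prod' fun _ _ => hφ
    _ = _ := by
        rw [Finset.prod_const, Finset.card_univ, Fintype.card_fin,
          ← ENNReal.ofReal_pow (Real.exp_pos _).le, ← ENNReal.ofReal_mul (Real.exp_pos _).le,
          ← Real.exp_nat_mul, ← Real.exp_add]
        congr 2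
        field_simp
        ring

variable {n : ℕ} {F : Seminorm ℝ (EuclideanSpace ℝ (Fin n))}
  {T : EuclideanSpace ℝ (Fin n) →L[ℝ] EuclideanSpace ℝ (Fin n)} {L D : ℝ}

/-- A random combination of vectors is large in a seminorm `F`, relative to a Hilbert norm
`‖T ·‖`, as soon as one of the vectors with large value of `F` is drawn. For few terms a single
coefficient provides the randomness; for many terms each vector is drawn often. -/
theorem prod_rows_seminorm_le [NeZero p] (hpn : p ≤ n) (hn : 10 ≤ n) (ht : 0 < t)
    (hF : Continuous F) {a : Fin p → EuclideanSpace ℝ (Fin n)} (ha : ∀ i, ‖T (a i)‖ ≤ 1)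
    (hL : 0 < L) (hD : 100 * ((n : ℝ) ^ 2 * √n) ≤ D) {B : Finset (Fin p)}
    (hB : ∀ i ∈ B, D * L ≤ F (a i)) {b : ℝ} (hb0 : 0 < b) (hb : b ≤ B.card) :
    ((Measure.pi fun _ : Fin t => uniformOn (Set.univ : Set (Fin p))).prod
      (Measure.pi fun _ : Fin t => uniformLaw))
      {ω | F (∑ l, ω.2 l • a (ω.1 l)) ≤ L * ‖T (∑ l, ω.2 l • a (ω.1 l))‖} ≤
      ENNReal.ofReal (Real.exp (-(b * t / p)) + 1 / n) := by
  have hn' : (10 : ℝ) ≤ n := by exact_mod_cast hn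
  have hn0 : (0 : ℝ) < n := by linarith
  have hsn : 1 ≤ √(n : ℝ) := Real.one_le_sqrt.2 (by linarith)
  have hsn2 : √(n : ℝ) * √n = n := Real.mul_self_sqrt hn0.le
  have hp : (0 : ℝ) < p := by exact_mod_cast Nat.pos_of_neZero p
  have ht' : (0 : ℝ) < t := by exact_mod_cast ht
  have hD0 : 0 < D := lt_of_lt_of_le (by positivity) hD
  have hset : MeasurableSet {ω : (Fin t → Fin p) × (Fin t → ℝ) |
      F (∑ l, ω.2 l • a (ω.1 l)) ≤ L * ‖T (∑ l, ω.2 l • a (ω.1 l))‖} := by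
    have hw : Measurable fun ω : (Fin t → Fin p) × (Fin t → ℝ) => ∑ l, ω.2 l • a (ω.1 l) := by
      refine measurable_from_prod_countable_right fun R => ?_
      change Measurable fun z : Fin t → ℝ => ∑ l, z l • a (R l)
      fun_prop
    exact measurableSet_le (hF.measurable.comp hw) (by fun_prop)
  -- Up to this many terms, `‖T w‖`, of order `√t`, is within the range of a single coefficient.
  by_cases hcase : (t : ℝ) ≤ 100 * n ^ 3
  · rw [ENNReal.ofReal_add (Real.exp_pos _).le (by positivity)]
    refine prod_le_of_forall_mem _ _ hset (Γ := {R | ∃ l, R l ∈ B}) (Set.toFinite _).measurableSet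
      ?_ ?_
    · have e : {R : Fin t → Fin p | ∃ l, R l ∈ B}ᶜ = {R | ∀ l, R l ∉ B} := by
        ext R; simp
      rw [e]
      exact pi_uniformOn_forall_notMem_le hb
    · rintro R ⟨l, hl⟩
      refine (pi_uniformLaw_seminorm_le_of_one (v := fun l => a (R l)) hF (fun l => ha _) hL hD0
        (hB _ hl)).trans (ENNReal.ofReal_le_ofReal ?_)
      have h1 : √(t : ℝ) ≤ 10 * (n * √n) := by
        rw [Real.sqrt_le_left (by positivity)]
        calc (t : ℝ) ≤ 100 * n ^ 3 := hcase
          _ = 100 * n ^ 2 * (√n * √n) := by rw [hsn2]; ring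
          _ = _ := by ring
      rw [div_le_div_iff₀ hD0 hn0]
      have h2 : (1 : ℝ) ≤ n * √n := by nlinarith
      calc (1 + √t) * n ≤ (n * √n + 10 * (n * √n)) * n := by gcongr
        _ ≤ 100 * (n ^ 2 * √n) := by nlinarith [Real.sqrt_nonneg (n : ℝ)]
        _ ≤ _ := by linarith
  · push Not at hcase
    have hBne : B.Nonempty := by
      rw [← Finset.card_pos]
      have : (0 : ℝ) < B.card := lt_of_lt_of_le hb0 hb
      exact_mod_cast this
    -- a single index of `B` suffices, as it is drawn at least `t / (4 p)` times
    obtain ⟨i₀, hi₀⟩ := hBne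
    have hpn' : (p : ℝ) ≤ n := by exact_mod_cast hpn
    have h0 : ENNReal.ofReal (1 / (2 * n)) + ENNReal.ofReal (1 / (2 * n)) ≤
        ENNReal.ofReal (Real.exp (-(b * t / p)) + 1 / n) := by
      rw [← ENNReal.ofReal_add (by positivity) (by positivity)]
      apply ENNReal.ofReal_le_ofReal
      have := Real.exp_pos (-(b * t / p))
      have e : (1 / (2 * n) + 1 / (2 * n) : ℝ) = 1 / n := by field_simp; norm_num
      linarith
    refine le_trans (prod_le_of_forall_mem _ _ hset
      (Γ := {R | t / (4 * p) < ((Finset.univ.filter fun l => R l = i₀).card : ℝ)})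
      (Set.toFinite _).measurableSet ?_ ?_) h0
    · have e : {R : Fin t → Fin p | t / (4 * p) <
          ((Finset.univ.filter fun l => R l = i₀).card : ℝ)}ᶜ =
          {R | ((Finset.univ.filter fun l => R l = i₀).card : ℝ) ≤ t / (4 * p)} := by
        ext R; simp
      rw [e]
      refine (pi_uniformOn_card_le i₀).trans (ENNReal.ofReal_le_ofReal ?_)
      have h1 : 2 * (n : ℝ) ≤ t / (4 * p) := by
        rw [le_div_iff₀ (by positivity)]
        calc 2 * (n : ℝ) * (4 * p) ≤ 2 * n * (4 * n) := by gcongr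
          _ ≤ 100 * n ^ 3 := by nlinarith [pow_pos hn0 2]
          _ ≤ t := hcase.le
      rw [Real.exp_neg, ← one_div]
      have h2 := Real.add_one_le_exp (t / (4 * p) : ℝ)
      gcongr
      linarith
    · intro R hR
      simp only [Set.mem_ofPred_eq] at hR
      refine (pi_uniformLaw_seminorm_le_norm_of_many (v := fun l => a (R l))
        (I := Finset.univ.filter fun l => R l = i₀) hF (fun l => ha _) hL hD0
        (hB _ hi₀) (fun l hl => by rw [(Finset.mem_filter.1 hl).2]) (ρ := 8 * n) (by positivity)
        ht).trans (ENNReal.ofReal_le_ofReal ?_)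
      set N : ℝ := ((Finset.univ.filter fun l => R l = i₀).card : ℝ)
      have hst : 10 * ((n : ℝ) * √(n : ℝ)) ≤ √(t : ℝ) := by
        apply Real.le_sqrt_of_sq_le
        calc (10 * ((n : ℝ) * √(n : ℝ))) ^ 2 = 100 * (n : ℝ) ^ 2 * (√(n : ℝ) * √(n : ℝ)) := by
              ring
          _ = 100 * (n : ℝ) ^ 3 := by rw [hsn2]; ring
          _ ≤ (t : ℝ) := hcase.le
      have hst0 : 0 < √(t : ℝ) := lt_of_lt_of_le (by positivity) hst
      have hN : √(t : ℝ) / (2 * √n) ≤ √(N + 1) := by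
        apply Real.le_sqrt_of_sq_le
        rw [div_pow, mul_pow, Real.sq_sqrt ht'.le, Real.sq_sqrt hn0.le]
        have : (t : ℝ) / (4 * n) ≤ t / (4 * p) := by gcongr
        norm_num at this hR ⊢
        linarith
      have h8 : √(8 * n * t) ≤ 3 * (√n * √t) := by
        rw [Real.sqrt_le_left (by positivity)]
        calc 8 * (n : ℝ) * t ≤ 9 * (√n * √n) * (√t * √t) := by
              rw [hsn2, Real.mul_self_sqrt ht'.le]; nlinarith [mul_pos hn0 ht']
          _ = _ := by ring
      calc 1 / (8 * (n : ℝ)) + (2 * √(8 * n * t) / D + 1) / √(N + 1)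
          ≤ 1 / (8 * n) + (2 * (3 * (√n * √t)) / (100 * (n ^ 2 * √n)) + 1) / (√t / (2 * √n)) := by
            gcongr
        _ = 1 / (8 * n) + 12 / 100 * (√n * (1 / n) * (1 / n)) + 2 * √n / √t := by
            field_simp
            ring
        _ ≤ 1 / (8 * n) + 12 / 100 * (1 / n) + 2 * √n / (10 * (n * √n)) := by
            gcongr
            have : √(n : ℝ) ≤ n := by nlinarith
            calc √(n : ℝ) * (1 / n) * (1 / n) ≤ n * (1 / n) * (1 / n) := by gcongr
              _ = 1 / n := by field_simp
        _ ≤ 1 / (2 * n) := by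
            have e1 : 2 * √(n : ℝ) / (10 * (n * √n)) = 1 / 5 * (1 / n) := by field_simp; norm_num
            have e2 : 1 / (8 * (n : ℝ)) = 1 / 8 * (1 / n) := by field_simp
            have e3 : 1 / (2 * (n : ℝ)) = 1 / 2 * (1 / n) := by field_simp
            rw [e1, e2, e3]
            have : 0 < 1 / (n : ℝ) := by positivity
            linarith

end RandomRows

/-! ### Sparse Gaussian signals -/

section RandomSupports

/-- The probability that a random `k`-element set misses `d` given elements is at most
`(1 - d / n) ^ k`. -/
theorem choose_sub_mul_pow_le (n d k : ℕ) :
    (n - d).choose k * n ^ k ≤ n.choose k * (n - d) ^ k := by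
  induction k with
  | zero => simp
  | succ k ih =>
    refine le_of_mul_le_mul_left ?_ (Nat.succ_pos k : 0 < k + 1)
    have h1 : (n - d).choose (k + 1) * (k + 1) = (n - d).choose k * (n - d - k) :=
      Nat.choose_succ_right_eq _ _
    have h2 : n.choose (k + 1) * (k + 1) = n.choose k * (n - k) := Nat.choose_succ_right_eq _ _
    have h3 : (n - d - k) * n ≤ (n - k) * (n - d) := by
      rcases le_total (d + k) n with h | h
      · obtain ⟨q, rfl⟩ := Nat.exists_eq_add_of_le h
        have e1 : d + k + q - d - k = q := by omega
        have e2 : d + k + q - k = d + q := by omega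
        have e3 : d + k + q - d = k + q := by omega
        rw [e1, e2, e3]
        nlinarith [Nat.zero_le (d * k)]
      · have : n - d - k = 0 := by omega
        simp [this]
    calc (k + 1) * ((n - d).choose (k + 1) * n ^ (k + 1))
        = ((n - d).choose (k + 1) * (k + 1)) * n ^ (k + 1) := by ring
      _ = ((n - d).choose k * n ^ k) * ((n - d - k) * n) := by rw [h1]; ring
      _ ≤ (n.choose k * (n - d) ^ k) * ((n - k) * (n - d)) := Nat.mul_le_mul ih h3
      _ = (n.choose k * (n - k)) * (n - d) ^ (k + 1) := by ring
      _ = (k + 1) * (n.choose (k + 1) * (n - d) ^ (k + 1)) := by rw [← h2]; ring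

variable {n : ℕ}

/-- The sets of `min k n` coordinates, as supports of a random `k`-sparse signal. -/
abbrev supportSets (n k : ℕ) : Finset (Finset (Fin n)) :=
  (Finset.univ : Finset (Fin n)).powersetCard (min k n)

theorem card_supportSets_pos (n k : ℕ) : 0 < (supportSets n k).card := by
  rw [Finset.card_powersetCard, Finset.card_univ, Fintype.card_fin]
  exact Nat.choose_pos (min_le_right _ _)

/-- A random support misses `D` with probability at most `exp (-k |D| / n)`. -/
theorem card_filter_disjoint_le (hn : 0 < n) (k : ℕ) (D : Finset (Fin n)) :
    (((supportSets n k).filter fun K => Disjoint K D).card : ℝ) ≤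
      Real.exp (-(k * D.card / n)) * (supportSets n k).card := by
  have hn' : (0 : ℝ) < n := by exact_mod_cast hn
  have hd : D.card ≤ n := (Finset.card_le_univ D).trans_eq (Fintype.card_fin n)
  have e : (supportSets n k).filter (fun K => Disjoint K D) = Dᶜ.powersetCard (min k n) := by
    ext K
    simp only [Finset.mem_filter, Finset.mem_powersetCard, Finset.subset_univ, true_and]
    rw [← le_compl_iff_disjoint_right]
    exact and_comm
  rw [e, Finset.card_powersetCard, Finset.card_powersetCard, Finset.card_univ, Finset.card_compl,
    Fintype.card_fin]
  rcases le_total k n with h | h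
  · rw [min_eq_left h]
    have h1 : ((n - D.card).choose k : ℝ) * n ^ k ≤ n.choose k * (n - D.card : ℝ) ^ k := by
      have := choose_sub_mul_pow_le n D.card k
      rw [← Nat.cast_sub hd]
      exact_mod_cast this
    have h2 : ((n - D.card : ℝ) / n) ^ k ≤ Real.exp (-(k * D.card / n)) := by
      have e1 : ((n : ℝ) - D.card) / n = -(D.card / n) + 1 := by field_simp; ring
      have h0 : (0 : ℝ) ≤ (n - D.card) / n := by
        apply div_nonneg _ hn'.le
        have : (D.card : ℝ) ≤ n := by exact_mod_cast hd
        linarith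
      calc ((n - D.card : ℝ) / n) ^ k ≤ Real.exp (-(D.card / n)) ^ k := by
            apply pow_le_pow_left₀ h0
            rw [e1]; exact Real.add_one_le_exp _
        _ = _ := by rw [← Real.exp_nat_mul]; congr 1; ring
    calc ((n - D.card).choose k : ℝ) ≤ n.choose k * ((n - D.card : ℝ) / n) ^ k := by
          rw [div_pow, ← mul_div_assoc, le_div_iff₀ (by positivity)]
          exact h1
      _ ≤ _ := by rw [mul_comm]; gcongr
  · rw [min_eq_right h]
    rcases Nat.eq_zero_or_pos D.card with h0 | h0
    · simp [h0]
    · rw [Nat.choose_eq_zero_of_lt (by omega)]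
      simp only [Nat.cast_zero]; positivity

/-- The vector `g` with the entries outside `K` set to zero. -/
noncomputable def restrictTo (K : Finset (Fin n)) (g : Fin n → ℝ) : EuclideanSpace ℝ (Fin n) :=
  WithLp.toLp 2 fun i => if i ∈ K then g i else 0

theorem measurable_restrictTo (K : Finset (Fin n)) : Measurable (restrictTo K) := by
  unfold restrictTo
  refine (WithLp.measurable_toLp 2 _).comp ?_
  refine measurable_pi_lambda _ fun i => ?_
  split_ifs <;> fun_prop

theorem restrictTo_update_sub {K : Finset (Fin n)} {i : Fin n} (hi : i ∈ K) (g : Fin n → ℝ)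
    (x y : ℝ) : restrictTo K (Function.update g i x) - restrictTo K (Function.update g i y) =
      (x - y) • EuclideanSpace.single i (1 : ℝ) := by
  ext j
  by_cases hj : j = i
  · subst hj; simp [restrictTo, hi]
  · simp [restrictTo, hj]

/-- A bound on the probability of an event under the sparse Gaussian law, from a bound on the number
of supports in an exceptional family and a bound on the conditional probability for the others. -/
theorem sparseGaussianLaw_le {k : ℕ} {A : Set (EuclideanSpace ℝ (Fin n))} (hA : MeasurableSet A)
    (𝒢 : Finset (Finset (Fin n))) {q : ℝ} {e : ℝ≥0∞}
    (hq : ((𝒢 ∩ supportSets n k).card : ℝ) ≤ q * (supportSets n k).card)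
    (he : ∀ K ∈ supportSets n k, K ∉ 𝒢 →
      (Measure.pi fun _ : Fin n => gaussianReal 0 1) {g | restrictTo K g ∈ A} ≤ e) :
    sparseGaussianLaw n k A ≤ ENNReal.ofReal q + e := by
  have hc := card_supportSets_pos n k
  have hc0 : ((supportSets n k).card : ℝ≥0∞) ≠ 0 := by exact_mod_cast hc.ne'
  have hct : ((supportSets n k).card : ℝ≥0∞) ≠ ⊤ := ENNReal.natCast_ne_top _
  have h1 : ∀ K ∈ supportSets n k,
      ((Measure.pi fun _ : Fin n => gaussianReal 0 1).map (restrictTo K)) A ≤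
        (if K ∈ 𝒢 then 1 else 0) + e := by
    intro K hK
    rw [Measure.map_apply (measurable_restrictTo K) hA]
    split_ifs with h
    · exact prob_le_one.trans le_self_add
    · exact (he K hK h).trans le_add_self
  have h2 : sparseGaussianLaw n k A = ((supportSets n k).card : ℝ≥0∞)⁻¹ *
      ∑ K ∈ supportSets n k,
        ((Measure.pi fun _ : Fin n => gaussianReal 0 1).map (restrictTo K)) A := by
    rw [sparseGaussianLaw, Measure.smul_apply, Measure.coe_finsetSum, Finset.sum_apply]
    rfl
  rw [h2]
  have h3 : ((supportSets n k).filter (· ∈ 𝒢)).card = (𝒢 ∩ supportSets n k).card := by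
    congr 1; ext; simp [and_comm]
  have h4 : ((𝒢 ∩ supportSets n k).card : ℝ≥0∞) ≤
      ENNReal.ofReal q * (supportSets n k).card := by
    rw [← ENNReal.ofReal_natCast, ← ENNReal.ofReal_natCast (supportSets n k).card,
      ← ENNReal.ofReal_mul']
    · exact ENNReal.ofReal_le_ofReal hq
    · positivity
  calc _ ≤ ((supportSets n k).card : ℝ≥0∞)⁻¹ *
        ∑ K ∈ supportSets n k, ((if K ∈ 𝒢 then 1 else 0) + e) :=
        mul_le_mul' le_rfl (Finset.sum_le_sum h1)
    _ = ((supportSets n k).card : ℝ≥0∞)⁻¹ *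
        ((𝒢 ∩ supportSets n k).card + (supportSets n k).card * e) := by
        rw [Finset.sum_add_distrib, Finset.sum_boole, h3, Finset.sum_const, nsmul_eq_mul]
    _ ≤ ((supportSets n k).card : ℝ≥0∞)⁻¹ *
        (ENNReal.ofReal q * (supportSets n k).card + (supportSets n k).card * e) :=
        mul_le_mul' le_rfl (add_le_add h4 le_rfl)
    _ = (((supportSets n k).card : ℝ≥0∞)⁻¹ * (supportSets n k).card) * (ENNReal.ofReal q + e) := by
        ring
    _ = _ := by rw [ENNReal.inv_mul_cancel hc0 hct, one_mul]

instance : IsProbabilityMeasure (sparseGaussianLaw n k) := by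
  have hc := card_supportSets_pos n k
  constructor
  rw [sparseGaussianLaw, Measure.smul_apply, Measure.coe_finsetSum, Finset.sum_apply]
  have : ∀ K ∈ supportSets n k,
      ((Measure.pi fun _ : Fin n => gaussianReal 0 1).map (restrictTo K)) Set.univ = 1 := by
    intro K _
    rw [Measure.map_apply (measurable_restrictTo K) MeasurableSet.univ, Set.preimage_univ,
      measure_univ]
  refine (congrArg _ (Finset.sum_congr rfl this)).trans ?_
  rw [Finset.sum_const, nsmul_eq_mul, mul_one, smul_eq_mul]
  exact ENNReal.inv_mul_cancel (by exact_mod_cast hc.ne') (ENNReal.natCast_ne_top _)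

/-- Anticoncentration from the Gaussian entry at a basis vector where the seminorm is large. -/
theorem pi_gaussian_seminorm_lt_le {F : Seminorm ℝ (EuclideanSpace ℝ (Fin n))} (hF : Continuous F)
    {K : Finset (Fin n)} {i : Fin n} (hi : i ∈ K) {γ d : ℝ}
    (h : 2 * γ ≤ d * F (EuclideanSpace.single i 1)) (h0 : 0 < F (EuclideanSpace.single i 1)) :
    (Measure.pi fun _ : Fin n => gaussianReal 0 1) {g | F (restrictTo K g) < γ} ≤
      ENNReal.ofReal (d / 2) := by
  refine measure_pi_le_of_slices _ i ?_ _ fun g => ?_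
  · exact measurableSet_lt (hF.measurable.comp (measurable_restrictTo K)) measurable_const
  · refine gaussianReal_le_of_forall_abs_sub_le fun x hx y hy => ?_
    simp only [Set.mem_ofPred_eq] at hx hy
    have h1 : F (restrictTo K (Function.update g i x) - restrictTo K (Function.update g i y)) ≤
        γ + γ := (map_sub_le_add F _ _).trans (add_le_add hx.le hy.le)
    rw [restrictTo_update_sub hi, map_smul_eq_mul, Real.norm_eq_abs] at h1
    exact le_of_mul_le_mul_right (by linarith) h0

theorem pi_gaussian_inner_eq_zero {K : Finset (Fin n)} {v : EuclideanSpace ℝ (Fin n)}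
    (h : ¬ Disjoint K (supp v)) :
    (Measure.pi fun _ : Fin n => gaussianReal 0 1) {g | inner ℝ v (restrictTo K g) = 0} = 0 := by
  obtain ⟨i, hi, hiv⟩ := Finset.not_disjoint_iff.1 h
  rw [supp, Finset.mem_filter] at hiv
  refine le_antisymm ?_ zero_le
  refine (measure_pi_le_of_slices _ i (q := ENNReal.ofReal (0 / 2)) ?_ fun g => ?_).trans (by simp)
  · exact measurableSet_eq_fun ((measurable_const.inner measurable_id).comp
      (measurable_restrictTo K)) measurable_const
  · refine gaussianReal_le_of_forall_abs_sub_le fun x hx y hy => ?_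
    simp only [Set.mem_ofPred_eq] at hx hy
    have h1 : inner ℝ v (restrictTo K (Function.update g i x) -
        restrictTo K (Function.update g i y)) = 0 := by rw [inner_sub_right, hx, hy, sub_zero]
    rw [restrictTo_update_sub hi, inner_smul_right, EuclideanSpace.inner_single_right] at h1
    have : x - y = 0 := by simpa [hiv.2] using h1
    simp [this]

theorem lintegral_sq_gaussianReal : ∫⁻ x, ENNReal.ofReal (x ^ 2) ∂(gaussianReal 0 1) = 1 := by
  have h2 : Integrable (fun x : ℝ => x ^ 2) (gaussianReal 0 1) :=
    (memLp_id_gaussianReal (μ := 0) (v := 1) 2).integrable_sq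
  rw [← ofReal_integral_eq_lintegral_ofReal h2 (ae_of_all _ fun x => sq_nonneg x)]
  have h := variance_fun_id_gaussianReal (μ := 0) (v := 1)
  rw [variance_of_integral_eq_zero (by fun_prop) (by simp)] at h
  rw [h]; simp

theorem pi_gaussian_norm_sq_gt_le (hn : 0 < n) {k : ℕ} (hk : 0 < k) {K : Finset (Fin n)}
    (hK : K.card ≤ k) :
    (Measure.pi fun _ : Fin n => gaussianReal 0 1) {g | 2 * n * k < ‖restrictTo K g‖ ^ 2} ≤
      ENNReal.ofReal (1 / (2 * n)) := by
  have hn' : (0 : ℝ) < n := by exact_mod_cast hn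
  have hk' : (0 : ℝ) < k := by exact_mod_cast hk
  have h1 : ∀ g : Fin n → ℝ, ENNReal.ofReal (‖restrictTo K g‖ ^ 2) =
      ∑ i ∈ K, ENNReal.ofReal (g i ^ 2) := by
    intro g
    rw [← ENNReal.ofReal_sum_of_nonneg fun i _ => sq_nonneg _, EuclideanSpace.real_norm_sq_eq]
    congr 1
    calc ∑ i, restrictTo K g i ^ 2 = ∑ i, if i ∈ K then g i ^ 2 else 0 := by
          refine Finset.sum_congr rfl fun i _ => ?_
          by_cases hi : i ∈ K <;> simp [restrictTo, hi]
      _ = _ := by rw [Finset.sum_ite_mem, Finset.univ_inter]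
  have h2 : ∫⁻ g, ENNReal.ofReal (‖restrictTo K g‖ ^ 2)
      ∂(Measure.pi fun _ : Fin n => gaussianReal 0 1) ≤ k := by
    simp_rw [h1]
    rw [lintegral_finsetSum _ fun i _ => by fun_prop]
    have : ∀ i ∈ K, ∫⁻ g : Fin n → ℝ, ENNReal.ofReal (g i ^ 2)
        ∂(Measure.pi fun _ : Fin n => gaussianReal 0 1) = 1 := by
      intro i _
      rw [← lintegral_sq_gaussianReal,
        ← (measurePreserving_eval (fun _ : Fin n => gaussianReal 0 1) i).lintegral_comp
          (f := fun x => ENNReal.ofReal (x ^ 2)) (by fun_prop)]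
    rw [Finset.sum_congr rfl this]
    simpa using hK
  have h3 := mul_meas_ge_le_lintegral₀ (μ := Measure.pi fun _ : Fin n => gaussianReal 0 1)
    (f := fun g => ENNReal.ofReal (‖restrictTo K g‖ ^ 2))
    ((measurable_restrictTo K).norm.pow_const 2).ennreal_ofReal.aemeasurable
    (ENNReal.ofReal (2 * n * k))
  have h4 : {g : Fin n → ℝ | 2 * n * k < ‖restrictTo K g‖ ^ 2} ⊆
      {g | ENNReal.ofReal (2 * n * k) ≤ ENNReal.ofReal (‖restrictTo K g‖ ^ 2)} :=
    fun g hg => ENNReal.ofReal_le_ofReal (le_of_lt hg)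
  refine (measure_mono h4).trans ?_
  have h5 := h3.trans h2
  have h6 : ENNReal.ofReal (1 / (2 * n)) = k / ENNReal.ofReal (2 * n * k) := by
    rw [← ENNReal.ofReal_natCast, ← ENNReal.ofReal_div_of_pos (by positivity)]
    congr 1; field_simp
  rw [h6, ENNReal.le_div_iff_mul_le (Or.inl (ENNReal.ofReal_pos.2 (by positivity)).ne')
    (Or.inl ENNReal.ofReal_ne_top), mul_comm]
  exact h5

/-- A sparse Gaussian signal is typically not orthogonal to a vector with large support, and neither
too small in a seminorm that is large at many basis vectors, nor too large in norm. -/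
theorem sparseGaussianLaw_atypical_le (hn : 0 < n) {k : ℕ} (hk : 0 < k)
    {F : Seminorm ℝ (EuclideanSpace ℝ (Fin n))} (hF : Continuous F) {γ : ℝ} (hγ : 0 < γ)
    (Γ : Finset (Fin n)) (hΓ : ∀ i ∈ Γ, 2 * n * γ ≤ F (EuclideanSpace.single i 1))
    {ι : Type*} (J : Finset ι) (v : ι → EuclideanSpace ℝ (Fin n)) {τ : ℝ}
    (hJ : ∀ j ∈ J, τ ≤ (supp (v j)).card) :
    sparseGaussianLaw n k {w | (∃ j ∈ J, inner ℝ (v j) w = 0) ∨ F w < γ ∨ 2 * n * k < ‖w‖ ^ 2} ≤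
      ENNReal.ofReal (Real.exp (-(k * Γ.card / n)) +
        J.card * Real.exp (-(k * τ / n)) + 1 / n) := by
  classical
  have hn' : (0 : ℝ) < n := by exact_mod_cast hn
  have hmeas : MeasurableSet {w : EuclideanSpace ℝ (Fin n) | (∃ j ∈ J, inner ℝ (v j) w = 0) ∨
      F w < γ ∨ 2 * n * k < ‖w‖ ^ 2} := by
    have e : {w : EuclideanSpace ℝ (Fin n) | (∃ j ∈ J, inner ℝ (v j) w = 0) ∨
        F w < γ ∨ 2 * n * k < ‖w‖ ^ 2} =
        (⋃ j ∈ J, {w | inner ℝ (v j) w = 0}) ∪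
          ({w | F w < γ} ∪ {w | 2 * n * k < ‖w‖ ^ 2}) := by
      ext w; simp
    rw [e]
    refine MeasurableSet.union (Finset.measurableSet_biUnion _ fun j _ => ?_)
      (MeasurableSet.union ?_ ?_)
    · exact (isClosed_eq (by fun_prop) continuous_const).measurableSet
    · exact (isOpen_lt hF continuous_const).measurableSet
    · exact (isOpen_lt continuous_const (by fun_prop)).measurableSet
  let 𝒢 : Finset (Finset (Fin n)) :=
    (supportSets n k).filter (fun K => Disjoint K Γ) ∪
      J.biUnion fun j => (supportSets n k).filter fun K => Disjoint K (supp (v j))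
  have hN : (0 : ℝ) ≤ (supportSets n k).card := by positivity
  have hq : ((𝒢 ∩ supportSets n k).card : ℝ) ≤ (Real.exp (-(k * Γ.card / n)) +
      J.card * Real.exp (-(k * τ / n))) * (supportSets n k).card := by
    have h2 : ((J.biUnion fun j =>
        (supportSets n k).filter fun K => Disjoint K (supp (v j))).card : ℝ) ≤
        J.card * Real.exp (-(k * τ / n)) * (supportSets n k).card := by
      calc _ ≤ ∑ j ∈ J, (((supportSets n k).filter
              fun K => Disjoint K (supp (v j))).card : ℝ) := by
            exact_mod_cast Finset.card_biUnion_le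
        _ ≤ ∑ j ∈ J, Real.exp (-(k * τ / n)) * ((supportSets n k).card : ℝ) := by
            refine Finset.sum_le_sum fun j hj => (card_filter_disjoint_le hn k _).trans ?_
            have := hJ j hj
            gcongr
        _ = _ := by rw [Finset.sum_const, nsmul_eq_mul]; ring
    have h3 := card_filter_disjoint_le hn k Γ
    calc ((𝒢 ∩ supportSets n k).card : ℝ) ≤ (𝒢.card : ℝ) := by
          exact_mod_cast Finset.card_le_card Finset.inter_subset_left
      _ ≤ (((supportSets n k).filter fun K => Disjoint K Γ).card : ℝ) +
          ((J.biUnion fun j =>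
            (supportSets n k).filter fun K => Disjoint K (supp (v j))).card : ℝ) := by
          exact_mod_cast Finset.card_union_le _ _
      _ ≤ _ := by linarith
  have he1 : (0 : ℝ) ≤ Real.exp (-(k * Γ.card / n)) +
      J.card * Real.exp (-(k * τ / n)) := by positivity
  rw [ENNReal.ofReal_add he1 (by positivity)]
  refine sparseGaussianLaw_le hmeas 𝒢 hq fun K hK hKG => ?_
  simp only [𝒢, Finset.mem_union, Finset.mem_biUnion, Finset.mem_filter, hK, true_and, not_or,
    not_exists, not_and] at hKG
  obtain ⟨hKΓ, hKJ⟩ := hKG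
  have hKk : K.card ≤ k := by
    rw [(Finset.mem_powersetCard.1 hK).2]; exact min_le_left _ _
  obtain ⟨i, hiK, hiΓ⟩ := Finset.not_disjoint_iff.1 hKΓ
  have hFi : 0 < F (EuclideanSpace.single i 1) := lt_of_lt_of_le (by positivity) (hΓ i hiΓ)
  have hsub : {g | restrictTo K g ∈ {w : EuclideanSpace ℝ (Fin n) | (∃ j ∈ J, inner ℝ (v j) w = 0) ∨
      F w < γ ∨ 2 * n * k < ‖w‖ ^ 2}} ⊆
      (⋃ j ∈ J, {g | inner ℝ (v j) (restrictTo K g) = 0}) ∪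
        ({g | F (restrictTo K g) < γ} ∪ {g | 2 * n * k < ‖restrictTo K g‖ ^ 2}) := by
    intro g hg
    simp only [Set.mem_ofPred_eq] at hg
    rcases hg with h | h | h
    · left; simpa using h
    · right; left; exact h
    · right; right; exact h
  refine (measure_mono hsub).trans ((measure_union_le _ _).trans ?_)
  have hnull : (Measure.pi fun _ : Fin n => gaussianReal 0 1)
      (⋃ j ∈ J, {g | inner ℝ (v j) (restrictTo K g) = 0}) = 0 :=
    (measure_biUnion_null_iff J.countable_toSet).2 fun j hj => pi_gaussian_inner_eq_zero (hKJ j hj)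
  rw [hnull, zero_add]
  refine (measure_union_le _ _).trans ?_
  have e : (1 / n : ℝ) = 1 / n / 2 + 1 / (2 * n) := by field_simp; norm_num
  rw [e, ENNReal.ofReal_add (by positivity) (by positivity)]
  refine add_le_add (pi_gaussian_seminorm_lt_le hF hiK ?_ hFi) (pi_gaussian_norm_sq_gt_le hn hk hKk)
  rw [div_mul_eq_mul_div, one_mul, le_div_iff₀ hn']
  linarith [hΓ i hiΓ]

end RandomSupports

/-! ### The objective and its size on `ker M` -/

section Objective

variable {n s : ℕ} (S : Matrix (Fin n) (Fin s) ℝ)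

/-- The `j`-th column of `S`, as a vector of Euclidean space. -/
noncomputable def column (j : Fin s) : EuclideanSpace ℝ (Fin n) := WithLp.toLp 2 fun i => S i j

theorem objective_eq_sum_abs_inner (w : EuclideanSpace ℝ (Fin n)) :
    objective S w = ∑ j, |inner ℝ (column S j) w| := by
  simp_rw [inner_eq_dotProduct]; rfl

/-- The objective `‖Sᵀ w‖₁` as a seminorm. -/
noncomputable def objectiveSeminorm : Seminorm ℝ (EuclideanSpace ℝ (Fin n)) :=
  Seminorm.of (objective S)
    (fun x y => by
      simp_rw [objective_eq_sum_abs_inner, ← Finset.sum_add_distrib, inner_add_right]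
      exact Finset.sum_le_sum fun j _ => abs_add_le _ _)
    (fun a x => by
      simp_rw [objective_eq_sum_abs_inner, inner_smul_right, abs_mul, Real.norm_eq_abs,
        Finset.mul_sum])

theorem objectiveSeminorm_apply (w : EuclideanSpace ℝ (Fin n)) :
    objectiveSeminorm S w = objective S w := rfl

theorem continuous_objectiveSeminorm : Continuous (objectiveSeminorm S) := by
  have : ⇑(objectiveSeminorm S) = fun w => ∑ j, |inner ℝ (column S j) w| := by
    ext w; rw [objectiveSeminorm_apply, objective_eq_sum_abs_inner]
  rw [this]
  fun_prop

variable {S}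

theorem eq_zero_of_objective_eq_zero (hS : IsPreconditioner S) {w : EuclideanSpace ℝ (Fin n)}
    (h : objectiveSeminorm S w = 0) : w = 0 := by
  rw [objectiveSeminorm_apply, objective, Finset.sum_eq_zero_iff_of_nonneg fun _ _ => abs_nonneg _]
    at h
  refine WithLp.ofLp_injective 2 (hS _ ?_)
  ext j
  exact abs_eq_zero.1 (h j (Finset.mem_univ _))

end Objective

section Width

variable {n : ℕ} {F : Seminorm ℝ (EuclideanSpace ℝ (Fin n))}

theorem exists_mul_norm_le (hF : Continuous F) (h0 : ∀ x, F x = 0 → x = 0) :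
    ∃ c > 0, ∀ x, c * ‖x‖ ≤ F x := by
  rcases subsingleton_or_nontrivial (EuclideanSpace ℝ (Fin n)) with hE | hE
  · exact ⟨1, one_pos, fun x => by simp [Subsingleton.elim x 0]⟩
  · obtain ⟨x₀, hx₀, hmin⟩ := (isCompact_sphere (0 : EuclideanSpace ℝ (Fin n)) 1).exists_isMinOn
      (NormedSpace.sphere_nonempty.2 zero_le_one) hF.continuousOn
    have hx1 : ‖x₀‖ = 1 := by simpa using hx₀
    refine ⟨F x₀, (apply_nonneg F x₀).lt_of_ne' fun h => ?_, fun x => ?_⟩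
    · rw [h0 _ h] at hx1; simp at hx1
    · rcases eq_or_ne x 0 with rfl | hx
      · simp
      have hx' : 0 < ‖x‖ := norm_pos_iff.2 hx
      have h1 : F x₀ ≤ F (‖x‖⁻¹ • x) := hmin (by
        simp [norm_smul, inv_mul_cancel₀ hx'.ne'])
      rw [map_smul_eq_mul, norm_inv, norm_norm, inv_mul_eq_div, le_div_iff₀ hx'] at h1
      exact h1

/-- Up to a factor `2`, the best constant `K` for which `F ≤ K ‖·‖` holds on a `d`-dimensional
subspace of `V`. -/
theorem exists_width (hF : Continuous F) (h0 : ∀ x, F x = 0 → x = 0)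
    (V : Submodule ℝ (EuclideanSpace ℝ (Fin n))) {d : ℕ} (hd : 0 < d)
    (hdV : d ≤ Module.finrank ℝ V) :
    ∃ K > 0, (∃ U ≤ V, d ≤ Module.finrank ℝ U ∧ ∀ u ∈ U, F u ≤ 2 * K * ‖u‖) ∧
      ∀ U ≤ V, d ≤ Module.finrank ℝ U → ∃ u ∈ U, K * ‖u‖ < F u := by
  obtain ⟨c, hc, hcF⟩ := exists_mul_norm_le hF h0
  obtain ⟨C, -, hCF⟩ := Seminorm.bound_of_continuous_normedSpace F hF
  set T : Set ℝ := {a | ∃ U ≤ V, d ≤ Module.finrank ℝ U ∧ ∀ u ∈ U, F u ≤ a * ‖u‖}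
  have hT : T.Nonempty := ⟨C, V, le_rfl, hdV, fun u _ => hCF u⟩
  have hTc : ∀ a ∈ T, c ≤ a := by
    rintro a ⟨U, -, hU, hUF⟩
    have : Nontrivial U := Module.nontrivial_of_finrank_pos (R := ℝ) (hd.trans_le hU)
    obtain ⟨⟨u, hu⟩, hu0⟩ := exists_ne (0 : U)
    have hu' : 0 < ‖u‖ := norm_pos_iff.2 fun h => hu0 (Subtype.ext h)
    exact le_of_mul_le_mul_right ((hcF u).trans (hUF u hu)) hu'
  have hinf : c ≤ sInf T := le_csInf hT hTc
  have hpos : 0 < sInf T := hc.trans_le hinf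
  -- `K < inf T < 2 K`
  refine ⟨3 / 4 * sInf T, by positivity, ?_, ?_⟩
  · obtain ⟨a, ⟨U, hUV, hU, hUF⟩, ha⟩ :=
      exists_lt_of_csInf_lt hT (by linarith : sInf T < 2 * (3 / 4 * sInf T))
    exact ⟨U, hUV, hU, fun u hu => (hUF u hu).trans (by gcongr)⟩
  · intro U hUV hU
    by_contra! h
    have : sInf T ≤ 3 / 4 * sInf T := csInf_le ⟨c, hTc⟩ ⟨U, hUV, hU, h⟩
    linarith

theorem seminorm_le_sum (F : Seminorm ℝ (EuclideanSpace ℝ (Fin n)))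
    (u : EuclideanSpace ℝ (Fin n)) :
    F u ≤ ∑ i, |u i| * F (EuclideanSpace.single i 1) := by
  have h : u = ∑ i, u i • EuclideanSpace.single i (1 : ℝ) := by
    ext j; simp [Pi.single_apply]
  conv_lhs => rw [h]
  refine (Finset.le_sum_of_subadditive F (map_zero F).le (map_add_le_add F) _ _).trans (le_of_eq ?_)
  exact Finset.sum_congr rfl fun i _ => by rw [map_smul_eq_mul, Real.norm_eq_abs]

theorem sum_abs_le_sqrt_mul_norm (u : EuclideanSpace ℝ (Fin n)) :
    ∑ i, |u i| ≤ √n * ‖u‖ := by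
  rw [EuclideanSpace.norm_eq, ← Real.sqrt_mul (by positivity)]
  apply Real.le_sqrt_of_sq_le
  have := sq_sum_le_card_mul_sum_sq (s := Finset.univ) (f := fun i => |u i|)
  simpa using this

/-- A seminorm that is not small on any `d`-dimensional subspace of `V` is large at all but few
basis vectors. -/
theorem finrank_lt_card_large_add {K : ℝ} (hK : 0 < K) (hn : 0 < n)
    (V : Submodule ℝ (EuclideanSpace ℝ (Fin n))) {d : ℕ}
    (h : ∀ U ≤ V, d ≤ Module.finrank ℝ U → ∃ u ∈ U, K * ‖u‖ < F u) :
    Module.finrank ℝ V <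
      (Finset.univ.filter fun i => K / √n < F (EuclideanSpace.single i 1)).card + d := by
  set Γ := Finset.univ.filter fun i => K / √n < F (EuclideanSpace.single i 1) with hΓ
  by_contra! hcard
  let φ : V →ₗ[ℝ] (Γ → ℝ) :=
    { toFun := fun x i => (x : EuclideanSpace ℝ (Fin n)) i
      map_add' := fun _ _ => rfl
      map_smul' := fun _ _ => rfl }
  have h1 := LinearMap.finrank_range_add_finrank_ker φ
  have h2 := Submodule.finrank_le (LinearMap.range φ)
  rw [Module.finrank_fintype_fun_eq_card, Fintype.card_coe] at h2
  obtain ⟨u, hu, hFu⟩ := h ((LinearMap.ker φ).map V.subtype)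
    (Submodule.map_subtype_le _ _) (by rw [Submodule.finrank_map_subtype_eq]; omega)
  obtain ⟨v, hv, rfl⟩ := hu
  have hn' : 0 < √(n : ℝ) := Real.sqrt_pos.2 (by exact_mod_cast hn)
  have h3 : F (v : EuclideanSpace ℝ (Fin n)) ≤ K * ‖(v : EuclideanSpace ℝ (Fin n))‖ := by
    calc _ ≤ ∑ i, |(v : EuclideanSpace ℝ (Fin n)) i| * F (EuclideanSpace.single i 1) :=
          seminorm_le_sum F _
      _ ≤ ∑ i, |(v : EuclideanSpace ℝ (Fin n)) i| * (K / √n) := by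
          refine Finset.sum_le_sum fun i _ => ?_
          by_cases hi : i ∈ Γ
          · have : (v : EuclideanSpace ℝ (Fin n)) i = 0 := congrFun (LinearMap.mem_ker.1 hv) ⟨i, hi⟩
            simp [this]
          · have : F (EuclideanSpace.single i 1) ≤ K / √n := by
              simpa [hΓ] using hi
            gcongr
      _ ≤ (√n * ‖(v : EuclideanSpace ℝ (Fin n))‖) * (K / √n) := by
          rw [← Finset.sum_mul]
          gcongr
          exact sum_abs_le_sqrt_mul_norm _
      _ = _ := by field_simp
  exact absurd hFu (not_lt.2 h3)

end Width

/-! ### Optimality certificates -/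

section Duality

open Filter Topology

/-- The one-sided derivative of the absolute value in the direction `b`. -/
theorem eventually_abs_add_smul (a b : ℝ) :
    ∀ᶠ s in 𝓝[>] (0 : ℝ), |a + s * b| = |a| + s * (if a = 0 then |b| else SignType.sign a * b) := by
  have hc : Tendsto (fun s : ℝ => a + s * b) (𝓝[>] 0) (𝓝 a) := by
    have : Tendsto (fun s : ℝ => a + s * b) (𝓝 0) (𝓝 (a + 0 * b)) :=
      (Continuous.tendsto (by fun_prop) 0)
    rw [zero_mul, add_zero] at this
    exact this.mono_left nhdsWithin_le_nhds
  rcases lt_trichotomy a 0 with ha | ha | ha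
  · filter_upwards [hc.eventually_lt_const ha] with s hs
    rw [abs_of_neg hs, abs_of_neg ha, if_neg ha.ne, sign_neg ha]
    simp; ring
  · subst ha
    filter_upwards [self_mem_nhdsWithin] with s hs
    have hs' : (0 : ℝ) < s := hs
    simp [abs_mul, abs_of_pos hs']
  · filter_upwards [hc.eventually_const_lt ha] with s hs
    rw [abs_of_pos hs, abs_of_pos ha, if_neg ha.ne', sign_pos ha]
    simp

variable {n s m : ℕ} (S : Matrix (Fin n) (Fin s) ℝ)

/-- The gradient at `w` of the terms of the objective that do not vanish at `w`. -/
noncomputable def signCombination (w : EuclideanSpace ℝ (Fin n)) : EuclideanSpace ℝ (Fin n) :=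
  ∑ j, (SignType.sign (inner ℝ (column S j) w) : ℝ) • column S j

theorem inner_signCombination_self (w : EuclideanSpace ℝ (Fin n)) :
    inner ℝ (signCombination S w) w = objective S w := by
  rw [objective_eq_sum_abs_inner, signCombination, sum_inner]
  refine Finset.sum_congr rfl fun j _ => ?_
  rw [inner_smul_left]
  simp

/-- Optimality certificate: if the Lasso recovers `w`, some vector in the span of the samples is a
subgradient of the objective at `w`. -/
theorem exists_certificate {X : Fin m → EuclideanSpace ℝ (Fin n)} {w : EuclideanSpace ℝ (Fin n)}
    (h : ¬ LassoFails S X w) :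
    ∃ α : Fin m → ℝ,
      (inner ℝ (∑ l, α l • X l) w = objective S w) ∧
      ∀ v, inner ℝ (∑ l, α l • X l - signCombination S w) v ≤
        ∑ j ∈ Finset.univ.filter fun j => inner ℝ (column S j) w = 0, |inner ℝ (column S j) v| := by
  classical
  rw [LassoFails, not_not] at h
  set J := Finset.univ.filter fun j => inner ℝ (column S j) w = 0 with hJ
  -- the directional derivative of the objective at `w`
  set p : EuclideanSpace ℝ (Fin n) → ℝ := fun v =>
    inner ℝ (signCombination S w) v + ∑ j ∈ J, |inner ℝ (column S j) v| with hp
  have hp_sum : ∀ v, p v = ∑ j, if inner ℝ (column S j) w = 0 then |inner ℝ (column S j) v| else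
      SignType.sign (inner ℝ (column S j) w) * inner ℝ (column S j) v := by
    intro v
    simp only [hp, hJ, signCombination, sum_inner, inner_smul_left]
    rw [Finset.sum_filter, ← Finset.sum_add_distrib]
    refine Finset.sum_congr rfl fun j _ => ?_
    split_ifs with hj <;> simp [hj]
  have hdir : ∀ v, ∀ᶠ s in 𝓝[>] (0 : ℝ), objective S (w + s • v) = objective S w + s * p v := by
    intro v
    have : ∀ᶠ s in 𝓝[>] (0 : ℝ), ∀ j, |inner ℝ (column S j) w + s * inner ℝ (column S j) v| =
        |inner ℝ (column S j) w| + s * (if inner ℝ (column S j) w = 0 then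
          |inner ℝ (column S j) v| else
          SignType.sign (inner ℝ (column S j) w) * inner ℝ (column S j) v) :=
      eventually_all.2 fun j => eventually_abs_add_smul _ _
    filter_upwards [this] with s hs
    rw [objective_eq_sum_abs_inner, objective_eq_sum_abs_inner, hp_sum, Finset.mul_sum,
      ← Finset.sum_add_distrib]
    refine Finset.sum_congr rfl fun j _ => ?_
    rw [inner_add_right, inner_smul_right, hs j]
  set N : Submodule ℝ (EuclideanSpace ℝ (Fin n)) := (Submodule.span ℝ (Set.range X))ᗮ with hN
  have hN0 : ∀ v ∈ N, 0 ≤ p v := by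
    intro v hv
    have hXv : ∀ l, inner ℝ (X l) v = 0 := fun l =>
      (Submodule.mem_orthogonal _ _).1 hv _ (Submodule.subset_span ⟨l, rfl⟩)
    obtain ⟨s, hs, hs0⟩ := ((hdir v).and self_mem_nhdsWithin).exists
    have hs0 : 0 < s := hs0
    have h1 := h.2 (w + s • v) fun l => by
      rw [inner_add_right, inner_smul_right, hXv, mul_zero, add_zero]
    rw [hs] at h1
    by_contra! h2
    nlinarith
  -- Hahn–Banach: the zero functional on `N`, below the directional derivative `p` by optimality,
  -- extends below `p`
  obtain ⟨g, hg0, hgp⟩ := exists_extension_of_le_sublinear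
    (E := EuclideanSpace ℝ (Fin n)) ⟨N, 0⟩ p
    (fun c hc v => by
      simp only [hp, inner_smul_right, abs_mul, abs_of_pos hc, ← Finset.mul_sum]; ring)
    (fun x y => by
      have : ∑ j ∈ J, |inner ℝ (column S j) (x + y)| ≤
          ∑ j ∈ J, |inner ℝ (column S j) x| + ∑ j ∈ J, |inner ℝ (column S j) y| := by
        rw [← Finset.sum_add_distrib]
        exact Finset.sum_le_sum fun j _ => by rw [inner_add_right]; exact abs_add_le _ _
      simp only [hp, inner_add_right] at this ⊢
      linarith)
    (fun v => by simpa using hN0 v v.2)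
  set γ : EuclideanSpace ℝ (Fin n) :=
    (InnerProductSpace.toDual ℝ (EuclideanSpace ℝ (Fin n))).symm (LinearMap.toContinuousLinearMap g)
  have hγ : ∀ v, inner ℝ γ v = g v := fun v => by
    simp [γ]
  have hmem : γ ∈ Submodule.span ℝ (Set.range X) := by
    rw [← Submodule.orthogonal_orthogonal (Submodule.span ℝ (Set.range X)),
      Submodule.mem_orthogonal']
    intro v hv
    rw [hγ]
    exact hg0 ⟨v, hv⟩
  obtain ⟨α, hα⟩ := (Submodule.mem_span_range_iff_exists_fun ℝ).1 hmem
  have hsum0 : ∀ c : ℝ, ∑ j ∈ J, |inner ℝ (column S j) (c • w)| = 0 := fun c =>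
    Finset.sum_eq_zero fun j hj => by
      rw [inner_smul_right, (Finset.mem_filter.1 hj).2, mul_zero, abs_zero]
  refine ⟨α, ?_, fun v => ?_⟩
  -- `p w = F w` and `p (-w) = -F w` force `g w = F w`
  · rw [hα, hγ]
    have h1 := hgp ((1 : ℝ) • w)
    have h2 := hgp ((-1 : ℝ) • w)
    simp only [hp, hsum0] at h1 h2
    simp only [inner_smul_right, inner_signCombination_self, map_smul, smul_eq_mul] at h1 h2
    linarith
  · rw [hα, inner_sub_left, hγ]
    have := hgp v
    simp only [hp] at this
    linarith

end Duality

/-! ### Signals with large objective -/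

section LargeSignal

variable {n m s p : ℕ}

theorem exists_orthonormal_mem (U : Submodule ℝ (EuclideanSpace ℝ (Fin n))) {d : ℕ}
    (hd : d ≤ Module.finrank ℝ U) :
    ∃ f : Fin d → EuclideanSpace ℝ (Fin n), Orthonormal ℝ f ∧ ∀ i, f i ∈ U := by
  refine ⟨fun i => stdOrthonormalBasis ℝ U (Fin.castLE hd i), ?_, fun i => Subtype.mem _⟩
  exact ((stdOrthonormalBasis ℝ U).orthonormal.comp_linearIsometry U.subtypeₗᵢ).comp _
    (Fin.castLE_injective hd)

theorem norm_sq_sum_inner_smul {ι : Type*} [Fintype ι] {f : ι → EuclideanSpace ℝ (Fin n)}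
    (hf : Orthonormal ℝ f) (c : ι → ℝ) : ‖∑ i, c i • f i‖ ^ 2 = ∑ i, c i ^ 2 := by
  rw [← real_inner_self_eq_norm_sq, hf.inner_sum]
  simp [sq]

/-- If every combination of the samples has a large component in the span of an orthonormal system
`f`, then any responses are attained by a small vector in that span. -/
theorem exists_interpolant {d : ℕ} {X : Fin m → EuclideanSpace ℝ (Fin n)}
    {f : Fin d → EuclideanSpace ℝ (Fin n)} (hf : Orthonormal ℝ f) {R : ℝ}
    (hX : ∀ α : Fin m → ℝ, ‖α‖ ≤ R * √(∑ i, inner ℝ (f i) (∑ l, α l • X l) ^ 2)) (y : Fin m → ℝ) :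
    ∃ u ∈ Submodule.span ℝ (Set.range f), (∀ l, inner ℝ (X l) u = y l) ∧ ‖u‖ ≤ R * ∑ l, |y l| := by
  -- the Gram matrix of the samples projected to the span of `f`
  let T : (Fin m → ℝ) →ₗ[ℝ] (Fin m → ℝ) :=
    { toFun := fun α l => ∑ i, inner ℝ (f i) (∑ l, α l • X l) * inner ℝ (f i) (X l)
      map_add' := fun α β => by
        ext l
        simp only [Pi.add_apply, add_smul, Finset.sum_add_distrib, inner_add_right, add_mul]
      map_smul' := fun c α => by
        ext l
        simp only [Pi.smul_apply, smul_eq_mul, mul_smul, ← Finset.smul_sum, inner_smul_right,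
          Finset.mul_sum, RingHom.id_apply, mul_assoc] }
  have hT : ∀ α l, T α l = ∑ i, inner ℝ (f i) (∑ l, α l • X l) * inner ℝ (f i) (X l) :=
    fun _ _ => rfl
  have hTα : ∀ α, ∑ l, α l * T α l = ∑ i, inner ℝ (f i) (∑ l, α l • X l) ^ 2 := by
    intro α
    simp_rw [hT, Finset.mul_sum]
    rw [Finset.sum_comm]
    refine Finset.sum_congr rfl fun i _ => ?_
    have e : inner ℝ (f i) (∑ l, α l • X l) = ∑ l, α l * inner ℝ (f i) (X l) := by
      simp_rw [inner_sum, inner_smul_right]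
    calc ∑ l, α l * (inner ℝ (f i) (∑ l, α l • X l) * inner ℝ (f i) (X l))
        = inner ℝ (f i) (∑ l, α l • X l) * ∑ l, α l * inner ℝ (f i) (X l) := by
          rw [Finset.mul_sum]
          exact Finset.sum_congr rfl fun l _ => by ring
      _ = _ := by rw [← e, sq]
  have hinj : Function.Injective T := by
    rw [← LinearMap.ker_eq_bot, LinearMap.ker_eq_bot']
    intro α hα
    have h1 := hX α
    rw [← hTα, hα] at h1
    simpa using h1
  obtain ⟨α, hα⟩ := LinearMap.injective_iff_surjective.1 hinj y
  set c : Fin d → ℝ := fun i => inner ℝ (f i) (∑ l, α l • X l) with hc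
  refine ⟨∑ i, c i • f i, ?_, fun l => ?_, ?_⟩
  · exact Submodule.sum_mem _ fun i _ =>
      Submodule.smul_mem _ _ (Submodule.subset_span ⟨i, rfl⟩)
  · rw [← hα, hT, inner_sum]
    exact Finset.sum_congr rfl fun i _ => by rw [inner_smul_right, real_inner_comm]
  · have h1 : ‖∑ i, c i • f i‖ ^ 2 = ∑ l, α l * y l := by
      rw [norm_sq_sum_inner_smul hf, ← hTα, hα]
    have h2 : ‖α‖ ≤ R * ‖∑ i, c i • f i‖ := by
      refine (hX α).trans_eq ?_
      rw [← Real.sqrt_sq (norm_nonneg (∑ i, c i • f i)), norm_sq_sum_inner_smul hf]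
    have h3 : ∑ l, α l * y l ≤ ‖α‖ * ∑ l, |y l| := by
      rw [Finset.mul_sum]
      refine Finset.sum_le_sum fun l _ => (le_abs_self _).trans ?_
      rw [abs_mul]
      gcongr
      exact norm_le_pi_norm α l
    have hy : 0 ≤ ∑ l, |y l| := Finset.sum_nonneg fun _ _ => abs_nonneg _
    rcases (norm_nonneg (∑ i, c i • f i)).eq_or_lt' with h0 | h0
    · have hα0 : ‖α‖ = 0 := le_antisymm (by simpa [h0] using h2) (norm_nonneg _)
      have hα0 : α = 0 := norm_eq_zero.1 hα0
      have : y = 0 := by rw [← hα, hα0, map_zero]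
      rw [h0, this]; simp
    · refine le_of_mul_le_mul_right ?_ h0
      calc ‖∑ i, c i • f i‖ * ‖∑ i, c i • f i‖ = ∑ l, α l * y l := by rw [← sq, h1]
        _ ≤ ‖α‖ * ∑ l, |y l| := h3
        _ ≤ (R * ‖∑ i, c i • f i‖) * ∑ l, |y l| := by gcongr
        _ = _ := by ring

theorem sum_abs_le_of_sum_sq_le {y : Fin m → ℝ} {v : ℝ} (h : ∑ l, y l ^ 2 ≤ v) :
    ∑ l, |y l| ≤ √m * √v := by
  rw [← Real.sqrt_mul (by positivity)]
  apply Real.le_sqrt_of_sq_le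
  have := sq_sum_le_card_mul_sum_sq (s := Finset.univ) (f := fun i => |y i|)
  simp only [sq_abs, Finset.card_univ, Fintype.card_fin] at this
  exact this.trans (by gcongr)

/-- Valid for the outer measure of a set `A` that need not be measurable. -/
theorem measure_compl_le_real {Ω : Type*} [MeasurableSpace Ω] {μ : Measure Ω}
    [IsProbabilityMeasure μ] {A : Set Ω} {q : ℝ} (hq : 0 ≤ q) (h : μ Aᶜ ≤ ENNReal.ofReal q) :
    1 - q ≤ μ.real A := by
  have h1 : (1 : ℝ≥0∞) ≤ μ A + μ Aᶜ := by
    rw [← measure_univ (μ := μ), ← Set.union_compl_self A]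
    exact measure_union_le _ _
  have h2 : (1 : ℝ≥0∞) ≤ ENNReal.ofReal (μ.real A + q) := by
    rw [ENNReal.ofReal_add measureReal_nonneg hq, ofReal_measureReal]
    exact h1.trans (by gcongr)
  rw [ENNReal.one_le_ofReal] at h2
  linarith

variable (M : Matrix (Fin p) (Fin n) ℝ) {ε K : ℝ} (S : Matrix (Fin n) (Fin s) ℝ)

/-- A signal whose objective is large compared with the standard deviation of its responses is not
recovered: the responses are attained by a vector in a subspace of `ker M` on which the objective is
small. -/
theorem sampleLaw_not_lassoFails_le_of_large (hε : 0 < ε) (hK : 0 < K) (hm : 0 < m)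
    {U : Submodule ℝ (EuclideanSpace ℝ (Fin n))} (hU : U ≤ kernel M)
    (hmU : 2 * m ≤ Module.finrank ℝ U) (hmn : 2 * m ≤ n)
    (hF : ∀ u ∈ U, objectiveSeminorm S u ≤ 2 * K * ‖u‖)
    {w : EuclideanSpace ℝ (Fin n)}
    (hw : 400 * (K * √ε * (n * √n)) * ‖covSqrt M ε w‖ < objectiveSeminorm S w) :
    sampleLaw (covMat M ε) m {X | ¬ LassoFails S X w} ≤
      ENNReal.ofReal ((2 * m + 2) * Real.exp (-m)) := by
  obtain ⟨f, hf, hfU⟩ := exists_orthonormal_mem U hmU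
  have hw0 : w ≠ 0 := by
    rintro rfl
    simp at hw
  have hG := norm_covSqrt_pos M hε hw0
  have hm' : (0 : ℝ) < m := by exact_mod_cast hm
  have hsub : {X : Fin m → EuclideanSpace ℝ (Fin n) | ¬ LassoFails S X w} ⊆
      {X | ∃ α : Fin m → ℝ,
        200 * √m * (√ε * √(∑ i, inner ℝ (f i) (∑ l, α l • X l) ^ 2)) < ‖α‖} ∪
      {X | 8 * m * ‖covSqrt M ε w‖ ^ 2 < ∑ l, inner ℝ w (X l) ^ 2} := by
    intro X hX
    by_contra hcon
    simp only [Set.mem_union, Set.mem_ofPred_eq, not_or, not_exists, not_lt] at hcon hX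
    obtain ⟨h1, h2⟩ := hcon
    obtain ⟨u, huf, huX, hu⟩ := exists_interpolant hf (R := 200 * √m * √ε)
      (fun α => (h1 α).trans_eq (by ring)) fun l => inner ℝ (X l) w
    have huU : u ∈ U := Submodule.span_le.2 (by rintro _ ⟨i, rfl⟩; exact hfU i) huf
    rw [LassoFails, not_not] at hX
    have hle := hX.2 u huX
    have hy : ∑ l, |inner ℝ (X l) w| ≤ √m * √(8 * m * ‖covSqrt M ε w‖ ^ 2) :=
      sum_abs_le_of_sum_sq_le (by simpa only [real_inner_comm] using h2)
    -- `√m * √m * √(8 m)` is at most `n * √n`, since `2 * m ≤ n`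
    have hs8 : √(8 * m * ‖covSqrt M ε w‖ ^ 2) = √(2 * m) * (2 * ‖covSqrt M ε w‖) := by
      rw [show 8 * (m : ℝ) * ‖covSqrt M ε w‖ ^ 2 = (2 * m) * (2 * ‖covSqrt M ε w‖) ^ 2 by ring,
        Real.sqrt_mul (by positivity), Real.sqrt_sq (by positivity)]
    have hmn' : (2 * m : ℝ) ≤ n := by exact_mod_cast hmn
    have hFu : objectiveSeminorm S u ≤ 400 * (K * √ε * (n * √n)) * ‖covSqrt M ε w‖ := by
      calc objectiveSeminorm S u ≤ 2 * K * ‖u‖ := hF u huU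
        _ ≤ 2 * K * (200 * √m * √ε * (√m * (√(2 * m) * (2 * ‖covSqrt M ε w‖)))) := by
            rw [hs8] at hy
            gcongr
            exact hu.trans (by gcongr)
        _ = 400 * (K * √ε * ((2 * (√m * √m)) * √(2 * m))) * ‖covSqrt M ε w‖ := by ring
        _ ≤ _ := by
            rw [Real.mul_self_sqrt hm'.le]
            gcongr
    exact absurd hw (not_lt.2 (le_trans hle hFu))
  refine (measure_mono hsub).trans ((measure_union_le _ _).trans ?_)
  have e : (2 * m + 2 : ℝ) * Real.exp (-m) = (2 * m + 1) * Real.exp (-m) + Real.exp (-m) := by ring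
  rw [e, ENNReal.ofReal_add (by positivity) (by positivity)]
  exact add_le_add (sampleLaw_small_combination_le M hε hm hf fun i => hU (hfU i))
    (sampleLaw_sum_inner_sq_gt_le M hε m (by positivity) le_rfl)

end LargeSignal

/-! ### Sparse columns of the preconditioner -/

section Restriction

variable {n s p : ℕ}

theorem restrictCompl_add (C : Finset (Fin n)) (x y : EuclideanSpace ℝ (Fin n)) :
    restrictCompl C (x + y) = restrictCompl C x + restrictCompl C y := by
  ext i; by_cases h : i ∈ C <;> simp [restrictCompl, h]

theorem restrictCompl_neg (C : Finset (Fin n)) (x : EuclideanSpace ℝ (Fin n)) :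
    restrictCompl C (-x) = -restrictCompl C x := by
  ext i; by_cases h : i ∈ C <;> simp [restrictCompl, h]

theorem restrictCompl_sub (C : Finset (Fin n)) (x y : EuclideanSpace ℝ (Fin n)) :
    restrictCompl C (x - y) = restrictCompl C x - restrictCompl C y := by
  rw [sub_eq_add_neg, restrictCompl_add, restrictCompl_neg, ← sub_eq_add_neg]

theorem inner_restrictCompl_right (C : Finset (Fin n)) (x y : EuclideanSpace ℝ (Fin n)) :
    inner ℝ x (restrictCompl C y) = inner ℝ (restrictCompl C x) (restrictCompl C y) := by
  rw [inner_eq_dotProduct, inner_eq_dotProduct, dotProduct, dotProduct]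
  refine Finset.sum_congr rfl fun i _ => ?_
  by_cases h : i ∈ C <;> simp [restrictCompl, h]

/-- A vector whose inner products are dominated by those of the vectors `v j` is small wherever all
the `v j` are small. -/
theorem norm_restrictCompl_le_sum {ι : Type*} {J : Finset ι} {v : ι → EuclideanSpace ℝ (Fin n)}
    {g : EuclideanSpace ℝ (Fin n)} (h : ∀ x, inner ℝ g x ≤ ∑ j ∈ J, |inner ℝ (v j) x|)
    (C : Finset (Fin n)) : ‖restrictCompl C g‖ ≤ ∑ j ∈ J, ‖restrictCompl C (v j)‖ := by
  rcases (norm_nonneg (restrictCompl C g)).eq_or_lt' with h0 | h0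
  · rw [h0]; exact Finset.sum_nonneg fun _ _ => norm_nonneg _
  refine le_of_mul_le_mul_right ?_ h0
  rw [Finset.sum_mul, ← real_inner_self_eq_norm_mul_norm, ← inner_restrictCompl_right]
  refine (h _).trans (Finset.sum_le_sum fun j _ => ?_)
  rw [inner_restrictCompl_right]
  exact abs_real_inner_le_norm _ _

variable (M : Matrix (Fin p) (Fin n) ℝ) (S : Matrix (Fin n) (Fin s) ℝ) {ε lam : ℝ}

theorem sum_norm_row_le (hpn : p ≤ n) :
    ∑ i, ‖(WithLp.toLp 2 (M i) : EuclideanSpace ℝ (Fin n))‖ ≤ √n * frobNorm M := by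
  have h1 : ∑ i, ‖(WithLp.toLp 2 (M i) : EuclideanSpace ℝ (Fin n))‖ ^ 2 = ∑ i, ∑ j, M i j ^ 2 :=
    Finset.sum_congr rfl fun i _ => by rw [EuclideanSpace.real_norm_sq_eq]
  have h2 := sum_abs_le_of_sum_sq_le h1.le
  simp only [abs_norm] at h2
  refine h2.trans ?_
  rw [frobNorm]
  gcongr

/-- If the normalized rows outside `B` have small objective, the sparse columns of `S` are small in
total outside the coordinate set that robustness attaches to `B`. -/
theorem sum_norm_restrictCompl_column_le (hε : 0 < ε)
    (hlam : IsSmallestNonzeroEigenvalue (Mᵀ * M) lam) (hpn : p ≤ n) {η τ Λ : ℝ} (hη : 0 < η)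
    (hΛ : 0 ≤ Λ) {B : Finset (Fin p)} {C : Finset (Fin n)}
    (hC : ∀ x : EuclideanSpace ℝ (Fin n), τ ≤ ((supp x).card : ℝ) ∨
      ‖restrictCompl C x‖ ≤ η * ‖fun i : {i : Fin p // i ∉ B} => (M *ᵥ x.ofLp) i‖)
    (hB : ∀ i ∉ B, objectiveSeminorm S (normalizedRow M ε i) ≤ Λ)
    {J : Finset (Fin s)} (hJ : ∀ j ∈ J, ((supp (column S j)).card : ℝ) < τ) :
    ∑ j ∈ J, ‖restrictCompl C (column S j)‖ ≤ η * (Λ * (√n * frobNorm M / √lam)) := by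
  have hl := eigenvalue_pos M hlam
  have h1 : ∀ j ∈ J, ‖restrictCompl C (column S j)‖ ≤
      η * ∑ i ∈ Bᶜ, |inner ℝ (column S j) (WithLp.toLp 2 (M i))| := by
    intro j hj
    refine ((hC (column S j)).resolve_left (not_le.2 (hJ j hj))).trans ?_
    gcongr
    rw [pi_norm_le_iff_of_nonneg (Finset.sum_nonneg fun _ _ => abs_nonneg _)]
    rintro ⟨i, hi⟩
    simp only
    rw [← inner_row_eq, real_inner_comm, Real.norm_eq_abs]
    exact Finset.single_le_sum (f := fun i => |inner ℝ (column S j) (WithLp.toLp 2 (M i))|)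
      (fun _ _ => abs_nonneg _) (Finset.mem_compl.2 hi)
  have h2 : ∀ i ∈ Bᶜ, ∑ j ∈ J, |inner ℝ (column S j) (WithLp.toLp 2 (M i))| ≤
      Λ / √lam * ‖(WithLp.toLp 2 (M i) : EuclideanSpace ℝ (Fin n))‖ := by
    intro i hi
    have h3 : ‖covSqrt M ε (WithLp.toLp 2 (M i))‖ ≤
        ‖(WithLp.toLp 2 (M i) : EuclideanSpace ℝ (Fin n))‖ / √lam := by
      refine le_of_sq_le_sq ?_ (by positivity)
      rw [div_pow, Real.sq_sqrt hl.le]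
      exact norm_sq_covSqrt_le M hε hlam (row_mem_orthogonal_kernel M i)
    calc ∑ j ∈ J, |inner ℝ (column S j) (WithLp.toLp 2 (M i))|
        ≤ objectiveSeminorm S (WithLp.toLp 2 (M i)) := by
          rw [objectiveSeminorm_apply, objective_eq_sum_abs_inner]
          exact Finset.sum_le_sum_of_subset_of_nonneg (Finset.subset_univ _)
            fun _ _ _ => abs_nonneg _
      _ = ‖covSqrt M ε (WithLp.toLp 2 (M i))‖ * objectiveSeminorm S (normalizedRow M ε i) := by
          rw [← norm_covSqrt_smul_normalizedRow M hε i, map_smul_eq_mul, norm_norm,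
            norm_covSqrt_smul_normalizedRow M hε i]
      _ ≤ ‖(WithLp.toLp 2 (M i) : EuclideanSpace ℝ (Fin n))‖ / √lam * Λ := by
          have := hB i (Finset.mem_compl.1 hi)
          gcongr
      _ = _ := by ring
  calc ∑ j ∈ J, ‖restrictCompl C (column S j)‖
      ≤ ∑ j ∈ J, η * ∑ i ∈ Bᶜ, |inner ℝ (column S j) (WithLp.toLp 2 (M i))| :=
        Finset.sum_le_sum h1
    _ = η * ∑ i ∈ Bᶜ, ∑ j ∈ J, |inner ℝ (column S j) (WithLp.toLp 2 (M i))| := by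
        rw [← Finset.mul_sum, Finset.sum_comm]
    _ ≤ η * ∑ i ∈ Bᶜ, Λ / √lam * ‖(WithLp.toLp 2 (M i) : EuclideanSpace ℝ (Fin n))‖ := by
        gcongr with i hi
        exact h2 i hi
    _ ≤ η * (Λ / √lam * (√n * frobNorm M)) := by
        rw [← Finset.mul_sum]
        gcongr
        exact (Finset.sum_le_sum_of_subset_of_nonneg (Finset.subset_univ _)
          fun _ _ _ => norm_nonneg _).trans (sum_norm_row_le M hpn)
    _ = _ := by ring

theorem norm_mulVec_single_le_frobNorm (j : Fin n) (i : Fin p) :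
    |(M *ᵥ (EuclideanSpace.single j (1 : ℝ)).ofLp) i| ≤ frobNorm M := by
  have e : (M *ᵥ (EuclideanSpace.single j (1 : ℝ)).ofLp) i = M i j := by
    simp [Matrix.mulVec, dotProduct]
  rw [e, frobNorm]
  apply Real.le_sqrt_of_sq_le
  rw [sq_abs]
  calc M i j ^ 2 ≤ ∑ j, M i j ^ 2 :=
        Finset.single_le_sum (f := fun j => M i j ^ 2) (fun _ _ => sq_nonneg _) (Finset.mem_univ j)
    _ ≤ _ := Finset.single_le_sum (f := fun i => ∑ j, M i j ^ 2)
        (fun _ _ => Finset.sum_nonneg fun _ _ => sq_nonneg _) (Finset.mem_univ i)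

/-- Erasure-robustness, applied to a basis vector outside the exceptional coordinates. -/
theorem one_le_mul_frobNorm {b b' η τ : ℝ} (hb : 0 < b) (hη : 0 < η) (hτ : 1 < τ) (hb' : b' < n)
    (h : ErasureRobust M b b' η τ) : 1 ≤ η * frobNorm M := by
  obtain ⟨C, hC, hCx⟩ := h ∅ (by simpa using hb.le)
  obtain ⟨j, hj⟩ : ∃ j, j ∉ C := by
    by_contra! hall
    have : C = Finset.univ := Finset.eq_univ_of_forall hall
    rw [this, Finset.card_univ, Fintype.card_fin] at hC
    linarith
  have hs : (supp (EuclideanSpace.single j (1 : ℝ))).card = 1 := by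
    rw [Finset.card_eq_one]
    refine ⟨j, ?_⟩
    ext i
    simp [supp]
  have h1 := (hCx (EuclideanSpace.single j 1)).resolve_left (by rw [hs]; simpa using hτ)
  have h2 : restrictCompl C (EuclideanSpace.single j (1 : ℝ)) = EuclideanSpace.single j 1 := by
    ext i
    by_cases hi : i ∈ C
    · have : i ≠ j := fun e => hj (e ▸ hi)
      simp [restrictCompl, hi, this]
    · simp [restrictCompl, hi]
  rw [h2, PiLp.norm_single, norm_one] at h1
  refine h1.trans ?_
  gcongr
  rw [pi_norm_le_iff_of_nonneg (show 0 ≤ frobNorm M from Real.sqrt_nonneg _)]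
  exact fun i => norm_mulVec_single_le_frobNorm M j i

end Restriction

/-! ### Certificates near `ker M` -/

section NearKernel

variable {n m p : ℕ} (M : Matrix (Fin p) (Fin n) ℝ) {ε lam : ℝ}

/-- Combinations of typical samples lie close to `ker M`. -/
theorem norm_sub_starProjection_le (hl : 0 < lam) (hε : 0 < ε) (hmn : 2 * m ≤ n)
    {X : Fin m → EuclideanSpace ℝ (Fin n)} {d : ℕ} {f : Fin d → EuclideanSpace ℝ (Fin n)}
    (hf : Orthonormal ℝ f) {α : Fin m → ℝ}
    (hα : ‖α‖ ≤ 200 * √m * (√ε * √(∑ i, inner ℝ (f i) (∑ l, α l • X l) ^ 2)))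
    (hX : ∀ j, ∑ l, inner ℝ (EuclideanSpace.single j (1 : ℝ) -
      (kernel M).starProjection (EuclideanSpace.single j 1)) (X l) ^ 2 ≤ 8 * m * (1 / lam)) :
    ‖(∑ l, α l • X l) - (kernel M).starProjection (∑ l, α l • X l)‖ ≤
      200 * ((n : ℝ) ^ 2 * √(ε / lam)) * ‖∑ l, α l • X l‖ := by
  set g := ∑ l, α l • X l with hg
  have hα' : ‖α‖ ≤ 200 * √m * (√ε * ‖g‖) := by
    refine hα.trans ?_
    gcongr
    rw [Real.sqrt_le_left (norm_nonneg _)]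
    have := hf.sum_inner_products_le (s := Finset.univ) (x := g)
    simpa only [Real.norm_eq_abs, sq_abs] using this
  have hmn' : (2 * m : ℝ) ≤ n := by exact_mod_cast hmn
  have hs8 : √(8 * m * (1 / lam)) = 2 * √(2 * m) / √lam := by
    rw [show 8 * (m : ℝ) * (1 / lam) = 2 ^ 2 * (2 * m) / lam by ring, Real.sqrt_div (by positivity),
      Real.sqrt_mul (by positivity), Real.sqrt_sq (by norm_num)]
  have hcoord : ∀ j, |(g - (kernel M).starProjection g) j| ≤
      200 * (n * √n * √(ε / lam)) * ‖g‖ := by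
    intro j
    have h1 : (g - (kernel M).starProjection g) j = ∑ l, α l * inner ℝ
        (EuclideanSpace.single j (1 : ℝ) - (kernel M).starProjection (EuclideanSpace.single j 1))
        (X l) := by
      have e1 : (g - (kernel M).starProjection g) j =
          inner ℝ (EuclideanSpace.single j (1 : ℝ)) (g - (kernel M).starProjection g) := by
        rw [EuclideanSpace.inner_single_left]; simp
      rw [e1, inner_sub_right, ← Submodule.inner_starProjection_left_eq_right, ← inner_sub_left, hg,
        inner_sum]
      exact Finset.sum_congr rfl fun l _ => by rw [inner_smul_right]
    rw [h1]
    calc |∑ l, α l * inner ℝ (EuclideanSpace.single j (1 : ℝ) -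
            (kernel M).starProjection (EuclideanSpace.single j 1)) (X l)|
        ≤ ∑ l, ‖α‖ * |inner ℝ (EuclideanSpace.single j (1 : ℝ) -
            (kernel M).starProjection (EuclideanSpace.single j 1)) (X l)| := by
          refine (Finset.abs_sum_le_sum_abs _ _).trans (Finset.sum_le_sum fun l _ => ?_)
          rw [abs_mul]
          gcongr
          exact norm_le_pi_norm α l
      _ ≤ (200 * √m * (√ε * ‖g‖)) * (√m * √(8 * m * (1 / lam))) := by
          rw [← Finset.mul_sum]
          gcongr
          exact sum_abs_le_of_sum_sq_le (hX j)
      _ = 200 * ((2 * (√m * √m)) * √(2 * m) * (√ε / √lam)) * ‖g‖ := by rw [hs8]; ring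
      _ ≤ _ := by
          rw [Real.mul_self_sqrt (Nat.cast_nonneg m), ← Real.sqrt_div hε.le]
          gcongr
  refine abs_le_of_sq_le_sq' ?_ (by positivity) |>.2
  rw [EuclideanSpace.real_norm_sq_eq]
  calc ∑ j, (g - (kernel M).starProjection g) j ^ 2
      ≤ ∑ _j : Fin n, (200 * (n * √n * √(ε / lam)) * ‖g‖) ^ 2 := by
        refine Finset.sum_le_sum fun j _ => ?_
        rw [← sq_abs]
        exact pow_le_pow_left₀ (abs_nonneg _) (hcoord j) 2
    _ = (200 * (n * (√n * √n) * √(ε / lam)) * ‖g‖) ^ 2 := by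
        rw [Finset.sum_const, Finset.card_univ, Fintype.card_fin, nsmul_eq_mul]
        nth_rw 1 [← Real.mul_self_sqrt (Nat.cast_nonneg n : (0 : ℝ) ≤ n)]
        ring
    _ = _ := by rw [Real.mul_self_sqrt (Nat.cast_nonneg n)]; ring

/-- Two vectors close to a quantitatively dense subspace `V` that agree up to a small error outside
a small set of coordinates are close, and so are their projections to `V`. -/
theorem norm_starProjection_sub_lt {V : Submodule ℝ (EuclideanSpace ℝ (Fin n))} {b' : ℝ}
    (hn : 0 < n) (hV : QuantitativelyDense V (1 / (12 * √n)) (1 / (2 * √n)) b')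
    {C : Finset (Fin n)} (hC : (C.card : ℝ) ≤ b') {a g h : EuclideanSpace ℝ (Fin n)} {κ γ : ℝ}
    (hγ : 0 < γ) (hκ : 134 * (√n * κ) ≤ γ)
    (hg : ‖g - V.starProjection g‖ ≤ 1 / (1200 * √n) * ‖g‖)
    (hh : ‖h - V.starProjection h‖ ≤ 1 / (1200 * √n) * ‖h‖)
    (hga : ‖restrictCompl C (g - a)‖ ≤ κ) (hha : ‖restrictCompl C (h - a)‖ ≤ κ) (hhγ : γ ≤ ‖h‖) :
    ‖V.starProjection g - V.starProjection h‖ < ‖V.starProjection h‖ / 2 := by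
  have hsn : 1 ≤ √(n : ℝ) := Real.one_le_sqrt.2 (by exact_mod_cast hn)
  have hsn0 : 0 < √(n : ℝ) := by linarith
  have hh0 : 0 < ‖h‖ := hγ.trans_le hhγ
  have h1 : ‖(g - h) - V.starProjection (g - h)‖ ≤ 1 / (1200 * √n) * (‖g‖ + ‖h‖) := by
    have e : (g - h) - V.starProjection (g - h) =
        (g - V.starProjection g) - (h - V.starProjection h) := by rw [map_sub]; abel
    rw [e]
    exact (norm_sub_le _ _).trans (by linarith)
  have hclose : ‖g - h‖ ≤ 3 / 100 * ‖h‖ := by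
    by_cases hd : ‖(g - h) - V.starProjection (g - h)‖ ≤ 1 / (12 * √n) * ‖g - h‖
    · have h2 := hV C hC (g - h) ((Metric.infDist_le_dist_of_mem
        (V.starProjection_apply_mem (g - h))).trans (by rwa [dist_eq_norm]))
      have h3 : ‖restrictCompl C (g - h)‖ ≤ 2 * κ := by
        have e : g - h = (g - a) - (h - a) := by abel
        rw [e, restrictCompl_sub]
        exact (norm_sub_le _ _).trans (by linarith)
      have h4 : ‖g - h‖ ≤ 4 * (√n * κ) := by
        have h5 := h2.trans h3
        rw [div_mul_eq_mul_div, one_mul, div_le_iff₀ (by positivity)] at h5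
        linarith
      linarith
    · push Not at hd
      have h2 := hd.trans_le h1
      have h3 : ‖g - h‖ < 1 / 100 * (‖g‖ + ‖h‖) := by
        have e : 1 / (1200 * √(n : ℝ)) * (‖g‖ + ‖h‖) =
            1 / (12 * √n) * (1 / 100 * (‖g‖ + ‖h‖)) := by field_simp; norm_num
        rw [e] at h2
        exact lt_of_mul_lt_mul_left h2 (by positivity)
      have h4 : ‖g‖ ≤ ‖g - h‖ + ‖h‖ := by
        simpa using norm_add_le (g - h) h
      linarith
  have h2 : ‖V.starProjection g - V.starProjection h‖ ≤ 3 / 100 * ‖h‖ := by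
    rw [← map_sub]
    exact (V.norm_starProjection_apply_le _).trans hclose
  have h3 : ‖h - V.starProjection h‖ ≤ 1 / 1200 * ‖h‖ := by
    refine hh.trans ?_
    gcongr
    linarith
  have h4 : ‖h‖ ≤ ‖h - V.starProjection h‖ + ‖V.starProjection h‖ := by
    simpa using norm_add_le (h - V.starProjection h) (V.starProjection h)
  linarith

end NearKernel

/-! ### Typical sparse signals -/

section TypicalSignal

variable {n m s p : ℕ} (M : Matrix (Fin p) (Fin n) ℝ) {ε lam : ℝ} (S : Matrix (Fin n) (Fin s) ℝ)

theorem sampleLaw_spanNear_le_of_le (hε : 0 < ε) {r : ℕ} (hr : 0 < r)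
    (hrk : r ≤ Module.finrank ℝ (kernel M)) {h : EuclideanSpace ℝ (Fin n)}
    (hk : h ∈ kernel M) (h0 : h ≠ 0) :
    sampleLaw (covMat M ε) m (spanNear M m h) ≤ ENNReal.ofReal (4 * m / (3 * r)) := by
  refine (sampleLaw_spanNear_le M hε m hk h0).trans (ENNReal.ofReal_le_ofReal ?_)
  have : (r : ℝ) ≤ Module.finrank ℝ (kernel M) := by exact_mod_cast hrk
  have : (0 : ℝ) < r := by exact_mod_cast hr
  gcongr

/-- If every certificate is nearly determined by the signal, recovery is unlikely: the span of the
samples would have to come close to a fixed vector of `ker M`. -/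
theorem sampleLaw_not_lassoFails_le_of_typical (hε : 0 < ε)
    (hlam : IsSmallestNonzeroEigenvalue (Mᵀ * M) lam) (hm : 0 < m) (hmn : 2 * m ≤ n) {r : ℕ}
    (hmr : 2 * m ≤ r) (hrk : r ≤ Module.finrank ℝ (kernel M)) {b' : ℝ}
    (hV : QuantitativelyDense (kernel M) (1 / (12 * √n)) (1 / (2 * √n)) b')
    {C : Finset (Fin n)} (hC : (C.card : ℝ) ≤ b') {κ γ : ℝ} (hγ : 0 < γ)
    (hκγ : 134 * (√n * κ) ≤ γ) (hδ : 200 * ((n : ℝ) ^ 2 * √(ε / lam)) ≤ 1 / (1200 * √n))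
    {w : EuclideanSpace ℝ (Fin n)} (hw : w ≠ 0) (hwγ : γ * ‖w‖ ≤ objectiveSeminorm S w)
    (hκ : ∑ j ∈ Finset.univ.filter fun j => inner ℝ (column S j) w = 0,
      ‖restrictCompl C (column S j)‖ ≤ κ) :
    sampleLaw (covMat M ε) m {X | ¬ LassoFails S X w} ≤
      ENNReal.ofReal ((2 * m + 1 + n) * Real.exp (-m) + 4 * m / (3 * r)) := by
  have hl := eigenvalue_pos M hlam
  have hn : 0 < n := by omega
  have hr : 0 < r := by omega
  obtain ⟨f, hf, hfk⟩ := exists_orthonormal_mem (kernel M) (hmr.trans hrk)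
  -- candidates for a certificate, a set that depends on the signal only
  set 𝓗 : Set (EuclideanSpace ℝ (Fin n)) :=
    {h | ‖h - (kernel M).starProjection h‖ ≤ 1 / (1200 * √n) * ‖h‖ ∧
      ‖restrictCompl C (h - signCombination S w)‖ ≤ κ ∧ γ ≤ ‖h‖} with h𝓗
  -- All candidates are close to each other, so a sample whose span contains a candidate lies in
  -- `spanNear` for the projection of any fixed one.
  obtain ⟨A, hA, hA𝓗⟩ : ∃ A : Set (Fin m → EuclideanSpace ℝ (Fin n)),
      sampleLaw (covMat M ε) m A ≤ ENNReal.ofReal (4 * m / (3 * r)) ∧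
      ∀ X, ∀ α : Fin m → ℝ, ∑ l, α l • X l ∈ 𝓗 → X ∈ A := by
    rcases 𝓗.eq_empty_or_nonempty with h | ⟨h, hh1, hh2, hh3⟩
    · exact ⟨∅, by simp, fun X α hα => by simp [h] at hα⟩
    · have hclose : ∀ g ∈ 𝓗, ‖(kernel M).starProjection g - (kernel M).starProjection h‖ <
          ‖(kernel M).starProjection h‖ / 2 := fun g hg =>
        norm_starProjection_sub_lt hn hV hC hγ hκγ hg.1 hh1 hg.2.1 hh2 hh3
      have h0 : (kernel M).starProjection h ≠ 0 := fun h0 => by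
        have := hclose h ⟨hh1, hh2, hh3⟩
        simp [h0] at this
      exact ⟨spanNear M m ((kernel M).starProjection h), sampleLaw_spanNear_le_of_le M hε hr hrk
        (Submodule.starProjection_apply_mem _ _) h0, fun X α hα => ⟨α, hclose _ hα⟩⟩
  set D : Fin n → Set (Fin m → EuclideanSpace ℝ (Fin n)) := fun j =>
    {X | 8 * m * (1 / lam) < ∑ l, inner ℝ (EuclideanSpace.single j (1 : ℝ) -
      (kernel M).starProjection (EuclideanSpace.single j 1)) (X l) ^ 2} with hD
  have hDp : ∀ j, sampleLaw (covMat M ε) m (D j) ≤ ENNReal.ofReal (Real.exp (-m)) := by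
    intro j
    refine sampleLaw_sum_inner_sq_gt_le M hε m (by positivity) ?_
    refine (norm_sq_covSqrt_le M hε hlam
      (Submodule.sub_starProjection_mem_orthogonal _)).trans ?_
    gcongr
    rw [← Submodule.starProjection_orthogonal_val]
    have := (kernel M)ᗮ.norm_starProjection_apply_le (EuclideanSpace.single j (1 : ℝ))
    rw [PiLp.norm_single, norm_one] at this
    exact pow_le_one₀ (norm_nonneg _) this
  have hsub : {X : Fin m → EuclideanSpace ℝ (Fin n) | ¬ LassoFails S X w} ⊆
      {X | ∃ α : Fin m → ℝ,
        200 * √m * (√ε * √(∑ i, inner ℝ (f i) (∑ l, α l • X l) ^ 2)) < ‖α‖} ∪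
      ((⋃ j, D j) ∪ A) := by
    intro X hX
    by_contra hcon
    simp only [Set.mem_union, Set.mem_iUnion, hD, Set.mem_ofPred_eq, not_or, not_exists, not_lt]
      at hcon hX
    obtain ⟨h1, h2, h3⟩ := hcon
    obtain ⟨α, hα, hcert⟩ := exists_certificate S hX
    refine h3 (hA𝓗 X α ⟨?_, ?_, ?_⟩)
    · exact (norm_sub_starProjection_le M hl hε hmn hf (h1 α) h2).trans (by gcongr)
    · exact (norm_restrictCompl_le_sum hcert C).trans hκ
    · have hw0 := norm_pos_iff.2 hw
      refine le_of_mul_le_mul_right (hwγ.trans ?_) hw0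
      rw [objectiveSeminorm_apply, ← hα]
      exact real_inner_le_norm _ _
  have hn' : (0 : ℝ) ≤ n * Real.exp (-m) := by positivity
  refine (measure_mono hsub).trans ((measure_union_le _ _).trans ?_)
  have e : (2 * m + 1 + n : ℝ) * Real.exp (-m) + 4 * m / (3 * r) =
    (2 * m + 1) * Real.exp (-m) + (n * Real.exp (-m) + 4 * m / (3 * r)) := by ring
  rw [e, ENNReal.ofReal_add (by positivity) (by positivity),
    ENNReal.ofReal_add (by positivity) (by positivity)]
  refine add_le_add (sampleLaw_small_combination_le M hε hm hf hfk)
    ((measure_union_le _ _).trans (add_le_add ?_ hA))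
  refine (measure_iUnion_fintype_le _ _).trans ((Finset.sum_le_sum fun j _ => hDp j).trans ?_)
  rw [Finset.sum_const, Finset.card_univ, Fintype.card_fin, nsmul_eq_mul,
    ENNReal.ofReal_mul (by positivity), ENNReal.ofReal_natCast]

/-- If the columns of `S` orthogonal to the signal all vanish, the certificate is determined by the
signal, and recovery is unlikely. -/
theorem sampleLaw_not_lassoFails_le_of_dense (hε : 0 < ε) (hm : 0 < m) {r : ℕ}
    (hmr : 2 * m ≤ r) (hrk : r ≤ Module.finrank ℝ (kernel M))
    {w : EuclideanSpace ℝ (Fin n)} (hw : 0 < objectiveSeminorm S w)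
    (hS : ∀ j, inner ℝ (column S j) w = 0 → column S j = 0) :
    sampleLaw (covMat M ε) m {X | ¬ LassoFails S X w} ≤
      ENNReal.ofReal ((2 * m + 1 + n) * Real.exp (-m) + 4 * m / (3 * r)) := by
  have hr : 0 < r := by omega
  obtain ⟨f, hf, hfk⟩ := exists_orthonormal_mem (kernel M) (hmr.trans hrk)
  set a := signCombination S w with ha
  have hcert : ∀ X : Fin m → EuclideanSpace ℝ (Fin n), ¬ LassoFails S X w →
      ∃ α : Fin m → ℝ, ∑ l, α l • X l = a := by
    intro X hX
    obtain ⟨α, -, hcert⟩ := exists_certificate S hX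
    refine ⟨α, sub_eq_zero.1 ?_⟩
    have h0 := hcert (∑ l, α l • X l - signCombination S w)
    have hz : ∑ j ∈ Finset.univ.filter fun j => inner ℝ (column S j) w = 0,
        |inner ℝ (column S j) (∑ l, α l • X l - signCombination S w)| = 0 :=
      Finset.sum_eq_zero fun j hj => by
        rw [hS j (Finset.mem_filter.1 hj).2, inner_zero_left, abs_zero]
    rw [hz, real_inner_self_eq_norm_sq] at h0
    exact norm_eq_zero.1 (pow_eq_zero_iff two_ne_zero |>.1 (le_antisymm h0 (sq_nonneg _)))
  have hle : ENNReal.ofReal ((2 * m + 1) * Real.exp (-m) + 4 * m / (3 * r)) ≤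
      ENNReal.ofReal ((2 * m + 1 + n) * Real.exp (-m) + 4 * m / (3 * r)) := by
    apply ENNReal.ofReal_le_ofReal
    have : (0 : ℝ) ≤ n * Real.exp (-m) := by positivity
    linarith
  refine le_trans ?_ hle
  -- If `a` is orthogonal to `ker M`, it is a combination of the samples without component along
  -- the vectors `f i`.
  by_cases hPa : (kernel M).starProjection a = 0
  · refine (measure_mono ?_).trans ((sampleLaw_small_combination_le M hε hm hf hfk).trans
      (ENNReal.ofReal_le_ofReal (by linarith [show (0 : ℝ) ≤ 4 * m / (3 * r) by positivity])))
    intro X hX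
    obtain ⟨α, hα⟩ := hcert X hX
    refine ⟨α, ?_⟩
    have h0 : ∀ i, inner ℝ (f i) a = 0 := fun i => by
      rw [← Submodule.starProjection_eq_self_iff.2 (hfk i),
        Submodule.inner_starProjection_left_eq_right, hPa, inner_zero_right]
    simp only [hα, h0]
    norm_num
    rintro rfl
    have := inner_signCombination_self S w
    rw [← ha, ← hα] at this
    simp [← objectiveSeminorm_apply] at this
    linarith
  · refine (measure_mono (t := spanNear M m ((kernel M).starProjection a)) ?_).trans
      ((sampleLaw_spanNear_le_of_le M hε hr hrk (Submodule.starProjection_apply_mem _ _) hPa).trans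
      (ENNReal.ofReal_le_ofReal
        (by linarith [show (0 : ℝ) ≤ (2 * m + 1) * Real.exp (-m) by positivity])))
    intro X hX
    obtain ⟨α, hα⟩ := hcert X hX
    refine ⟨α, ?_⟩
    rw [hα, sub_self, norm_zero]
    have := norm_pos_iff.2 hPa
    positivity

end TypicalSignal

/-! ### The law of the signal -/

section SignalLaw

variable {n p : ℕ} (M : Matrix (Fin p) (Fin n) ℝ) (ε : ℝ) {k k' t : ℕ}

theorem measurable_rowCombination :
    Measurable fun ω : (Fin t → Fin p) × (Fin t → ℝ) =>
      ∑ i, ω.2 i • normalizedRow M ε (ω.1 i) := by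
  refine Finset.measurable_sum _ fun i _ => ?_
  have h1 : Measurable fun ω : (Fin t → Fin p) × (Fin t → ℝ) => normalizedRow M ε (ω.1 i) :=
    (measurable_of_countable (normalizedRow M ε)).comp
      ((measurable_pi_apply i).comp measurable_fst)
  fun_prop

instance [NeZero p] : IsProbabilityMeasure (rowCombinationLaw M ε t) := by
  have : IsProbabilityMeasure (uniformOn (Set.univ : Set (Fin p))) :=
    isProbabilityMeasure_uniformOn Set.finite_univ Set.univ_nonempty
  have h : IsProbabilityMeasure uniformLaw := inferInstance
  rw [rowCombinationLaw]
  exact Measure.isProbabilityMeasure_map (measurable_rowCombination M ε).aemeasurable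

instance isProbabilityMeasure_signalLaw [NeZero p] : IsProbabilityMeasure (signalLaw M ε k t) := by
  constructor
  rw [signalLaw, Measure.add_apply, Measure.smul_apply, Measure.smul_apply, measure_univ,
    measure_univ]
  simp [ENNReal.inv_two_add_inv_two]

theorem signalLaw_real [NeZero p] (A : Set (EuclideanSpace ℝ (Fin n))) :
    (signalLaw M ε k t).real A = 1 / 2 * (rowCombinationLaw M ε t).real A +
      1 / 2 * (sparseGaussianLaw n k).real A := by
  simp only [Measure.real, signalLaw, Measure.add_apply, Measure.smul_apply, smul_eq_mul]
  rw [ENNReal.toReal_add (ENNReal.mul_ne_top (by simp) (measure_ne_top _ _))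
    (ENNReal.mul_ne_top (by simp) (measure_ne_top _ _)), ENNReal.toReal_mul, ENNReal.toReal_mul]
  simp

variable {M ε}

theorem half_le_signalLaw_of_rowCombinationLaw [NeZero p] {A : Set (EuclideanSpace ℝ (Fin n))}
    {q x : ℝ} (hq : 0 ≤ q) (h : rowCombinationLaw M ε t Aᶜ ≤ ENNReal.ofReal q) (hx : x ≤ 1 - q) :
    1 / 2 * x ≤ (signalLaw M ε k t).real A := by
  have h1 := measure_compl_le_real hq h
  have h2 := signalLaw_real M ε (k := k) (t := t) A
  have h3 : 0 ≤ (sparseGaussianLaw n k).real A := measureReal_nonneg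
  linarith

theorem half_le_signalLaw_of_sparseGaussianLaw [NeZero p] {A : Set (EuclideanSpace ℝ (Fin n))}
    {q x : ℝ} (hq : 0 ≤ q) (h : sparseGaussianLaw n k Aᶜ ≤ ENNReal.ofReal q) (hx : x ≤ 1 - q) :
    1 / 2 * x ≤ (signalLaw M ε k t).real A := by
  have h1 := measure_compl_le_real hq h
  have h2 := signalLaw_real M ε (k := k) (t := t) A
  have h3 : 0 ≤ (rowCombinationLaw M ε t).real A := measureReal_nonneg
  linarith

theorem measurableSet_card_supp_le (N : ℕ) :
    MeasurableSet {w : EuclideanSpace ℝ (Fin n) | (supp w).card ≤ N} := by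
  have h : Measurable fun w : EuclideanSpace ℝ (Fin n) => (supp w).card := by
    simp only [supp, Finset.card_filter]
    refine Finset.measurable_sum _ fun i _ => Measurable.ite ?_ measurable_const measurable_const
    exact (isOpen_ne_fun (by fun_prop) continuous_const).measurableSet
  exact h measurableSet_Iic

theorem card_supp_sum_smul_le {a : Fin p → EuclideanSpace ℝ (Fin n)}
    (ha : ∀ i, (supp (a i)).card ≤ k') (R : Fin t → Fin p) (z : Fin t → ℝ) :
    (supp (∑ i, z i • a (R i))).card ≤ k' * t := by
  have hsub : supp (∑ i, z i • a (R i)) ⊆ Finset.univ.biUnion fun i => supp (a (R i)) := by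
    intro j hj
    by_contra hcon
    simp only [Finset.mem_biUnion, Finset.mem_univ, true_and, supp, Finset.mem_filter, not_exists,
      not_not] at hcon hj
    exact hj (by simp [hcon])
  refine (Finset.card_le_card hsub).trans (Finset.card_biUnion_le.trans ?_)
  calc _ ≤ ∑ _i : Fin t, k' := Finset.sum_le_sum fun i _ => ha _
    _ = _ := by simp [mul_comm]

theorem card_supp_normalizedRow_le (h : ∀ i, (supp (WithLp.toLp 2 (M i))).card ≤ k') (i : Fin p) :
    (supp (normalizedRow M ε i)).card ≤ k' := by
  refine (Finset.card_le_card fun j hj => ?_).trans (h i)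
  simp only [supp, Finset.mem_filter, Finset.mem_univ, true_and] at hj ⊢
  exact fun h0 => hj (by simp [normalizedRow, h0])

theorem ae_signalLaw_card_supp_le [NeZero p]
    (h : ∀ i, (supp (WithLp.toLp 2 (M i))).card ≤ k') :
    ∀ᵐ w ∂(signalLaw M ε k t), (supp w).card ≤ max (k' * t) k := by
  rw [signalLaw, ae_add_measure_iff]
  constructor
  · refine Measure.ae_smul_measure ?_ _
    rw [rowCombinationLaw, ae_map_iff (measurable_rowCombination M ε).aemeasurable
      (measurableSet_card_supp_le _)]
    exact ae_of_all _ fun ω => (card_supp_sum_smul_le (card_supp_normalizedRow_le h) _ _).trans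
      (le_max_left _ _)
  · refine Measure.ae_smul_measure ?_ _
    rw [ae_iff]
    refine le_antisymm ?_ zero_le
    refine (sparseGaussianLaw_le (q := 0) (e := 0) (measurableSet_card_supp_le _).compl ∅ (by simp)
      fun K hK _ => ?_).trans (by simp)
    have : {g : Fin n → ℝ | restrictTo K g ∈
        {w : EuclideanSpace ℝ (Fin n) | (supp w).card ≤ max (k' * t) k}ᶜ} = ∅ := by
      ext g
      simp only [Set.mem_ofPred_eq, Set.mem_compl_iff, Set.mem_empty_iff_false, iff_false, not_not]
      have h1 : supp (restrictTo K g) ⊆ K := fun i hi => by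
        by_contra hiK
        simp [supp, restrictTo, hiK] at hi
      calc (supp (restrictTo K g)).card ≤ K.card := Finset.card_le_card h1
        _ = min k n := (Finset.mem_powersetCard.1 hK).2
        _ ≤ _ := (min_le_left _ _).trans (le_max_right _ _)
    rw [this, measure_empty]

theorem rowCombinationLaw_seminorm_le [NeZero p] (hε : 0 < ε) (hpn : p ≤ n) (hn : 10 ≤ n)
    (ht : 0 < t) {F : Seminorm ℝ (EuclideanSpace ℝ (Fin n))} (hF : Continuous F) {L D b : ℝ}
    (hL : 0 < L) (hD : 100 * ((n : ℝ) ^ 2 * √n) ≤ D) {B : Finset (Fin p)}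
    (hB : ∀ i ∈ B, D * L ≤ F (normalizedRow M ε i)) (hb0 : 0 < b) (hb : b ≤ B.card) :
    rowCombinationLaw M ε t {w | F w ≤ L * ‖covSqrt M ε w‖} ≤
      ENNReal.ofReal (Real.exp (-(b * t / p)) + 1 / n) := by
  rw [rowCombinationLaw, Measure.map_apply (measurable_rowCombination M ε)]
  · exact prod_rows_seminorm_le (T := covSqrt M ε) hpn hn ht hF
      (norm_covSqrt_normalizedRow_le M hε) hL hD hB hb0 hb
  · exact (isClosed_le hF (by fun_prop)).measurableSet

end SignalLaw

/-! ### Failure of the Lasso -/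

section Main

theorem pos_of_isSmallestNonzeroEigenvalue {n p : ℕ} {M : Matrix (Fin p) (Fin n) ℝ} {lam : ℝ}
    (h : IsSmallestNonzeroEigenvalue (Mᵀ * M) lam) : 0 < p := by
  rcases Nat.eq_zero_or_pos p with rfl | hp
  · obtain ⟨⟨h0, hev⟩, -⟩ := h
    obtain ⟨v, hv⟩ := hev.exists_hasEigenvector
    have h1 : Mᵀ *ᵥ (M *ᵥ v) = lam • v := by
      rw [Matrix.mulVec_mulVec, ← Matrix.toLin'_apply]; exact hv.apply_eq_smul
    rw [Subsingleton.elim (M *ᵥ v) 0, Matrix.mulVec_zero] at h1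
    exact absurd h1.symm (smul_ne_zero h0 hv.2)
  · exact hp

theorem rpow_fifteen_half (n : ℕ) : (n : ℝ) ^ (15 / 2 : ℝ) = √n ^ 15 := by
  rw [Real.sqrt_eq_rpow, ← Real.rpow_natCast, ← Real.rpow_mul (Nat.cast_nonneg n)]
  norm_num

/-- The mass of the sparse columns outside the exceptional coordinates is small compared with the
norm of every certificate. -/
theorem sparse_mass_le {N k K η f ε lam : ℝ} (hN : 44000 ≤ N) (hk : 1 ≤ k) (hK : 0 < K)
    (hη : 0 < η) (hf : 0 ≤ f) (hε : 0 < ε)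
    (h : 544 * N ^ 15 * k * η * f * √(ε / lam) ≤ 1) :
    134 * (N * (η * (100 * ((N ^ 2) ^ 2 * N) * (400 * (K * √ε * (N ^ 2 * N))) *
      (N * f / √lam)))) ≤ K / (2 * (N ^ 2 * N)) / √(2 * N ^ 2 * k) := by
  have hN0 : 0 < N := by linarith
  have hk0 : 0 < k := by linarith
  rw [Real.sqrt_div hε.le] at h
  have h1 : √(2 * N ^ 2 * k) ≤ 2 * N * k := by
    rw [Real.sqrt_le_left (by positivity)]
    nlinarith [mul_pos (pow_pos hN0 2) hk0, mul_nonneg (mul_pos (pow_pos hN0 2) hk0).le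
      (sub_nonneg.2 hk)]
  rw [div_div, le_div_iff₀ (by positivity)]
  have h2 : 0 ≤ √ε / √lam := by positivity
  calc 134 * (N * (η * (100 * ((N ^ 2) ^ 2 * N) * (400 * (K * √ε * (N ^ 2 * N))) *
      (N * f / √lam)))) * (2 * (N ^ 2 * N) * √(2 * N ^ 2 * k))
      = 10720000 * K * N ^ 13 * (η * f * (√ε / √lam)) * √(2 * N ^ 2 * k) := by ring
    _ ≤ 10720000 * K * N ^ 13 * (η * f * (√ε / √lam)) * (2 * N * k) := by gcongr
    _ = 21440000 * K * (N ^ 14 * k * η * f * (√ε / √lam)) := by ring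
    _ ≤ 544 * K * N * (N ^ 14 * k * η * f * (√ε / √lam)) := by
        refine mul_le_mul_of_nonneg_right ?_ (by positivity)
        nlinarith
    _ = K * (544 * N ^ 15 * k * η * f * (√ε / √lam)) := by ring
    _ ≤ K * 1 := by gcongr
    _ = K := mul_one K

/-- The relative distance of a certificate to `ker M` is below the scale of quantitative density. -/
theorem residual_factor_le {N k y ρ : ℝ} (hN : 44000 ≤ N) (hk : 1 ≤ k) (hy : 1 ≤ y) (hρ : 0 ≤ ρ)
    (h : 544 * N ^ 15 * k * y * ρ ≤ 1) :
    200 * ((N ^ 2) ^ 2 * ρ) ≤ 1 / (1200 * N) := by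
  have hN0 : 0 < N := by linarith
  rw [le_div_iff₀ (by positivity)]
  have h10 : (1000 : ℝ) ≤ N ^ 10 := by
    calc (1000 : ℝ) ≤ N ^ 1 := by linarith
      _ ≤ N ^ 10 := pow_le_pow_right₀ (by linarith) (by norm_num)
  calc 200 * ((N ^ 2) ^ 2 * ρ) * (1200 * N) = 240000 * N ^ 5 * ρ := by ring
    _ ≤ 544 * N ^ 10 * N ^ 5 * ρ := by gcongr; linarith
    _ = 544 * N ^ 15 * 1 * 1 * ρ := by ring
    _ ≤ 544 * N ^ 15 * k * y * ρ := by gcongr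
    _ ≤ 1 := h

theorem mul_exp_neg_le {n m : ℕ} (hn : 3 ≤ n) (hmn : 2 * m < n)
    (h : 10 ^ 10 * Real.log n ≤ m) :
    (2 * m + 1 + n) * Real.exp (-m) ≤ Real.exp (-(1 / 2 * m)) := by
  have hn0 : (3 : ℝ) ≤ n := by exact_mod_cast hn
  have hlog : 0 ≤ Real.log n := Real.log_nonneg (by linarith)
  have h1 : (2 * m + 1 + n : ℝ) ≤ Real.exp (1 / 2 * m) := by
    have h2 : (2 * m + 1 : ℝ) ≤ n := by exact_mod_cast hmn
    calc (2 * m + 1 + n : ℝ) ≤ n * n := by nlinarith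
      _ = Real.exp (Real.log n + Real.log n) := by
          rw [Real.exp_add, Real.exp_log (by linarith)]
      _ ≤ _ := Real.exp_le_exp.2 (by linarith)
  calc (2 * m + 1 + n) * Real.exp (-m) ≤ Real.exp (1 / 2 * m) * Real.exp (-m) := by gcongr
    _ = _ := by rw [← Real.exp_add]; congr 1; ring

/-- A union bound over the columns of `S` with at least `τ` nonzero entries. -/
theorem card_mul_exp_le {n s k : ℕ} (hn : 0 < n) {τ : ℝ} (hτ : 0 < τ)
    (h : (n : ℝ) / τ * Real.log (s * n) < k) (J : Finset (Fin s)) :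
    J.card * Real.exp (-(k * τ / n)) ≤ 1 / n := by
  have hn' : (0 : ℝ) < n := by exact_mod_cast hn
  have hJ : (J.card : ℝ) ≤ s := by
    exact_mod_cast (Finset.card_le_univ J).trans_eq (Fintype.card_fin s)
  rcases Nat.eq_zero_or_pos s with hs | hs
  · have : (J.card : ℝ) = 0 := le_antisymm (by simpa [hs] using hJ) (by positivity)
    rw [this, zero_mul]; positivity
  have hs' : (0 : ℝ) < s := by exact_mod_cast hs
  have h1 : Real.log (s * n) ≤ k * τ / n := by
    rw [le_div_iff₀ hn']
    rw [div_mul_eq_mul_div, div_lt_iff₀ hτ] at h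
    linarith
  calc J.card * Real.exp (-(k * τ / n)) ≤ s * Real.exp (-Real.log (s * n)) := by gcongr
    _ = _ := by
        rw [Real.exp_neg, Real.exp_log (by positivity)]
        field_simp

section

variable {n p m s k t r : ℕ} {M : Matrix (Fin p) (Fin n) ℝ} {ε K : ℝ} {S : Matrix (Fin n) (Fin s) ℝ}

/-- When many normalized rows have large objective, the `S`-preconditioned Lasso fails on a random
combination of normalized rows. -/
theorem rowCombinationLaw_not_lassoFails_le [NeZero p] (hε : 0 < ε) (hpn : p ≤ n) (hn : 10 ≤ n)
    (ht : 0 < t) (hm : 0 < m) (hmn : 2 * m ≤ n) (hK : 0 < K)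
    {U : Submodule ℝ (EuclideanSpace ℝ (Fin n))} (hU : U ≤ kernel M)
    (hmU : 2 * m ≤ Module.finrank ℝ U) (hF : ∀ u ∈ U, objectiveSeminorm S u ≤ 2 * K * ‖u‖)
    {B : Finset (Fin p)} (hB : ∀ i ∈ B, 100 * ((n : ℝ) ^ 2 * √n) * (400 * (K * √ε * (n * √n))) ≤
      objectiveSeminorm S (normalizedRow M ε i))
    {b : ℝ} (hb0 : 0 < b) (hb : b ≤ B.card) {x : ℝ}
    (hx : x ≤ 1 - (2 * m + 2) * Real.exp (-m)) :
    rowCombinationLaw M ε t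
      {w | x ≤ (sampleLaw (covMat M ε) m).real {X | LassoFails S X w}}ᶜ ≤
      ENNReal.ofReal (Real.exp (-(b * t / p)) + 1 / n) := by
  have hn0 : (0 : ℝ) < n := by
    have : 0 < n := by omega
    exact_mod_cast this
  refine (measure_mono ?_).trans (rowCombinationLaw_seminorm_le (M := M) hε hpn hn ht
    (continuous_objectiveSeminorm S) (L := 400 * (K * √ε * (n * √n))) (by positivity) le_rfl hB
    hb0 hb)
  intro w hw
  by_contra hcon
  simp only [Set.mem_ofPred_eq, not_le] at hcon
  exact hw (hx.trans (measure_compl_le_real (by positivity)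
    (sampleLaw_not_lassoFails_le_of_large M S hε hK hm hU hmU hmn hF hcon)))

/-- When few normalized rows have large objective, the `S`-preconditioned Lasso fails on a sparse
Gaussian signal. -/
theorem sparseGaussianLaw_not_lassoFails_le {lam b' η τ : ℝ} (hε : 0 < ε)
    (hlam : IsSmallestNonzeroEigenvalue (Mᵀ * M) lam) (hpn : p ≤ n)
    (hn : (2 * 10 ^ 9 : ℝ) ≤ n) (hk : 0 < k) (hm : 0 < m) (hmn : 2 * m ≤ n)
    (hmr : 2 * m ≤ r) (hrk : r ≤ Module.finrank ℝ (kernel M)) (hK : 0 < K)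
    (hU : ∀ U ≤ kernel M, 2 * m ≤ Module.finrank ℝ U → ∃ u ∈ U, K * ‖u‖ < objectiveSeminorm S u)
    (hη : 0 < η) (hτ : 0 < τ)
    (hV : QuantitativelyDense (kernel M) (1 / (12 * √n)) (1 / (2 * √n)) b')
    (hηf : 1 < τ → 1 ≤ η * frobNorm M)
    (hsmall : 544 * (n : ℝ) ^ (15 / 2 : ℝ) * k * η * frobNorm M * √(ε / lam) ≤ 1)
    {B : Finset (Fin p)} (hB : ∀ i ∉ B, objectiveSeminorm S (normalizedRow M ε i) ≤
      100 * ((n : ℝ) ^ 2 * √n) * (400 * (K * √ε * (n * √n))))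
    {C : Finset (Fin n)} (hCb : (C.card : ℝ) ≤ b')
    (hC : ∀ x : EuclideanSpace ℝ (Fin n), τ ≤ ((supp x).card : ℝ) ∨
      ‖restrictCompl C x‖ ≤ η * ‖fun i : {i : Fin p // i ∉ B} => (M *ᵥ x.ofLp) i‖)
    (hs : (n : ℝ) / τ * Real.log (s * n) < k)
    {x : ℝ} (hx : x ≤ 1 - ((2 * m + 1 + n) * Real.exp (-m) + 4 * m / (3 * r))) :
    sparseGaussianLaw n k
      {w | x ≤ (sampleLaw (covMat M ε) m).real {X | LassoFails S X w}}ᶜ ≤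
      ENNReal.ofReal (2 / n + Real.exp (-(k * ((r : ℝ) - 2 * m) / n))) := by
  classical
  have hl := eigenvalue_pos M hlam
  have hn0 : (0 : ℝ) < n := by linarith
  have hn1 : 0 < n := by exact_mod_cast hn0
  have hk1 : (1 : ℝ) ≤ k := by exact_mod_cast hk
  have hk0 : (0 : ℝ) < k := by linarith
  have hN : 44000 ≤ √(n : ℝ) := Real.le_sqrt_of_sq_le (by linarith)
  have hN2 : √(n : ℝ) ^ 2 = n := Real.sq_sqrt hn0.le
  set F := objectiveSeminorm S with hF
  set γ₀ : ℝ := K / (2 * (n * √n)) with hγ₀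
  have hγ₀0 : 0 < γ₀ := by positivity
  set Γ := Finset.univ.filter fun i => K / √n < F (EuclideanSpace.single i 1) with hΓ
  set J := Finset.univ.filter fun j => τ ≤ ((supp (column S j)).card : ℝ) with hJ
  have hΓcard : (r : ℝ) - 2 * m ≤ Γ.card := by
    have h1 := finrank_lt_card_large_add (F := F) hK hn1 (kernel M) hU
    have h2 : r ≤ Γ.card + 2 * m := (hrk.trans_lt h1).le
    have h3 : (r : ℝ) ≤ Γ.card + 2 * m := by exact_mod_cast h2
    linarith
  have hq : Real.exp (-(k * Γ.card / n)) + J.card * Real.exp (-(k * τ / n)) + 1 / n ≤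
      2 / n + Real.exp (-(k * ((r : ℝ) - 2 * m) / n)) := by
    have h1 := card_mul_exp_le hn1 hτ hs J
    have h2 : Real.exp (-(k * Γ.card / n)) ≤ Real.exp (-(k * ((r : ℝ) - 2 * m) / n)) := by
      gcongr
    have h3 : (2 / n : ℝ) = 1 / n + 1 / n := by ring
    linarith
  refine le_trans ?_ (ENNReal.ofReal_le_ofReal hq)
  refine (measure_mono ?_).trans (sparseGaussianLaw_atypical_le hn1 hk
    (continuous_objectiveSeminorm S) hγ₀0 Γ (fun i hi => ?_) J (column S)
    fun j hj => (Finset.mem_filter.1 hj).2)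
  swap
  · have h1 := (Finset.mem_filter.1 hi).2.le
    have h2 : 2 * n * γ₀ = K / √n := by rw [hγ₀]; field_simp
    rwa [h2]
  intro w hw
  by_contra hcon
  simp only [Set.mem_ofPred_eq, not_or, not_exists, not_and, not_lt] at hcon
  obtain ⟨hwJ, hwF, hwn⟩ := hcon
  refine hw (hx.trans (measure_compl_le_real (by positivity) ?_))
  have hF0 : 0 < F w := hγ₀0.trans_le hwF
  have hw0 : w ≠ 0 := by
    rintro rfl
    simp at hF0
  have hsparse : ∀ j, inner ℝ (column S j) w = 0 → ((supp (column S j)).card : ℝ) < τ := by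
    intro j hj
    by_contra! h
    exact hwJ j (Finset.mem_filter.2 ⟨Finset.mem_univ _, h⟩) hj
  -- For `τ ≤ 1` robustness says nothing, but then the sparse columns vanish.
  rcases le_or_gt τ 1 with hτ1 | hτ1
  · refine sampleLaw_not_lassoFails_le_of_dense M S hε hm hmr hrk hF0 fun j hj => ?_
    have h1 := (hsparse j hj).trans_le hτ1
    have h2 : (supp (column S j)).card = 0 := by
      have : (supp (column S j)).card < 1 := by exact_mod_cast h1
      omega
    ext i
    by_contra hi
    have : i ∈ supp (column S j) := Finset.mem_filter.2 ⟨Finset.mem_univ _, hi⟩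
    rw [Finset.card_eq_zero.1 h2] at this
    simp at this
  · rw [rpow_fifteen_half] at hsmall
    have hf : 0 ≤ frobNorm M := Real.sqrt_nonneg _
    have hκγ := sparse_mass_le hN hk1 hK hη hf hε hsmall
    have hδ := residual_factor_le (y := η * frobNorm M) hN hk1 (hηf hτ1)
      (Real.sqrt_nonneg (ε / lam))
      (by linarith)
    rw [hN2] at hκγ hδ
    refine sampleLaw_not_lassoFails_le_of_typical M S hε hlam hm hmn hmr hrk hV hCb
      (γ := γ₀ / √(2 * n * k)) (by positivity) hκγ hδ hw0 ?_
      (sum_norm_restrictCompl_column_le M S hε hlam hpn hη (by positivity) hC hB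
        fun j hj => hsparse j (Finset.mem_filter.1 hj).2)
    calc γ₀ / √(2 * n * k) * ‖w‖ ≤ γ₀ / √(2 * n * k) * √(2 * n * k) := by
          gcongr
          exact Real.le_sqrt_of_sq_le hwn
      _ = γ₀ := by field_simp
      _ ≤ F w := hwF

end

end Main

end PrecLasso

theorem mainTheorem7 :
    ∃ c cm c₀ : ℝ, 0 < c ∧ 0 < cm ∧ 0 < c₀ ∧
      ∀ (n r : ℕ) (_ : r ≤ n) (M : Matrix (Fin (n - r)) (Fin n) ℝ)
        (k k' m t : ℕ) (_ : 0 < k) (_ : 0 < k') (_ : 0 < m) (_ : 0 < t)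
        (τ b b' η lam ε : ℝ) (_ : 0 < τ) (_ : 0 < b) (_ : 0 < b') (_ : 0 < η) (_ : 0 < ε)
        (_ : PrecLasso.IsSmallestNonzeroEigenvalue (Mᵀ * M) lam)
        (_ : PrecLasso.ErasureRobust M b b' η τ)
        (_ : PrecLasso.QuantitativelyDense (PrecLasso.kernel M)
          (1 / (12 * Real.sqrt n)) (1 / (2 * Real.sqrt n)) b')
        (_ : 544 * (n : ℝ) ^ (15 / 2 : ℝ) * k * η * PrecLasso.frobNorm M * Real.sqrt (ε / lam) ≤ 1)
        (_ : 2 * m < r)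
        (_ : cm * Real.log n ≤ m)
        (_ : ε < c * lam / (n : ℝ) ^ 2)
        (_ : ∀ i, (PrecLasso.supp (WithLp.toLp 2 (M i))).card ≤ k'),
      IsProbabilityMeasure (PrecLasso.signalLaw M ε k t) ∧
      (∀ᵐ w ∂(PrecLasso.signalLaw M ε k t), (PrecLasso.supp w).card ≤ max (k' * t) k) ∧
      ∀ (s : ℕ) (S : Matrix (Fin n) (Fin s) ℝ), PrecLasso.IsPreconditioner S →
        (n : ℝ) / τ * Real.log ((s : ℝ) * n) < k →
        1 / 2 * min (1 - Real.exp (-(b * t / ((n : ℝ) - r))) - 1 / n)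
            (1 - 2 / n - k * b' / n - Real.exp (-(k * ((r : ℝ) - 2 * m) / n))) ≤
          (PrecLasso.signalLaw M ε k t).real
            {w | 1 - 4 * m / (3 * r) - Real.exp (-(c₀ * m)) ≤
              (PrecLasso.sampleLaw (PrecLasso.covMat M ε) m).real
                {X | PrecLasso.LassoFails S X w}} := by
  refine ⟨1, 10 ^ 10, 1 / 2, one_pos, by norm_num, by norm_num, ?_⟩
  intro n r hrn M k k' m t hk _ hm ht τ b b' η lam ε hτ hb _ hη hε hlam hrob hV hsmall hmr hcm _ hsp
  have hp := PrecLasso.pos_of_isSmallestNonzeroEigenvalue hlam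
  have : NeZero (n - r) := ⟨hp.ne'⟩
  refine ⟨inferInstance, PrecLasso.ae_signalLaw_card_supp_le hsp, fun s S hS hs => ?_⟩
  have hn3 : 3 ≤ n := by omega
  have hmn : 2 * m < n := by omega
  have hn3' : (3 : ℝ) ≤ n := by exact_mod_cast hn3
  have hmn' : (2 * m : ℝ) < n := by exact_mod_cast hmn
  have hr0 : (0 : ℝ) < r := by
    have : 0 < r := by omega
    exact_mod_cast this
  -- `m ≥ 10 ^ 10 log n` makes `n > 2 m` large enough to absorb all numerical constants
  have hlog : 1 ≤ Real.log n := by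
    rw [Real.le_log_iff_exp_le (by linarith)]
    linarith [Real.exp_one_lt_d9]
  have hnbig : (2 * 10 ^ 9 : ℝ) ≤ n := by linarith
  have hn10 : 10 ≤ n := by
    have : (10 : ℝ) ≤ n := by linarith
    exact_mod_cast this
  have hrk : r ≤ Module.finrank ℝ (PrecLasso.kernel M) := by
    have := PrecLasso.le_finrank_kernel M
    omega
  have hpn : n - r ≤ n := Nat.sub_le _ _
  have hpcast : ((n - r : ℕ) : ℝ) = n - r := Nat.cast_sub hrn
  have hexp := PrecLasso.mul_exp_neg_le hn3 hmn hcm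
  obtain ⟨K, hK, ⟨U, hU, hmU, hUF⟩, hKU⟩ := PrecLasso.exists_width
    (PrecLasso.continuous_objectiveSeminorm S)
    (fun x hx => PrecLasso.eq_zero_of_objective_eq_zero hS hx) (PrecLasso.kernel M)
    (d := 2 * m) (by omega) (by omega)
  classical
  -- the rows on which the objective is large
  set B : Finset (Fin (n - r)) := Finset.univ.filter fun i =>
    100 * ((n : ℝ) ^ 2 * √n) * (400 * (K * √ε * (n * √n))) ≤
      PrecLasso.objectiveSeminorm S (PrecLasso.normalizedRow M ε i) with hB
  rcases le_total b B.card with hbB | hbB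
  · refine PrecLasso.half_le_signalLaw_of_rowCombinationLaw (by positivity)
      (PrecLasso.rowCombinationLaw_not_lassoFails_le hε hpn hn10 ht hm hmn.le hK hU hmU hUF
        (fun i hi => (Finset.mem_filter.1 hi).2) hb hbB ?_)
      ((min_le_left _ _).trans (le_of_eq ?_))
    · have h1 : (2 * m + 2) * Real.exp (-m) ≤ (2 * m + 1 + n) * Real.exp (-m) :=
        mul_le_mul_of_nonneg_right (by linarith) (Real.exp_pos _).le
      have h2 : (0 : ℝ) ≤ 4 * m / (3 * r) := by positivity
      linarith
    · rw [hpcast]; ring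
  · rcases le_or_gt (n : ℝ) b' with hb' | hb'
    · refine le_trans ?_ measureReal_nonneg
      -- for `b' ≥ n` the claimed lower bound is not positive
      refine mul_nonpos_of_nonneg_of_nonpos (by norm_num) ((min_le_right _ _).trans ?_)
      have h1 : 1 ≤ k * b' / n := by
        rw [le_div_iff₀ (by linarith), one_mul]
        have : (1 : ℝ) ≤ k := by exact_mod_cast hk
        nlinarith
      have h2 : (0 : ℝ) ≤ 2 / n := by positivity
      have h3 := Real.exp_pos (-(k * ((r : ℝ) - 2 * m) / n))
      linarith
    · obtain ⟨C, hCb, hC⟩ := hrob B hbB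
      refine PrecLasso.half_le_signalLaw_of_sparseGaussianLaw (by positivity)
        (PrecLasso.sparseGaussianLaw_not_lassoFails_le hε hlam hpn hnbig hk hm hmn.le hmr.le hrk hK
          hKU hη hτ hV (fun h => PrecLasso.one_le_mul_frobNorm M hb hη h hb' hrob) hsmall
          (fun i hi => ?_) hCb hC hs (by linarith)) ((min_le_right _ _).trans ?_)
      · exact (not_le.1 fun h => hi (Finset.mem_filter.2 ⟨Finset.mem_univ _, h⟩)).le
      · have : (0 : ℝ) ≤ k * b' / n := by positivity
        linarith
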